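/- **Theorem (Cubature formula).** Consider a compact, connected, simply connected simple Lie group of rank $n$, of type $A_n$ ($n\ge1$), $B_n$ ($n\ge3$), $C_n$ ($n\ge2$), $D_n$ ($n\ge4$), $E_6,E_7,E_8,F_4$ or $G_2$, given through its (irreducible, reduced, crystallographic) root system in $\mathbb R^n$ with simple roots $\alpha_1,\dots,\alpha_n$ and simple coroots $\alpha_i^\vee=2\alpha_i/\langle\alpha_i,\alpha_i\rangle$. The simple roots are numbered so that in type $A_n$ they form a chain $1,\dots,n$, in type $D_n$ the last two nodes are the two end nodes of the fork at node $n-2$, and in type $E_6$ the nodes $1,\dots,5$ form a chain and node $6$ is joined to node $3$; in the other types any fixed numbering may be used. Notation. Let $\omega_i,\omega_i^\vee$ be defined by $\langle\omega_i,\alpha_j^\vee\rangle=\delta_{ij}=\langle\omega_i^\vee,\alpha_j\rangle$ and put $\rho=\omega_1+\dots+\omega_n$. Let $m_j$ be the coefficients of the highest root in the $\alpha_j$, and $m_j^\vee$ those of the highest root of the dual root system in the $\alpha_j^\vee$. Let $W$ be the Weyl group, $c$ the determinant of the Cartan matrix, and $Q^\vee=\sum_j\mathbb Z\alpha_j^\vee$.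 For $x\in\mathbb R^n$ put $$C_\lambda(x)=\sum_{\nu\in W\lambda}e^{2\pi i\langle\nu,x\rangle},\qquad Z_j=C_{\omega_j},\qquad S_\rho(x)=\sum_{w\in W}\det(w)\,e^{2\pi i\langle w\rho,x\rangle},$$ and let $\varepsilon(x)$ be the number of points in the $W$-orbit of $x+Q^\vee$ in $\mathbb R^n/Q^\vee$. Define an involution $\sigma$ of $\{1,\dots,n\}$ by $\sigma(j)=n+1-j$ in type $A_n$; $\sigma$ exchanges $n-1$ and $n$ in type $D_n$ with $n$ odd; $\sigma$ exchanges $1\leftrightarrow5$ and $2\leftrightarrow4$ in type $E_6$; $\sigma$ is the identity otherwise. The map $X=(X_1,\dots,X_n)$ is given by $$X_j=Z_j\ \text{ if }\sigma(j)=j,\qquad X_j=\frac{Z_j+Z_{\sigma(j)}}2\ \text{ if }j<\sigma(j),\qquad X_j=\frac{Z_{\sigma(j)}-Z_j}{2i}\ \text{ if }j>\sigma(j).$$ Let $\kappa=2^{-\lfloor n/2\rfloor}$ in type $A_n$, $\kappa=\tfrac12$ in type $D_n$ with $n$ odd, $\kappa=\tfrac14$ in type $E_6$, and $\kappa=1$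 otherwise. For an integer $M\ge1$ let $$F=\Big\{\sum_j y_j\omega_j^\vee:\ y_0,\dots,y_n\in\mathbb R_{\ge0},\ y_0+\sum_j m_jy_j=1\Big\},\qquad F_M=\Big\{\sum_j\frac{u_j}{M}\omega_j^\vee:\ u_0,\dots,u_n\in\mathbb Z_{\ge0},\ u_0+\sum_j m_ju_j=M\Big\},$$ and $\Omega=X(F)$, $\Omega_M=X(F_M)$. The $m$-degree of a polynomial in $\mathbb C[y_1,\dots,y_n]$ is the largest value of $\sum_j\lambda_jm_j^\vee$ over the monomials $y_1^{\lambda_1}\cdots y_n^{\lambda_n}$ occurring in it. Claim. The functions $X_j$ are real-valued; there is a unique polynomial $K\in\mathbb C[y_1,\dots,y_n]$ with $|S_\rho|^2=K(X_1,\dots,X_n)$ on $\mathbb R^n$; and for every integer $M\ge1$ the set $F_M$ is finite and $X$ is injective on $F_M$, so that $\widetilde\varepsilon(X(x))=\varepsilon(x)$, $x\in F_M$, defines $\widetilde\varepsilon$ on $\Omega_M$. For every $M\ge1$ and every $p\in\mathbb C[y_1,\dots,y_n]$ of $m$-degree at most $2M-1$ (including $p=0$), the function $pK^{-1/2}$ is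 integrable on $\Omega$ and $$\int_\Omega p(y)\,K(y)^{-1/2}\,dy=\frac{\kappa}{c\,|W|}\Big(\frac{2\pi}{M}\Big)^n\sum_{y\in\Omega_M}\widetilde\varepsilon(y)\,p(y).$$ -/

import Mathlib

open MeasureTheory

namespace OrbitCubature

noncomputable section

/-! ### The types of compact simple Lie groups -/

/-- The types of simple Lie algebras of rank `n`, each isomorphism type listed once. -/
inductive SimpleType : ℕ → Type
  | A (n : ℕ) (h : 1 ≤ n) : SimpleType n
  | B (n : ℕ) (h : 3 ≤ n) : SimpleType n
  | C (n : ℕ) (h : 2 ≤ n) : SimpleType n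
  | D (n : ℕ) (h : 4 ≤ n) : SimpleType n
  | E6 : SimpleType 6
  | E7 : SimpleType 7
  | E8 : SimpleType 8
  | F4 : SimpleType 4
  | G2 : SimpleType 2

namespace SimpleType

/-- The Cartan matrix `⟨αᵢ, αⱼ^∨⟩` of each type, in a fixed numbering of the simple roots. Type
`A` is a chain, in type `D` the last two nodes are the end nodes of the fork, and in type `E6`
the first five nodes form a chain and the sixth one is joined to the third. -/
def cartanMatrix : {n : ℕ} → SimpleType n → Matrix (Fin n) (Fin n) ℤ
  | _, .A n _ => CartanMatrix.A n
  | _, .B n _ => CartanMatrix.B n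
  | _, .C n _ => CartanMatrix.C n
  | _, .D n _ => CartanMatrix.D n
  | _, .E6 =>
    !![ 2, -1,  0,  0,  0,  0;
       -1,  2, -1,  0,  0,  0;
        0, -1,  2, -1,  0, -1;
        0,  0, -1,  2, -1,  0;
        0,  0,  0, -1,  2,  0;
        0,  0, -1,  0,  0,  2]
  | _, .E7 => CartanMatrix.E₇
  | _, .E8 => CartanMatrix.E₈
  | _, .F4 => CartanMatrix.F₄
  | _, .G2 => CartanMatrix.G₂

/-- The pairing of the indices used in the real `X`-transform: reversal of the chain in type `A`,
exchange of the last two indices in type `D` of odd rank, `1 ↔ 5` and `2 ↔ 4` in type `E6`, and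
trivial otherwise. -/
def partner : {n : ℕ} → SimpleType n → Fin n → Fin n
  | _, .A _ _ => Fin.rev
  | _, .D n h =>
    if Even n then id else Equiv.swap ⟨n - 2, by omega⟩ ⟨n - 1, by omega⟩
  | _, .E6 => ![4, 3, 2, 1, 0, 5]
  | _, _ => id

/-- The constant `κ`. -/
def kappa : {n : ℕ} → SimpleType n → ℝ
  | _, .A n _ => (1 / 2 : ℝ) ^ (n / 2)
  | _, .D n _ => if Even n then 1 else 1 / 2
  | _, .E6 => 1 / 4
  | _, _ => 1

end SimpleType

/-! ### Root systems

`V` contains the roots and weights and `N` the coroots and coweights; the scalar product of the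
two is the pairing `P.toLinearMap : V → N → ℝ` of the root system. -/

section RootData

variable {n : ℕ} {ι V N : Type*} [AddCommGroup V] [Module ℝ V] [AddCommGroup N] [Module ℝ N]
  {P : RootPairing ι ℝ V N}

/-- The `i`-th root is the highest one: all the others arise from it by subtracting
simple roots. -/
def IsHighestRoot (b : P.Base) (i : ι) : Prop :=
  ∀ k, P.root i - P.root k ∈ AddSubmonoid.closure (P.root '' b.support)

open Classical in
/-- The highest root (`0` if there is none; for irreducible finite root systems it exists). -/
def highestRoot (b : P.Base) : V :=
  if h : ∃ i, IsHighestRoot b i then P.root h.choose else 0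

/-- The highest dual root `η`: the highest root of the dual root system. -/
def highestDualRoot (b : P.Base) : N :=
  highestRoot b.flip

variable [P.IsRootSystem]

/-- The fundamental weights: the basis of `V` dual to the simple coroots. -/
def fundamentalWeight (b : P.Base) (i : b.support) : V :=
  P.toLinearMap.toPerfPair.symm (b.toCoweightBasis.coord i)

/-- The fundamental coweights: the basis of `N` dual to the simple roots. -/
def fundamentalCoweight (b : P.Base) (i : b.support) : N :=
  P.toLinearMap.flip.toPerfPair.symm (b.toWeightBasis.coord i)

open Classical in
theorem fundamentalWeight_coroot (b : P.Base) (i j : b.support) :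
    P.toLinearMap (fundamentalWeight b i) (P.coroot j) = if i = j then 1 else 0 := by
  rw [fundamentalWeight, LinearMap.apply_symm_toPerfPair_self, Module.Basis.coord_apply,
    RootPairing.Base.toCoweightBasis_repr_coroot, Finsupp.single_apply]
  simp only [eq_comm]

open Classical in
theorem root_fundamentalCoweight (b : P.Base) (i j : b.support) :
    P.toLinearMap (P.root j) (fundamentalCoweight b i) = if i = j then 1 else 0 := by
  rw [fundamentalCoweight, LinearMap.apply_toPerfPair_flip, Module.Basis.coord_apply,
    RootPairing.Base.toWeightBasis_repr_root, Finsupp.single_apply]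
  simp only [eq_comm]

/-- The vector `ρ`, the sum of the fundamental weights. -/
def rho (b : P.Base) : V := ∑ i, fundamentalWeight b i

/-- The marks `mⱼ`: the coefficients of the highest root in the simple roots. -/
def mark (b : P.Base) (e : Fin n ≃ b.support) (j : Fin n) : ℝ :=
  b.toWeightBasis.repr (highestRoot b) (e j)

/-- The dual marks `mⱼ^∨`: the coefficients of the highest dual root in the simple coroots. -/
def dualMark (b : P.Base) (e : Fin n ≃ b.support) (j : Fin n) : ℝ :=
  b.toCoweightBasis.repr (highestDualRoot b) (e j)

/-! ### Orbit functions -/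

variable (P) in
/-- The exponential `x ↦ exp (2 π i ⟨ν, x⟩)`. -/
def expFun (ν : V) (x : N) : ℂ :=
  Complex.exp (2 * Real.pi * Complex.I * (P.toLinearMap ν x : ℂ))

variable (P) in
/-- The symmetric orbit function `C_λ`: the sum of `expFun ν` over the Weyl orbit of `λ`. -/
def orbitC (lam : V) (x : N) : ℂ :=
  ∑ᶠ ν ∈ MulAction.orbit P.weylGroup lam, expFun P ν x

variable (P) in
/-- The antisymmetric orbit function `S_λ`. -/
def orbitS (lam : V) (x : N) : ℂ :=
  ∑ᶠ w : P.weylGroup,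
    ((LinearMap.det (P.weylGroupRootRep w) : ℝ) : ℂ) * expFun P (w • lam) x

/-- `Z_j`, the orbit function of the `j`-th fundamental weight. -/
def orbitZ (b : P.Base) (e : Fin n ≃ b.support) (j : Fin n) (x : N) : ℂ :=
  orbitC P (fundamentalWeight b (e j)) x

/-- The functions `X_j`, as complex expressions in the `Z_j`. -/
def complexX (T : SimpleType n) (b : P.Base) (e : Fin n ≃ b.support) (x : N) (j : Fin n) : ℂ :=
  if T.partner j = j then orbitZ b e j x
  else if j < T.partner j then (orbitZ b e j x + orbitZ b e (T.partner j) x) / 2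
  else (orbitZ b e (T.partner j) x - orbitZ b e j x) / (2 * Complex.I)

/-- The `X`-transform. The expressions `complexX` are real, so that taking the real part only
changes the codomain. -/
def transformX (T : SimpleType n) (b : P.Base) (e : Fin n ≃ b.support) (x : N) : Fin n → ℝ :=
  fun j => (complexX T b e x j).re

/-! ### Domains, nodes and weights -/

/-- The fundamental simplex `F` of the affine Weyl group. -/
def simplexF (b : P.Base) (e : Fin n ≃ b.support) : Set N :=
  {x | ∃ (y₀ : ℝ) (y : Fin n → ℝ), 0 ≤ y₀ ∧ (∀ j, 0 ≤ y j) ∧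
    y₀ + ∑ j, y j * mark b e j = 1 ∧ x = ∑ j, y j • fundamentalCoweight b (e j)}

/-- The grid `F_M` in `F`. -/
def gridF (b : P.Base) (e : Fin n ≃ b.support) (M : ℕ) : Set N :=
  {x | ∃ (u₀ : ℕ) (u : Fin n → ℕ),
    (u₀ : ℝ) + ∑ j, (u j : ℝ) * mark b e j = M ∧
    x = ∑ j, ((u j : ℝ) / M) • fundamentalCoweight b (e j)}

/-- The integration domain `Ω = X(F)`. -/
def domainOmega (T : SimpleType n) (b : P.Base) (e : Fin n ≃ b.support) : Set (Fin n → ℝ) :=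
  transformX T b e '' simplexF b e

/-- The nodes `Ω_M = X(F_M)`. -/
def nodesOmega (T : SimpleType n) (b : P.Base) (e : Fin n ≃ b.support) (M : ℕ) :
    Set (Fin n → ℝ) :=
  transformX T b e '' gridF b e M

/-- The dual root lattice `Q^∨`. -/
def corootLattice (b : P.Base) : AddSubgroup N :=
  AddSubgroup.closure (P.coroot '' b.support)

/-- `ε(x)`, the number of points in the orbit of `x + Q^∨` under the Weyl group acting on the
torus `N / Q^∨`. In Mathlib the Weyl group acts on `N` from the right. -/
def orbitSize (b : P.Base) (x : N) : ℕ :=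
  ((QuotientAddGroup.mk : N → N ⧸ corootLattice b) ''
    MulAction.orbit P.weylGroup.op x).ncard

/-- `ε̃(y) = ε(X_M⁻¹ y)` for `y ∈ Ω_M`, where `X_M` is the restriction of `X` to `F_M`. -/
def nodeSize (T : SimpleType n) (b : P.Base) (e : Fin n ≃ b.support) (M : ℕ) (y : Fin n → ℝ) :
    ℕ :=
  orbitSize b (Function.invFunOn (transformX T b e) (gridF b e M) y)

/-- The `m`-degree of `p` is at most `d`: every monomial `y₁^λ₁ ⋯ yₙ^λₙ` occurring in `p`
has `λ₁ m₁^∨ + ⋯ + λₙ mₙ^∨ ≤ d`. -/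
def MDegreeLE (b : P.Base) (e : Fin n ≃ b.support) (p : MvPolynomial (Fin n) ℂ) (d : ℝ) : Prop :=
  ∀ lam ∈ p.support, ∑ j, (lam j : ℝ) * dualMark b e j ≤ d

/-- The value of a complex polynomial at a real point. -/
def evalReal (p : MvPolynomial (Fin n) ℂ) (y : Fin n → ℝ) : ℂ :=
  MvPolynomial.eval (fun j => (y j : ℂ)) p

/-- `K` is a polynomial with `|S_ρ|² = K(X₁, …, Xₙ)`. -/
def IsWeightPolynomial (T : SimpleType n) (b : P.Base) (e : Fin n ≃ b.support)
    (K : MvPolynomial (Fin n) ℂ) : Prop :=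
  ∀ x : N, evalReal K (transformX T b e x) = ((‖orbitS P (rho b) x‖ ^ 2 : ℝ) : ℂ)

end RootData

end

end OrbitCubature

open OrbitCubature

set_option linter.unusedSectionVars false

/-! Both sides of the cubature formula are multiples of one number: the constant term, i.e. the
coefficient of exp(0), of the exponential sum f = p(X_1, ..., X_n).

The integral. In coordinates along the simple coroots, the matrix of derivatives of the Z_j has a
determinant which, up to the factor (2πi)^n, is W-anti-invariant with leading term exp(ρ). Such a
sum can only be S_ρ (`eq_smul_alternatingSum`, `det_jacobian`). Passing from the Z_j to the X_j
contributes a constant matrix whose determinant has modulus κ (`norm_det_mixMatrix`). Hence the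
Jacobian of X is κ (2π)^n |S_ρ|, which cancels K^(-1/2), and since X is injective on F the integral
over Ω becomes κ (2π)^n times the integral of f over F. The alcove F is a fundamental domain of W ⋉
Q^∨, and in these coordinates Q^∨ is the integer lattice, so the integral of f over F is the
constant term divided by |W| (`card_mul_integral_openAlcove`).

The sum. The W-orbits of the points of F_M partition the finite group (1/M)P^∨/Q^∨, where P^∨ is the
coweight lattice. This group has order c M^n, and ε counts the points of each orbit. The weighted
sum is therefore the sum of f over that group, where only exponents in MQ survive, Q being the root
lattice. The bound on the m-degree says that every exponent pairs with every coroot to at most 2M -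
1. If the exponent is Mβ with β in Q, then β pairs with all coroots to -1, 0 or 1, and this forces β
= 0 (`eq_zero_of_small`, `exists_gridLattice_ne_one`).

Supporting facts. The X_j are real because -ω_j is W-conjugate to ω_σ(j): opposition is a diagram
symmetry with ω_j + ω_σ(j) in Q, and these two properties determine it in each type
(`partner_unique`). The polynomial K exists because invariant exponential sums are polynomials in
the Z_j (`mem_adjoin_fundSum`), and is unique because the image of X contains an open set. X is
injective on F because invariants separate the orbits of the affine Weyl group
(`affWeylEquiv_of_evalExp_eq`) and the alcove meets each orbit once (`eq_of_affWeylEquiv`). -/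

namespace OrbitCubature

/-! ### The Weyl group -/

section Weyl

open RootPairing (weylGroup)

variable {ι V N : Type*} [AddCommGroup V] [Module ℝ V] [AddCommGroup N] [Module ℝ N]
  {P : RootPairing ι ℝ V N}

/-- The transposed action of a Weyl group element on the coweight space. -/
noncomputable def coact (w : P.weylGroup) : N ≃ₗ[ℝ] N :=
  RootPairing.Equiv.coweightEquiv P P w.1

theorem pairing_smul (w : P.weylGroup) (v : V) (x : N) :
    P.toLinearMap (w • v) x = P.toLinearMap v (coact w x) := by
  have h := LinearMap.congr_fun (w.1.toHom.weight_coweight_transpose_apply P P x) v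
  simpa using! h

theorem pairing_sub_smul (v v' : V) (c : ℝ) (x : N) :
    P.toLinearMap (v - c • v') x = P.toLinearMap v x - c * P.toLinearMap v' x := by
  simp only [map_sub, map_smul, LinearMap.sub_apply, LinearMap.smul_apply, smul_eq_mul]

@[simp] theorem coact_one (x : N) : coact (1 : P.weylGroup) x = x := rfl

/-- Transposition reverses products, so `coact` is a right action. This fixes the order of factors
in all later computations on `N`. -/
theorem coact_mul (w w' : P.weylGroup) (x : N) : coact (w * w') x = coact w' (coact w x) := rfl

@[simp] theorem coact_coact_inv (w : P.weylGroup) (x : N) : coact w (coact w⁻¹ x) = x := by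
  rw [← coact_mul, inv_mul_cancel, coact_one]

@[simp] theorem coact_inv_coact (w : P.weylGroup) (x : N) : coact w⁻¹ (coact w x) = x := by
  rw [← coact_mul, mul_inv_cancel, coact_one]

theorem orbit_op_eq (x : N) :
    MulAction.orbit P.weylGroup.op x = Set.range fun w : P.weylGroup => coact w x := by
  ext y
  constructor
  · rintro ⟨w, rfl⟩
    exact ⟨⟨MulOpposite.unop w.1, w.2⟩, rfl⟩
  · rintro ⟨w, rfl⟩
    exact ⟨⟨MulOpposite.op w.1, w.2⟩, rfl⟩

theorem weyl_ext {w w' : P.weylGroup} (h : ∀ v : V, w • v = w' • v) : w = w' := by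
  apply Subtype.ext
  apply RootPairing.Equiv.weightHom_injective P
  ext v
  exact h v

theorem weyl_ext' {w w' : P.weylGroup} (h : ∀ x : N, coact w x = coact w' x) : w = w' := by
  refine weyl_ext fun v => P.toLinearMap.toPerfPair.injective ?_
  ext x
  simp only [LinearMap.toPerfPair_apply, pairing_smul, h]

theorem smul_root (w : P.weylGroup) (i : ι) : w • P.root i = P.root (w • i) :=
  (RootPairing.Equiv.root_indexEquiv_eq_smul P i w.1).symm

theorem coact_coroot_smul (w : P.weylGroup) (i : ι) : coact w (P.coroot (w • i)) = P.coroot i := by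
  have h := congr_fun w.1.toHom.coroot_coweightMap (w • i)
  have h2 : w.1.toHom.indexEquiv.symm (w • i) = i := by
    rw [Equiv.symm_apply_eq]; rfl
  simp only [Function.comp_apply, h2] at h
  exact h

theorem coact_coroot (w : P.weylGroup) (i : ι) : coact w (P.coroot i) = P.coroot (w⁻¹ • i) := by
  conv_lhs => rw [← smul_inv_smul w i]
  exact coact_coroot_smul w _

theorem smul_root_coroot (w : P.weylGroup) (v : V) (i : ι) :
    P.toLinearMap (w • v) (P.coroot i) = P.toLinearMap v (P.coroot (w⁻¹ • i)) := by
  rw [pairing_smul, coact_coroot]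

theorem root_smul_coact (w : P.weylGroup) (x : N) (i : ι) :
    P.toLinearMap (P.root i) (coact w x) = P.toLinearMap (P.root (w • i)) x := by
  rw [← pairing_smul, smul_root]

variable (P) in
/-- The reflection in the `i`-th root. -/
noncomputable abbrev refl (i : ι) : P.weylGroup := RootPairing.weylGroup.ofIdx P i

theorem refl_smul (i : ι) (v : V) :
    refl P i • v = v - P.toLinearMap v (P.coroot i) • P.root i :=
  P.reflection_apply i v

theorem coact_refl (i : ι) (x : N) :
    coact (refl P i) x = x - P.toLinearMap (P.root i) x • P.coroot i :=
  P.coreflection_apply i x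

theorem refl_smul_index (i j : ι) : refl P i • j = P.reflectionPerm i j := rfl

@[simp] theorem refl_mul_self (i : ι) : refl P i * refl P i = 1 := by
  refine weyl_ext fun v => ?_
  rw [mul_smul, refl_smul, refl_smul, one_smul]
  simp
  module

@[simp] theorem refl_inv (i : ι) : (refl P i)⁻¹ = refl P i :=
  inv_eq_of_mul_eq_one_left (refl_mul_self i)

theorem refl_conj (w : P.weylGroup) (i : ι) : refl P (w • i) = w * refl P i * w⁻¹ := by
  refine weyl_ext fun v => ?_
  rw [mul_smul, mul_smul, refl_smul, refl_smul, smul_sub, smul_inv_smul, ← smul_root,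
    smul_root_coroot, inv_inv]
  congr 1
  exact (smul_comm w.1 (P.toLinearMap v (P.coroot (w • i))) (P.root i)).symm

theorem smul_smul_real (w : P.weylGroup) (c : ℝ) (v : V) : w • (c • v) = c • (w • v) :=
  smul_comm w.1 c v

theorem smul_neg_index (w : P.weylGroup) (i : ι) :
    w • P.reflectionPerm i i = P.reflectionPerm (w • i) (w • i) := by
  apply P.root.injective
  rw [← smul_root, P.root_reflectionPerm, P.root_reflectionPerm, P.reflection_apply_self,
    P.reflection_apply_self, smul_neg, smul_root]

theorem refl_reflectionPerm_self (i : ι) : refl P (P.reflectionPerm i i) = refl P i := by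
  rw [← refl_smul_index, refl_conj, refl_mul_self, one_mul, refl_inv]

theorem root_reflectionPerm_self' (i : ι) : P.root (P.reflectionPerm i i) = - P.root i := by
  rw [P.root_reflectionPerm, P.reflection_apply_self]

theorem coroot_reflectionPerm_self' (i : ι) : P.coroot (P.reflectionPerm i i) = - P.coroot i :=
  root_reflectionPerm_self' (P := P.flip) i

/-- The roots span `V`, so a Weyl group element is determined by its permutation of the finite index
set. -/
instance [Finite ι] [P.IsRootSystem] : Finite P.weylGroup := by
  refine Finite.of_injective (fun w : P.weylGroup => (fun i : ι => w • i)) fun w w' h => ?_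
  refine weyl_ext fun v => ?_
  have hv : v ∈ Submodule.span ℝ (Set.range P.root) := by
    rw [RootPairing.IsRootSystem.span_root_eq_top]; trivial
  induction hv using Submodule.span_induction with
  | mem x hx =>
    obtain ⟨i, rfl⟩ := hx
    rw [smul_root, smul_root]
    exact congr_arg _ (congr_fun h i)
  | zero => simp
  | add x y _ _ hx hy => rw [smul_add, smul_add, hx, hy]
  | smul a x _ hx => rw [smul_smul_real, smul_smul_real, hx]

/-! ### Words in the simple reflections and the exchange condition -/

section Base

variable [Finite ι] [P.IsCrystallographic] [P.IsReduced] (b : P.Base)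

/-- Every root is reached from a simple one by simple reflections, and the reflection in w • α is
the conjugate by w. A submonoid suffices since reflections are involutions, so words need no
inverses. -/
theorem closure_simple_eq_top :
    Submonoid.closure (Set.range fun i : b.support => refl P i) = ⊤ := by
  set H := Submonoid.closure (Set.range fun i : b.support => refl P i)
  have h1 (i : ι) : refl P i ∈ H := by
    refine b.induction_reflect i (p := fun i => refl P i ∈ H) ?_ ?_ ?_
    · intro j hj
      rwa [refl_reflectionPerm_self]
    · exact fun j hj => Submonoid.subset_closure ⟨⟨j, hj⟩, rfl⟩
    · intro j k hj hk
      have hk' : refl P k ∈ H := Submonoid.subset_closure ⟨⟨k, hk⟩, rfl⟩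
      rw [← refl_smul_index, refl_conj, refl_inv]
      exact mul_mem (mul_mem hk' hj) hk'
  rw [eq_top_iff]
  rintro ⟨w, hw⟩ -
  induction hw using RootPairing.weylGroup.induction with
  | mem i => exact h1 i
  | one => exact one_mem _
  | mul x y hx hy hx' hy' => exact mul_mem hx' hy'

/-- The product of the simple reflections listed in `l`. -/
noncomputable def wordProd (l : List b.support) : P.weylGroup := (l.map fun i => refl P i.1).prod

theorem exists_wordProd (w : P.weylGroup) : ∃ l, wordProd b l = w := by
  have hw : w ∈ Submonoid.closure (Set.range fun i : b.support => refl P i) := by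
    rw [closure_simple_eq_top]; trivial
  obtain ⟨l, hl, rfl⟩ := Submonoid.exists_list_of_mem_closure hw
  clear hw
  induction l with
  | nil => exact ⟨[], rfl⟩
  | cons a l ih =>
    obtain ⟨l', hl'⟩ := ih fun y hy => hl y (List.mem_cons_of_mem _ hy)
    obtain ⟨i, hi⟩ := hl a List.mem_cons_self
    exact ⟨i :: l', by simp only [wordProd, List.map_cons, List.prod_cons] at hl' ⊢; rw [hl', ← hi]⟩

/-- An element fixing everything that the simple reflections fix. -/
theorem weyl_induction {p : P.weylGroup → Prop} (one : p 1)
    (mul : ∀ i : b.support, ∀ w, p w → p (refl P i * w)) (w : P.weylGroup) : p w := by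
  obtain ⟨l, rfl⟩ := exists_wordProd b w
  induction l with
  | nil => exact one
  | cons a l ih => exact mul a _ ih

theorem isPos_refl_smul {i : ι} {j : b.support} (hi : b.IsPos i) (hij : i ≠ j) :
    b.IsPos (refl P j.1 • i) :=
  hi.reflectionPerm j.2 hij

theorem isPos_reflectionPerm_self_iff (i : ι) : b.IsPos (P.reflectionPerm i i) ↔ ¬ b.IsPos i :=
  RootPairing.Base.IsPos.neg_iff_not b i

/-- The exchange condition. While the letters of the word are applied to a simple root, the sign
changes at some letter. A simple reflection makes only its own simple root negative, so that letter
can be deleted at the price of a reflection on the right. -/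
theorem wordProd_exchange (l : List b.support) (i : b.support)
    (h : ¬ b.IsPos (wordProd b l • i.1)) :
    ∃ l' : List b.support, l'.length < l.length ∧ wordProd b l' = wordProd b l * refl P i := by
  induction l with
  | nil => exact absurd (b.isPos_of_mem_support i.2) (by simpa [wordProd] using h)
  | cons j l ih =>
    have hc (l') : wordProd b (j :: l') = refl P j * wordProd b l' := by simp [wordProd]
    by_cases hl : b.IsPos (wordProd b l • i.1)
    · refine ⟨l, by simp, ?_⟩
      -- The reflection in `j` permutes the positive roots other than `j`, so the sign can only
      -- change here if the tail has already carried `i` to `j`.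
      have hj : wordProd b l • i.1 = j := by
        by_contra hne
        rw [hc, mul_smul] at h
        exact h (isPos_refl_smul b hl hne)
      have h2 : refl P j * (wordProd b l * refl P i) = wordProd b l := by
        have := refl_conj (wordProd b l) i.1
        rw [hj] at this
        rw [this]
        simp [mul_assoc]
      rw [hc, mul_assoc, h2]
    · obtain ⟨l', h1, h2⟩ := ih hl
      exact ⟨j :: l', by simpa using h1, by rw [hc, hc, h2, mul_assoc]⟩

/-- Induction along length-increasing right multiplications, without a length function: induct on
the length of some word, and if the last letter does not increase the length, exchange gives a
shorter word for the same element. -/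
theorem exists_reduced_induction {p : P.weylGroup → Prop} (one : p 1)
    (mul : ∀ i : b.support, ∀ w, p w → b.IsPos (w • i.1) → p (w * refl P i)) (w : P.weylGroup) :
    p w := by
  obtain ⟨l, rfl⟩ := exists_wordProd b w
  induction hn : l.length using Nat.strong_induction_on generalizing l with
  | _ n ih =>
    rcases List.eq_nil_or_concat' l with rfl | ⟨l', i, rfl⟩
    · exact one
    · have hw : wordProd b (l' ++ [i]) = wordProd b l' * refl P i := by simp [wordProd]
      rw [hw]
      simp only [List.length_append, List.length_singleton] at hn
      by_cases h : b.IsPos (wordProd b l' • i.1)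
      · exact mul i _ (ih _ (by omega) l' rfl) h
      · obtain ⟨l'', h1, h2⟩ := wordProd_exchange b l' i h
        rw [← h2]
        exact ih _ (by omega) l'' rfl

end Base

end Weyl


/-! ### Positive roots and dominant weights -/

section Positive

variable {ι V N : Type*} [Finite ι] [AddCommGroup V] [Module ℝ V] [AddCommGroup N] [Module ℝ N]
  {P : RootPairing ι ℝ V N} [P.IsCrystallographic] [P.IsReduced] (b : P.Base)

theorem pos_root_nonneg (x : N) (hx : ∀ j : b.support, 0 ≤ P.toLinearMap (P.root j) x) {i : ι}
    (hi : b.IsPos i) : 0 ≤ P.toLinearMap (P.root i) x := by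
  refine hi.induction_on_add (p := fun i => 0 ≤ P.toLinearMap (P.root i) x)
    (fun j hj => hx ⟨j, hj⟩) fun i j k h h1 h2 => ?_
  rw [h, map_add, LinearMap.add_apply]
  exact add_nonneg h1 (hx ⟨j, h2⟩)

theorem pos_root_pos (x : N) (hx : ∀ j : b.support, 0 < P.toLinearMap (P.root j) x) {i : ι}
    (hi : b.IsPos i) : 0 < P.toLinearMap (P.root i) x := by
  refine hi.induction_on_add (p := fun i => 0 < P.toLinearMap (P.root i) x)
    (fun j hj => hx ⟨j, hj⟩) fun i j k h h1 h2 => ?_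
  rw [h, map_add, LinearMap.add_apply]
  exact add_pos h1 (hx ⟨j, h2⟩)

theorem pos_coroot_nonneg (v : V) (hv : ∀ j : b.support, 0 ≤ P.toLinearMap v (P.coroot j)) {i : ι}
    (hi : b.flip.IsPos i) : 0 ≤ P.toLinearMap v (P.coroot i) :=
  pos_root_nonneg b.flip v hv hi

theorem pos_coroot_pos (v : V) (hv : ∀ j : b.support, 0 < P.toLinearMap v (P.coroot j)) {i : ι}
    (hi : b.flip.IsPos i) : 0 < P.toLinearMap v (P.coroot i) :=
  pos_root_pos b.flip v hv hi

/-- The finite set of positive roots. -/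
noncomputable def posRoots : Finset ι := (Set.toFinite {i | b.IsPos i}).toFinset

theorem mem_posRoots {i : ι} : i ∈ posRoots b ↔ b.IsPos i := by simp [posRoots]

/-- A simple reflection permutes the positive roots other than its own, which it negates. Both
exceptional factors are kept so that no division is needed; the same lemma serves the sum of the
positive roots and the Weyl denominator. -/
theorem prod_posRoots_reflectionPerm {M : Type*} [CommMonoid M] (f : ι → M) (j : b.support) :
    (∏ i ∈ posRoots b, f (P.reflectionPerm j i)) * f j =
      (∏ i ∈ posRoots b, f i) * f (P.reflectionPerm j j) := by
  classical
  have hj : j.1 ∈ posRoots b := (mem_posRoots b).2 (b.isPos_of_mem_support j.2)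
  rw [← Finset.mul_prod_erase _ _ hj, ← Finset.mul_prod_erase _ f hj]
  have : ∏ i ∈ (posRoots b).erase j, f (P.reflectionPerm j i) =
      ∏ i ∈ (posRoots b).erase j, f i := by
    refine Finset.prod_bij' (fun i _ => P.reflectionPerm j i) (fun i _ => P.reflectionPerm j i)
      ?_ ?_
      (fun i _ => P.reflectionPerm_self j i) (fun i _ => P.reflectionPerm_self j i)
      (fun _ _ => rfl)
    all_goals
      intro i hi
      rw [Finset.mem_erase, mem_posRoots] at hi ⊢
      refine ⟨fun h => ?_, hi.2.reflectionPerm j.2 hi.1⟩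
      have h2 : i = P.reflectionPerm j j := 
        (P.reflectionPerm_self j i).symm.trans (congr_arg _ h)
      rw [h2, isPos_reflectionPerm_self_iff] at hi
      exact hi.2 (b.isPos_of_mem_support j.2)
  rw [this]
  ac_rfl

/-- The sum of the positive roots. -/
noncomputable def posSum : V := ∑ i ∈ posRoots b, P.root i

/-- The reflection in `j` replaces one summand α_j by -α_j, so it lowers the sum by 2α_j. -/
theorem posSum_coroot (j : b.support) : P.toLinearMap (posSum b) (P.coroot j) = 2 := by
  have h := prod_posRoots_reflectionPerm b (fun i => Multiplicative.ofAdd (P.root i)) j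
  simp only [← ofAdd_sum, ← ofAdd_add] at h
  have h := Multiplicative.ofAdd.injective h
  simp only [P.root_reflectionPerm, ← map_sum (P.reflection j), P.reflection_apply_self] at h
  rw [P.reflection_apply] at h
  have h2 : P.toLinearMap (posSum b) (P.coroot j) • P.root j = (2 : ℝ) • P.root j := by
    change (P.coroot' j) (∑ i ∈ posRoots b, P.root i) • P.root j = _
    generalize ∑ i ∈ posRoots b, P.root i = s at h ⊢
    rw [two_smul]
    have h3 : s - (P.coroot' j) s • P.root j + P.root j = s + - P.root j := h
    have h4 := congr_arg (fun t => s + P.root j - t) h3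
    have h5 : s + P.root j - (s - (P.coroot' j) s • P.root j + P.root j) =
      (P.coroot' j) s • P.root j := by abel
    have h6 : s + P.root j - (s + - P.root j) = P.root j + P.root j := by abel
    rwa [h5, h6] at h4
  exact smul_left_injective ℝ (P.ne_zero j) h2

/-- The sum of the positive coroots. -/
noncomputable def posCosum : N := posSum b.flip

/-- Thus `posCosum` is a strictly dominant coweight, integral on weights. It is the height function
by which exponents are ordered throughout. -/
theorem root_posCosum (j : b.support) : P.toLinearMap (P.root j) (posCosum b) = 2 :=
  posSum_coroot b.flip j

/-! ### The weight lattice and dominance -/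

variable (P) in
/-- The weight lattice. -/
def weightLattice : AddSubgroup V where
  carrier := {v | ∀ i : ι, ∃ k : ℤ, P.toLinearMap v (P.coroot i) = k}
  zero_mem' i := ⟨0, by simp⟩
  add_mem' {v w} hv hw i := by
    obtain ⟨k, hk⟩ := hv i
    obtain ⟨l, hl⟩ := hw i
    exact ⟨k + l, by simp [hk, hl]⟩
  neg_mem' {v} hv i := by
    obtain ⟨k, hk⟩ := hv i
    exact ⟨-k, by simp [hk]⟩

theorem root_mem_weightLattice (i : ι) : P.root i ∈ weightLattice P := fun j =>
  ⟨P.pairingIn ℤ i j, by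
    rw [P.root_coroot_eq_pairing, ← P.algebraMap_pairingIn ℤ]; rfl⟩

theorem smul_mem_weightLattice (w : P.weylGroup) {v : V} (hv : v ∈ weightLattice P) :
    w • v ∈ weightLattice P := fun i => by
  rw [smul_root_coroot]; exact hv _

theorem mem_weightLattice_of_simple {v : V}
    (hv : ∀ j : b.support, ∃ k : ℤ, P.toLinearMap v (P.coroot j) = k) : v ∈ weightLattice P := by
  intro i
  refine b.flip.induction_add i (p := fun i => ∃ k : ℤ, P.toLinearMap v (P.coroot i) = k) ?_ ?_ ?_
  · rintro j ⟨k, hk⟩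
    refine ⟨-k, ?_⟩
    have : P.coroot (P.flip.reflectionPerm j j) = - P.coroot j := coroot_reflectionPerm_self' j
    rw [this, map_neg, hk, Int.cast_neg]
  · exact fun j hj => hv ⟨j, hj⟩
  · rintro i j k h ⟨l, hl⟩ hj
    obtain ⟨m, hm⟩ := hv ⟨j, hj⟩
    have h : P.coroot k = P.coroot i + P.coroot j := h
    exact ⟨l + m, by rw [h, map_add, hl, hm, Int.cast_add]⟩

theorem exists_int_posCosum {v : V} (hv : v ∈ weightLattice P) :
    ∃ k : ℤ, P.toLinearMap v (posCosum b) = k := by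
  choose k hk using hv
  refine ⟨∑ i ∈ posRoots b.flip, k i, ?_⟩
  simp only [posCosum, posSum, map_sum, Int.cast_sum]
  exact Finset.sum_congr rfl fun i _ => hk i

/-- Dominant elements of `V`. -/
def IsDominant (v : V) : Prop := ∀ j : b.support, 0 ≤ P.toLinearMap v (P.coroot j)

theorem IsDominant.posCosum_nonneg {v : V} (hv : IsDominant b v) :
    0 ≤ P.toLinearMap v (posCosum b) := by
  simp only [posCosum, posSum, map_sum]
  exact Finset.sum_nonneg fun i hi => pos_coroot_nonneg b v hv ((mem_posRoots b.flip).1 hi)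

theorem IsDominant.coroot_eq_zero {v : V} (hv : IsDominant b v)
    (h : P.toLinearMap v (posCosum b) ≤ 0) (j : b.support) : P.toLinearMap v (P.coroot j) = 0 := by
  have h0 := le_antisymm h hv.posCosum_nonneg
  simp only [posCosum, posSum, map_sum] at h0
  change ∑ i ∈ posRoots b.flip, P.toLinearMap v (P.coroot i) = 0 at h0
  rw [Finset.sum_eq_zero_iff_of_nonneg
    fun i hi => pos_coroot_nonneg b v hv ((mem_posRoots b.flip).1 hi)] at h0
  exact h0 j ((mem_posRoots b.flip).2 (b.flip.isPos_of_mem_support j.2))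

/-- Lengthening w by the simple reflection s_i subtracts ⟨v, α_i^∨⟩ (w • α_i), a nonnegative
multiple of a positive root. Either nothing changes or the value at `x` drops. -/
theorem IsDominant.smul_eq_or_lt {v : V} (hv : IsDominant b v) {x : N}
    (hx : ∀ j : b.support, 0 < P.toLinearMap (P.root j) x) (w : P.weylGroup) :
    w • v = v ∨ P.toLinearMap (w • v) x < P.toLinearMap v x := by
  induction w using exists_reduced_induction b with
  | one => exact Or.inl (one_smul _ _)
  | mul i w ih hi =>
    have h1 : (w * refl P i.1) • v =
        w • v - P.toLinearMap v (P.coroot i) • P.root (w • i.1) := by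
      rw [mul_smul, refl_smul, smul_sub, smul_smul_real, smul_root]
    rcases (hv i).eq_or_lt with h0 | h0
    · rw [h1, ← h0, zero_smul, sub_zero]
      exact ih
    · right
      rw [h1, pairing_sub_smul]
      have h2 := mul_pos h0 (pos_root_pos b x hx hi)
      rcases ih with ih | ih
      · rw [ih]; linarith
      · linarith

/-- For regular `v` every lengthening strictly lowers the value, so the alternative concerns w
itself. This isolates the leading term of S_ρ. -/
theorem eq_one_or_lt_of_regular {v : V} (hv : ∀ j : b.support, 0 < P.toLinearMap v (P.coroot j))
    {x : N} (hx : ∀ j : b.support, 0 < P.toLinearMap (P.root j) x) (w : P.weylGroup) :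
    w = 1 ∨ P.toLinearMap (w • v) x < P.toLinearMap v x := by
  induction w using exists_reduced_induction b with
  | one => exact Or.inl rfl
  | mul i w ih hi =>
    have h1 : (w * refl P i.1) • v =
        w • v - P.toLinearMap v (P.coroot i) • P.root (w • i.1) := by
      rw [mul_smul, refl_smul, smul_sub, smul_smul_real, smul_root]
    right
    rw [h1, pairing_sub_smul]
    have h2 := mul_pos (hv i) (pos_root_pos b x hx hi)
    rcases ih with ih | ih
    · simp only [ih, one_smul] at h2 ⊢; linarith
    · linarith

section RootSystem

variable [P.IsRootSystem]

theorem eq_of_coroot_eq {v v' : V}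
    (h : ∀ j : b.support, P.toLinearMap v (P.coroot j) = P.toLinearMap v' (P.coroot j)) :
    v = v' := by
  refine P.toLinearMap.toPerfPair.injective (b.toCoweightBasis.ext fun j => ?_)
  simpa using h j

theorem eq_of_root_eq {x x' : N}
    (h : ∀ j : b.support, P.toLinearMap (P.root j) x = P.toLinearMap (P.root j) x') : x = x' := by
  refine P.toLinearMap.flip.toPerfPair.injective (b.toWeightBasis.ext fun j => ?_)
  simpa using h j

theorem sum_coroot_smul_fundamentalWeight (v : V) :
    ∑ j : b.support, P.toLinearMap v (P.coroot j) • fundamentalWeight b j = v := by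
  classical
  refine eq_of_coroot_eq b fun k => ?_
  simp [fundamentalWeight_coroot]

theorem sum_root_smul_fundamentalCoweight (x : N) :
    ∑ j : b.support, P.toLinearMap (P.root j) x • fundamentalCoweight b j = x := by
  classical
  refine eq_of_root_eq b fun k => ?_
  simp [root_fundamentalCoweight]

theorem sum_fundamentalWeight_smul_coroot (x : N) :
    ∑ j : b.support, P.toLinearMap (fundamentalWeight b j) x • P.coroot j = x := by
  classical
  refine P.toLinearMap.flip.toPerfPair.injective ?_
  ext v
  conv_rhs => rw [← sum_coroot_smul_fundamentalWeight b v]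
  simp [mul_comm]

theorem fundamentalWeight_mem_weightLattice (j : b.support) :
    fundamentalWeight b j ∈ weightLattice P := by
  classical
  refine mem_weightLattice_of_simple b fun k => ⟨if j = k then 1 else 0, ?_⟩
  rw [fundamentalWeight_coroot]
  split_ifs <;> simp

theorem isDominant_fundamentalWeight (j : b.support) : IsDominant b (fundamentalWeight b j) := by
  classical
  intro k
  rw [fundamentalWeight_coroot]
  split_ifs <;> simp

theorem rho_coroot (j : b.support) : P.toLinearMap (rho b) (P.coroot j) = 1 := by
  classical
  simp [rho, fundamentalWeight_coroot]

theorem two_smul_rho : (2 : ℝ) • rho b = posSum b :=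
  eq_of_coroot_eq b fun j => by rw [posSum_coroot, map_smul, LinearMap.smul_apply, rho_coroot]; simp

theorem rho_mem_weightLattice : rho b ∈ weightLattice P :=
  sum_mem fun j _ => fundamentalWeight_mem_weightLattice b j

/-- Take the point of greatest height in the finite orbit: a negative pairing with a simple coroot
would let the reflection raise it. -/
theorem exists_smul_isDominant (v : V) : ∃ w : P.weylGroup, IsDominant b (w • v) := by
  obtain ⟨w, hw⟩ := Finite.exists_max fun w : P.weylGroup => P.toLinearMap (w • v) (posCosum b)
  refine ⟨w, fun j => ?_⟩
  have h := hw (refl P j * w)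
  rw [mul_smul, refl_smul, pairing_sub_smul, root_posCosum] at h
  linarith

end RootSystem

end Positive


/-! ### The highest root -/

section HighestRoot

theorem root_coroot_eq_cast {ι V N : Type*} [AddCommGroup V] [Module ℝ V] [AddCommGroup N]
    [Module ℝ N] (P : RootPairing ι ℝ V N) [P.IsCrystallographic] (i j : ι) :
    P.toLinearMap (P.root i) (P.coroot j) = (P.pairingIn ℤ i j : ℝ) := by
  rw [P.root_coroot_eq_pairing, ← P.algebraMap_pairingIn ℤ]; rfl

theorem reflectionPerm_reflectionPerm_self {ι V N : Type*} [AddCommGroup V] [Module ℝ V]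
    [AddCommGroup N] [Module ℝ N] (P : RootPairing ι ℝ V N) (i : ι) :
    P.reflectionPerm (P.reflectionPerm i i) (P.reflectionPerm i i) = i := by
  apply P.root.injective
  rw [root_reflectionPerm_self', root_reflectionPerm_self', neg_neg]

variable {ι V N : Type*} [Finite ι] [AddCommGroup V] [Module ℝ V] [AddCommGroup N] [Module ℝ N]
  {P : RootPairing ι ℝ V N} [P.IsCrystallographic] [P.IsReduced] (b : P.Base)

theorem pairing_nonneg_of_mem_closure {v : V}
    (hv : v ∈ AddSubmonoid.closure (P.root '' b.support)) {x : N}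
    (hx : ∀ j : b.support, 0 ≤ P.toLinearMap (P.root j) x) : 0 ≤ P.toLinearMap v x := by
  induction hv using AddSubmonoid.closure_induction with
  | mem v hv =>
    obtain ⟨i, hi, rfl⟩ := hv
    exact hx ⟨i, hi⟩
  | zero => simp
  | add v w _ _ hv hw =>
    rw [map_add, LinearMap.add_apply]
    exact add_nonneg hv hw

theorem eq_zero_or_pairing_pos_of_mem_closure {v : V}
    (hv : v ∈ AddSubmonoid.closure (P.root '' b.support)) {x : N}
    (hx : ∀ j : b.support, 0 < P.toLinearMap (P.root j) x) : v = 0 ∨ 0 < P.toLinearMap v x := by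
  induction hv using AddSubmonoid.closure_induction with
  | mem v hv =>
    obtain ⟨i, hi, rfl⟩ := hv
    exact Or.inr (hx ⟨i, hi⟩)
  | zero => simp
  | add v w _ _ hv hw =>
    rw [map_add, LinearMap.add_apply]
    rcases hv with rfl | hv
    · simpa using hw
    · rcases hw with rfl | hw
      · simpa using Or.inr hv
      · exact Or.inr (add_pos hv hw)

theorem root_mem_closure (j : b.support) :
    P.root j ∈ AddSubmonoid.closure (P.root '' b.support) :=
  AddSubmonoid.subset_closure ⟨j, j.2, rfl⟩

/-- A root above which there is no other one. -/
def IsMaximalRoot (i : ι) : Prop :=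
  ∀ k, P.root k - P.root i ∈ AddSubmonoid.closure (P.root '' b.support) → P.root k = P.root i

theorem exists_isMaximalRoot_ge (i : ι) : ∃ k, IsMaximalRoot b k ∧
    P.root k - P.root i ∈ AddSubmonoid.closure (P.root '' b.support) := by
  obtain ⟨k, hk, hmax⟩ := Set.exists_max_image
    {k | P.root k - P.root i ∈ AddSubmonoid.closure (P.root '' b.support)}
    (fun k => P.toLinearMap (P.root k) (posCosum b)) (Set.toFinite _) ⟨i, by simp⟩
  refine ⟨k, fun l hl => ?_, hk⟩
  have h1 := hmax l (by simpa using add_mem hl hk)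
  rcases eq_zero_or_pairing_pos_of_mem_closure b hl
    (x := posCosum b) (fun j => by rw [root_posCosum]; norm_num) with h | h
  · exact sub_eq_zero.1 h
  · rw [map_sub, LinearMap.sub_apply] at h
    linarith

/-- If the pairing were negative, adding the simple root would give a larger root. In the degenerate
case where the root is -α_j, the root α_j itself is larger. -/
theorem IsMaximalRoot.pairing_nonneg {i : ι} (hi : IsMaximalRoot b i) (j : b.support) :
    0 ≤ P.pairingIn ℤ i j := by
  by_contra! h
  by_cases hij : P.root i = -P.root j
  · have hj := root_mem_closure b j
    have h1 := hi j (by rw [hij, sub_neg_eq_add]; exact add_mem hj hj)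
    rw [hij] at h1
    have h3 : (2 : ℝ) • P.root j = 0 := by rw [two_smul]; nth_rw 1 [h1]; exact neg_add_cancel _
    exact P.ne_zero j ((smul_eq_zero.1 h3).resolve_left two_ne_zero)
  · obtain ⟨k, hk⟩ := P.root_add_root_mem_of_pairingIn_neg h hij
    have h1 := hi k (by rw [hk, add_sub_cancel_left]; exact root_mem_closure b j)
    rw [hk, add_eq_left] at h1
    exact P.ne_zero j h1

theorem IsMaximalRoot.mem_closure [Nonempty ι] {i : ι} (hi : IsMaximalRoot b i) :
    P.root i ∈ AddSubmonoid.closure (P.root '' b.support) := by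
  rcases b.root_mem_or_neg_mem i with h | h
  · exact h
  · obtain ⟨j, hj⟩ := b.support_nonempty
    have hm := root_mem_closure b ⟨j, hj⟩
    have h1 := hi j (by rw [sub_eq_add_neg]; exact add_mem hm h)
    rw [← h1]
    exact hm

variable [P.IsRootSystem]

theorem sum_repr_smul_root (v : V) : ∑ j : b.support, b.toWeightBasis.repr v j • P.root j = v := by
  conv_rhs => rw [← b.toWeightBasis.sum_repr v]
  simp

theorem pairing_eq_sum_repr (v : V) (x : N) :
    P.toLinearMap v x =
      ∑ j : b.support, b.toWeightBasis.repr v j * P.toLinearMap (P.root j) x := by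
  conv_lhs => rw [← sum_repr_smul_root b v]
  simp

theorem exists_nat_repr {v : V} (hv : v ∈ AddSubmonoid.closure (P.root '' b.support))
    (j : b.support) : ∃ m : ℕ, b.toWeightBasis.repr v j = m := by
  classical
  induction hv using AddSubmonoid.closure_induction with
  | mem v hv =>
    obtain ⟨i, hi, rfl⟩ := hv
    refine ⟨if (⟨i, hi⟩ : b.support) = j then 1 else 0, ?_⟩
    have h := b.toWeightBasis_repr_root ⟨i, hi⟩
    simp only at h
    rw [h, Finsupp.single_apply]
    split_ifs <;> simp
  | zero => exact ⟨0, by simp⟩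
  | add v w _ _ hv hw =>
    obtain ⟨k, hk⟩ := hv
    obtain ⟨l, hl⟩ := hw
    exact ⟨k + l, by simp [hk, hl]⟩

variable [P.IsIrreducible]

/-- Positivity of a coefficient spreads along the edges of the Dynkin diagram: a zero coefficient
next to a positive one would make the pairing with the corresponding coroot negative. Irreducibility
lets it reach every node. -/
theorem IsMaximalRoot.repr_pos [Nonempty ι] {i : ι} (hi : IsMaximalRoot b i) (j : b.support) :
    0 < b.toWeightBasis.repr (P.root i) j := by
  have h0 (j : b.support) : 0 ≤ b.toWeightBasis.repr (P.root i) j := by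
    obtain ⟨m, hm⟩ := exists_nat_repr b hi.mem_closure j
    rw [hm]; positivity
  obtain ⟨k, hk⟩ : ∃ k, 0 < b.toWeightBasis.repr (P.root i) k := by
    by_contra! h
    refine P.ne_zero i ?_
    rw [← sum_repr_smul_root b (P.root i)]
    exact Finset.sum_eq_zero fun j _ => by rw [le_antisymm (h j) (h0 j), zero_smul]
  refine b.induction_on_cartanMatrix (fun j => 0 < b.toWeightBasis.repr (P.root i) j) hk ?_
  intro k l hk hkl
  by_contra hl
  have hl0 := le_antisymm (not_lt.1 hl) (h0 l)
  have hne : k ≠ l := by rintro rfl; exact hl hk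
  have h1 : (0 : ℝ) ≤ P.toLinearMap (P.root i) (P.coroot l) := by
    rw [root_coroot_eq_cast]
    exact_mod_cast hi.pairing_nonneg b l
  have hle (m : b.support) (hm : m ≠ l) : P.toLinearMap (P.root m) (P.coroot l) ≤ 0 := by
    rw [root_coroot_eq_cast]
    exact_mod_cast b.cartanMatrix_le_zero_of_ne m l hm
  have hlt : P.toLinearMap (P.root k) (P.coroot l) < 0 := by
    refine lt_of_le_of_ne (hle k hne) fun h => hkl ?_
    rw [P.root_coroot_eq_pairing] at h
    exact b.cartanMatrix_apply_eq_zero_iff_symm.1 (b.cartanMatrix_apply_eq_zero_iff_pairing.2 h)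
  rw [pairing_eq_sum_repr b] at h1
  refine absurd h1 (not_le.2 (Finset.sum_neg' (fun m _ => ?_) ⟨k, Finset.mem_univ _, ?_⟩))
  · by_cases hm : m = l
    · rw [hm, hl0, zero_mul]
    · exact mul_nonpos_of_nonneg_of_nonpos (h0 m) (hle m hm)
  · exact mul_neg_of_pos_of_neg hk hlt

/-- Full support of one root and dominance of the other make their pairing positive. If they were
distinct their difference would be a root, positive or negative, and one of them would not be
maximal. -/
theorem IsMaximalRoot.root_eq [Nonempty ι] {i k : ι} (hi : IsMaximalRoot b i)
    (hk : IsMaximalRoot b k) : P.root i = P.root k := by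
  have h1 (j : b.support) : 0 ≤ P.pairingIn ℤ j k := by
    have := hk.pairing_nonneg b j
    by_contra! h
    rw [P.pairingIn_lt_zero_iff] at h
    omega
  have h2 : 0 < P.pairingIn ℤ i k := by
    have : (0 : ℝ) < P.toLinearMap (P.root i) (P.coroot k) := by
      rw [pairing_eq_sum_repr b]
      simp only [root_coroot_eq_cast]
      obtain ⟨j, hj, hjk⟩ := b.exists_mem_support_pos_pairingIn_ne_zero k
      refine Finset.sum_pos' (fun j _ => mul_nonneg (hi.repr_pos b j).le (by exact_mod_cast h1 j))
        ⟨⟨j, hj⟩, Finset.mem_univ _, mul_pos (hi.repr_pos b _) ?_⟩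
      exact_mod_cast lt_of_le_of_ne (h1 ⟨j, hj⟩) hjk.symm
    rw [root_coroot_eq_cast] at this
    exact_mod_cast this
  by_contra hne
  obtain ⟨l, hl⟩ := P.root_sub_root_mem_of_pairingIn_pos h2 (fun h => hne (by rw [h]))
  rcases b.root_mem_or_neg_mem l with h | h
  · exact hne (hk i (by rwa [← hl]))
  · exact hne (hi k (by rwa [hl, neg_sub] at h)).symm

theorem nonempty_index {ι V N : Type*} [AddCommGroup V] [Module ℝ V] [AddCommGroup N] [Module ℝ N]
    (P : RootPairing ι ℝ V N) [P.IsRootSystem] [P.IsIrreducible] : Nonempty ι := by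
  by_contra h
  rw [not_nonempty_iff] at h
  have h1 := RootPairing.IsRootSystem.span_root_eq_top (P := P)
  rw [Set.range_eq_empty, Submodule.span_empty] at h1
  have := RootPairing.IsIrreducible.nontrivial P
  exact bot_ne_top h1

theorem exists_isHighestRoot : ∃ i, IsHighestRoot b i := by
  have : Nonempty ι := nonempty_index P
  obtain ⟨i, hi, -⟩ := exists_isMaximalRoot_ge b (Classical.arbitrary ι)
  refine ⟨i, fun k => ?_⟩
  obtain ⟨l, hl, hlk⟩ := exists_isMaximalRoot_ge b k
  rwa [hi.root_eq b hl]

theorem exists_highestRoot_eq : ∃ i, highestRoot b = P.root i ∧ IsHighestRoot b i := by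
  have h := exists_isHighestRoot b
  refine ⟨h.choose, ?_, h.choose_spec⟩
  rw [highestRoot, dif_pos h]

theorem root_le_highestRoot (k : ι) {x : N} (hx : ∀ j : b.support, 0 ≤ P.toLinearMap (P.root j) x) :
    P.toLinearMap (P.root k) x ≤ P.toLinearMap (highestRoot b) x := by
  obtain ⟨i, hi, h⟩ := exists_highestRoot_eq b
  have := pairing_nonneg_of_mem_closure b (h k) hx
  rw [hi]
  rw [map_sub, LinearMap.sub_apply] at this
  linarith

variable {n : ℕ} (e : Fin n ≃ b.support)

theorem exists_nat_mark (j : Fin n) : ∃ m : ℕ, 1 ≤ m ∧ mark b e j = m := by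
  obtain ⟨i, hi, h⟩ := exists_highestRoot_eq b
  obtain ⟨m, hm⟩ := exists_nat_repr b (h (e j)) (e j)
  -- Here `m` is the coefficient of α_j in the highest root minus α_j.
  refine ⟨m + 1, by omega, ?_⟩
  rw [map_sub, Finsupp.sub_apply, b.toWeightBasis_repr_root, Finsupp.single_eq_same, ← hi] at hm
  rw [mark]
  push_cast
  linarith

theorem highestRoot_pairing (x : N) : P.toLinearMap (highestRoot b) x =
    ∑ j, mark b e j * P.toLinearMap (P.root (e j)) x := by
  rw [pairing_eq_sum_repr b]
  exact (Equiv.sum_comp e fun j =>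
    b.toWeightBasis.repr (highestRoot b) j * P.toLinearMap (P.root j) x).symm

/-- ω_j is dominant for the dual root system, so among all coroots the highest one pairs best with
it, and there ω_j reads off the coefficient of α_j^∨. -/
theorem pairing_coroot_le_dualMark (j : Fin n) (i : ι) :
    P.toLinearMap (fundamentalWeight b (e j)) (P.coroot i) ≤ dualMark b e j := by
  classical
  have h1 := root_le_highestRoot b.flip i (x := fundamentalWeight b (e j))
    fun k => isDominant_fundamentalWeight b (e j) k
  refine h1.trans (le_of_eq ?_)
  rw [pairing_eq_sum_repr b.flip]
  have h2 (k : b.support) : P.flip.toLinearMap (P.flip.root k) (fundamentalWeight b (e j)) =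
      if e j = k then 1 else 0 := fundamentalWeight_coroot b (e j) k
  change ∑ k : b.support, b.flip.toWeightBasis.repr (highestRoot b.flip) k *
    P.flip.toLinearMap (P.flip.root k) (fundamentalWeight b (e j)) = _
  simp only [h2]
  rw [Finset.sum_eq_single (e j) (fun k _ hk => by rw [if_neg hk.symm, mul_zero]) (by simp),
    if_pos rfl, mul_one]
  rfl

theorem exists_coroot_eq_dualMark (j : Fin n) :
    ∃ i, P.toLinearMap (fundamentalWeight b (e j)) (P.coroot i) = dualMark b e j := by
  classical
  obtain ⟨i, hi, -⟩ := exists_highestRoot_eq b.flip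
  refine ⟨i, ?_⟩
  change P.flip.toLinearMap (P.flip.root i) (fundamentalWeight b (e j)) = _
  rw [← hi, pairing_eq_sum_repr b.flip]
  have h2 (k : b.support) : P.flip.toLinearMap (P.flip.root k) (fundamentalWeight b (e j)) =
      if e j = k then 1 else 0 := fundamentalWeight_coroot b (e j) k
  change ∑ k : b.support, b.flip.toWeightBasis.repr (highestRoot b.flip) k *
    P.flip.toLinearMap (P.flip.root k) (fundamentalWeight b (e j)) = _
  simp only [h2]
  rw [Finset.sum_eq_single (e j) (fun k _ hk => by rw [if_neg hk.symm, mul_zero]) (by simp),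
    if_pos rfl, mul_one]
  rfl

end HighestRoot

/-! ### The opposition involution -/

section Opposition

variable {ι V N : Type*} [Finite ι] [AddCommGroup V] [Module ℝ V] [AddCommGroup N] [Module ℝ N]
  {P : RootPairing ι ℝ V N} [P.IsCrystallographic] [P.IsReduced] (b : P.Base)

theorem mem_support_or_exists_add {i : ι} (hi : b.IsPos i) :
    i ∈ b.support ∨ ∃ k l, b.IsPos k ∧ b.IsPos l ∧ P.root i = P.root k + P.root l := by
  refine (hi.induction_on_add (p := fun i => b.IsPos i ∧ (i ∈ b.support ∨
    ∃ k l, b.IsPos k ∧ b.IsPos l ∧ P.root i = P.root k + P.root l)) ?_ ?_).2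
  · exact fun j hj => ⟨b.isPos_of_mem_support hj, Or.inl hj⟩
  · intro i j k h hi hj
    have hj' := b.isPos_of_mem_support hj
    exact ⟨hi.1.add hj' h, Or.inr ⟨i, j, hi.1, hj', h⟩⟩

/-- Simple roots are the indecomposable positive roots. An additive permutation of the roots that
makes the simple ones positive preserves positivity in both directions, hence indecomposability. -/
theorem mem_support_of_image (f : ι ≃ ι) (g : V →+ V) (hg : ∀ i, P.root (f i) = g (P.root i))
    (g' : V →+ V) (hg' : ∀ i, P.root (f.symm i) = g' (P.root i))
    (hf : ∀ i ∈ b.support, b.IsPos (f i)) {i : ι} (hi : i ∈ b.support) : f i ∈ b.support := by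
  have h1 {i : ι} (hi : b.IsPos i) : b.IsPos (f i) := by
    refine (hi.induction_on_add (p := fun i => b.IsPos (f i)) hf ?_)
    intro i j k h h1 hj
    exact h1.add (hf j hj) (by rw [hg, hg, hg, h, map_add])
  have hneg (k : ι) : f (P.reflectionPerm k k) = P.reflectionPerm (f k) (f k) := by
    apply P.root.injective
    rw [hg, root_reflectionPerm_self', root_reflectionPerm_self', hg, map_neg]
  have h2 {k : ι} (hk : b.IsPos k) : b.IsPos (f.symm k) := by
    by_contra h
    rw [← isPos_reflectionPerm_self_iff] at h
    have h3 := h1 h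
    rw [hneg, f.apply_symm_apply, isPos_reflectionPerm_self_iff] at h3
    exact h3 hk
  rcases mem_support_or_exists_add b (hf i hi) with h | ⟨k, l, hk, hl, h⟩
  · exact h
  · have h3 : P.root i = P.root (f.symm k) + P.root (f.symm l) := by
      rw [hg', hg', ← map_add, ← h, ← hg', f.symm_apply_apply]
    -- A simple root has height one, whereas the two positive summands have height at least one
    -- each.
    have h4 := b.height_add h3
    rw [RootPairing.Base.height_one_of_mem_support hi] at h4
    have h5 := h2 hk
    have h6 := h2 hl
    rw [b.isPos_iff] at h5 h6
    omega

/-- The Weyl group acts trivially on weights modulo roots: a reflection changes a weight by an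
integer multiple of a root. -/
theorem sub_smul_mem_closure {v : V} (hv : v ∈ weightLattice P) (w : P.weylGroup) :
    v - w • v ∈ AddSubgroup.closure (P.root '' b.support) := by
  have hr (i : ι) : P.root i ∈ AddSubgroup.closure (P.root '' b.support) := by
    have h := b.root_mem_span_int i
    rwa [← Submodule.mem_toAddSubgroup, Submodule.span_int_eq_addSubgroupClosure] at h
  induction w using weyl_induction b with
  | one => simp
  | mul i w ih =>
    rw [mul_smul, refl_smul]
    obtain ⟨k, hk⟩ := smul_mem_weightLattice w hv i
    rw [hk, sub_sub_eq_add_sub, add_comm, add_sub_assoc, Int.cast_smul_eq_zsmul]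
    exact add_mem (zsmul_mem (hr i) k) ih

variable [P.IsRootSystem]

theorem exists_opposition : ∃ τ : b.support → b.support,
    (∀ j, ∃ w : P.weylGroup, -fundamentalWeight b j = w • fundamentalWeight b (τ j)) ∧
    ∀ i j, b.cartanMatrix (τ i) (τ j) = b.cartanMatrix i j := by
  classical
  -- This w plays the role of the longest element: it makes -ρ dominant, so the negative of its
  -- inverse sends simple coroots to positive, hence to simple ones.
  obtain ⟨w, hw⟩ := exists_smul_isDominant b (-rho b)
  let f : ι ≃ ι := ⟨fun i => P.reflectionPerm (w⁻¹ • i) (w⁻¹ • i),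
    fun i => w • P.reflectionPerm i i, fun i => by simp [reflectionPerm_reflectionPerm_self],
    fun i => by simp [smul_neg_index, reflectionPerm_reflectionPerm_self]⟩
  have hco (i : ι) : P.coroot (f i) = -coact w (P.coroot i) := by
    rw [coact_coroot]; exact coroot_reflectionPerm_self' _
  have hro (i : ι) : P.root (f i) = -(w⁻¹ • P.root i) := by
    rw [smul_root]; exact root_reflectionPerm_self' _
  have hco' (i : ι) : P.coroot (f.symm i) = -coact w⁻¹ (P.coroot i) := by
    rw [coact_coroot, inv_inv, ← coroot_reflectionPerm_self', ← smul_neg_index]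
    rfl
  have hmem (i : b.support) : f i ∈ b.support := by
    refine mem_support_of_image b.flip f (-(coact w).toLinearMap.toAddMonoidHom) hco
      (-(coact w⁻¹).toLinearMap.toAddMonoidHom) hco' (fun i hi => ?_) i.2
    have h1 := hw ⟨i, hi⟩
    rw [smul_root_coroot] at h1
    have h2 := isPos_reflectionPerm_self_iff b.flip (w⁻¹ • i)
    refine h2.2 fun h3 => ?_
    have h4 := pos_coroot_pos b (rho b) (fun j => by rw [rho_coroot]; norm_num) h3
    simp only [map_neg, LinearMap.neg_apply] at h1
    linarith
  refine ⟨fun i => ⟨f i, hmem i⟩, fun j => ⟨w, ?_⟩, fun i j => ?_⟩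
  · refine eq_of_coroot_eq b fun i => ?_
    rw [pairing_smul, ← neg_neg (coact w (P.coroot i)), ← hco, map_neg, map_neg,
      LinearMap.neg_apply, fundamentalWeight_coroot]
    have := fundamentalWeight_coroot b ⟨f j, hmem j⟩ ⟨f i, hmem i⟩
    simp only at this
    rw [this]
    have hiff : (⟨f j, hmem j⟩ : b.support) = ⟨f i, hmem i⟩ ↔ j = i := by
      rw [Subtype.mk.injEq, f.injective.eq_iff, Subtype.ext_iff]
    congr 1
    exact (if_congr hiff rfl rfl).symm
  · have h : P.pairing (f i) (f j) = P.pairing i j := by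
      rw [← P.root_coroot_eq_pairing, hco, hro, map_neg, map_neg, LinearMap.neg_apply, neg_neg,
        ← pairing_smul, smul_inv_smul, P.root_coroot_eq_pairing]
    rw [← P.algebraMap_pairingIn ℤ, ← P.algebraMap_pairingIn ℤ] at h
    exact_mod_cast h

theorem exists_int_repr {v : V} (hv : v ∈ AddSubgroup.closure (P.root '' b.support)) :
    ∃ c : b.support → ℤ, v = ∑ j, (c j : ℝ) • P.root j := by
  classical
  induction hv using AddSubgroup.closure_induction with
  | mem v hv =>
    obtain ⟨i, hi, rfl⟩ := hv
    exact ⟨Pi.single ⟨i, hi⟩ 1, by simp [Pi.single_apply]⟩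
  | zero => exact ⟨0, by simp⟩
  | add v w _ _ hv hw =>
    obtain ⟨k, hk⟩ := hv
    obtain ⟨l, hl⟩ := hw
    exact ⟨k + l, by simp [hk, hl, add_smul, Finset.sum_add_distrib]⟩
  | neg v _ hv =>
    obtain ⟨k, hk⟩ := hv
    exact ⟨-k, by simp [hk]⟩

/-- Since w acts trivially modulo the root lattice, ω_j + ω_k lies in that lattice. Written in
coordinates, this is the arithmetic condition that identifies the opposition in types A, D and E6.
-/
theorem exists_cartan_combination {j k : b.support} {w : P.weylGroup}
    (h : -fundamentalWeight b j = w • fundamentalWeight b k) [DecidableEq b.support] :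
    ∃ c : b.support → ℤ, ∀ i, (if j = i then 1 else 0) + (if k = i then 1 else 0) =
      ∑ l, c l * b.cartanMatrix l i := by
  obtain ⟨c, hc⟩ := exists_int_repr b
    (sub_smul_mem_closure b (fundamentalWeight_mem_weightLattice b k) w)
  rw [← h, sub_neg_eq_add] at hc
  refine ⟨c, fun i => ?_⟩
  have h1 := congr_arg (fun v => P.toLinearMap v (P.coroot i)) hc
  simp only [map_add, LinearMap.add_apply, fundamentalWeight_coroot, map_sum, map_smul,
    LinearMap.sum_apply, LinearMap.smul_apply, root_coroot_eq_cast, smul_eq_mul] at h1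
  rw [add_comm]
  have h2 : (((if k = i then 1 else 0) + (if j = i then 1 else 0) : ℤ) : ℝ) =
      ((∑ l : b.support, c l * P.pairingIn ℤ l i : ℤ) : ℝ) := by
    push_cast
    convert h1
  exact_mod_cast h2

end Opposition


/-! ### The opposition involution in each type -/

section Types

open Matrix

/-- A function killed by the rows of the Cartan matrix is a character of the weight lattice modulo
the root lattice, with values in ℤ/m; opposite nodes receive opposite values. -/
theorem apply_add_apply_eq_zero {n m : ℕ} {A : Matrix (Fin n) (Fin n) ℤ} (f : Fin n → ZMod m)
    (hf : ∀ l, ∑ i, (A l i : ZMod m) * f i = 0) {j k : Fin n} {c : Fin n → ℤ}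
    (hc : ∀ i, (if j = i then 1 else 0) + (if k = i then 1 else 0) = ∑ l, c l * A l i) :
    f j + f k = 0 := by
  have h1 : ∑ i, ((∑ l, c l * A l i : ℤ) : ZMod m) * f i = 0 := by
    push_cast
    simp only [Finset.sum_mul]
    rw [Finset.sum_comm]
    refine Finset.sum_eq_zero fun l _ => ?_
    simp only [mul_assoc]
    rw [← Finset.mul_sum, hf, mul_zero]
  simp only [← hc] at h1
  push_cast at h1
  simpa [add_mul, Finset.sum_add_distrib] using h1

theorem mulVec_comp {n : ℕ} {A : Matrix (Fin n) (Fin n) ℤ} {τ : Fin n → Fin n}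
    (hτ : Function.Injective τ) (hA : ∀ i j, A (τ i) (τ j) = A i j) {v : Fin n → ℤ}
    (hv : ∀ i, v (τ i) = v i) (i : Fin n) : (A *ᵥ v) (τ i) = (A *ᵥ v) i := by
  simp only [Matrix.mulVec, dotProduct]
  rw [← (Equiv.ofBijective τ (Finite.injective_iff_bijective.1 hτ)).sum_comp]
  simp only [Equiv.ofBijective_apply, hA, hv]

/-- The vector A^k 1 is invariant under diagram symmetries. When its entries are pairwise distinct,
no symmetry can move a node; `k` is chosen for each exceptional type to achieve this. -/
theorem eq_id_of_mulVec_pow {n : ℕ} {A : Matrix (Fin n) (Fin n) ℤ} {τ : Fin n → Fin n}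
    (hτ : Function.Injective τ) (hA : ∀ i j, A (τ i) (τ j) = A i j) (k : ℕ)
    (hk : ∀ i j, (fun v => A *ᵥ v)^[k] 1 i = (fun v => A *ᵥ v)^[k] 1 j → i = j) : τ = id := by
  funext i
  refine hk _ _ ?_
  simp only [id]
  clear hk
  induction k generalizing i with
  | zero => rfl
  | succ k ih =>
    rw [Function.iterate_succ_apply']
    exact mulVec_comp hτ hA ih i

/-- Descend along the chain from the fixed node `k₀`. The image of `i` is joined to the fixed node
`i + 1`, so it is at least `i`; every larger index is already the image of some index above `i`, so
injectivity leaves only `i`. -/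
theorem chain_fixed {n : ℕ} {A : Matrix (Fin n) (Fin n) ℤ} {τ : Fin n → Fin n}
    (hτ : Function.Injective τ) (hA : ∀ i j, A (τ i) (τ j) = A i j) (k₀ : ℕ)
    (h₀ : ∀ i : Fin n, i.val = k₀ → τ i = i)
    (hs : ∀ j : Fin n, k₀ ≤ j.val → ∃ i : Fin n, k₀ ≤ i.val ∧ τ i = j)
    (h₁ : ∀ i j : Fin n, i.val = j.val + 1 → i.val ≤ k₀ → A j i ≠ 0)
    (h₂ : ∀ i j : Fin n, i.val ≤ k₀ → A j i ≠ 0 → i.val ≤ j.val + 1) (hn : k₀ < n) (i : Fin n)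
    (hi : i.val ≤ k₀) : τ i = i := by
  obtain ⟨d, hd⟩ := Nat.exists_eq_add_of_le hi
  induction d using Nat.strong_induction_on generalizing i with
  | _ d ih =>
    rcases d with _ | d
    · exact h₀ i (by omega)
    · have hi' := ih d (by omega) ⟨i.val + 1, by omega⟩ (by simp; omega) (by simp; omega)
      have h3 := h₁ ⟨i.val + 1, by omega⟩ i rfl (by simp; omega)
      rw [← hA, hi'] at h3
      have h4 := h₂ _ _ (by simp; omega) h3
      simp only [add_le_add_iff_right] at h4
      rcases h4.eq_or_lt with h5 | h5
      · exact (Fin.ext h5).symm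
      · exfalso
        rcases le_or_gt k₀ (τ i).val with h6 | h6
        · obtain ⟨j, hj, hj'⟩ := hs _ h6
          have := hτ hj'
          subst this
          omega
        · have := ih (k₀ - (τ i).val) (by omega) (τ i) (by omega) (by omega)
          have := hτ this
          rw [this] at h5
          exact lt_irrefl _ h5

theorem sum_ite_val_eq {n : ℕ} {R : Type*} [Ring R] (F : ℕ → R) (k : ℕ) :
    ∑ i : Fin n, (if i.val = k then F i.val else 0) = if k < n then F k else 0 := by
  split_ifs with h
  · rw [Finset.sum_eq_single ⟨k, h⟩ (fun i _ hi => if_neg fun h' => hi (Fin.ext h')) (by simp),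
      if_pos rfl]
  · exact Finset.sum_eq_zero fun i _ => if_neg (by omega)

theorem sum_ite_val_succ_eq {n : ℕ} {R : Type*} [Ring R] (F : ℕ → R) (k : ℕ) (hk : k ≤ n) :
    ∑ i : Fin n, (if i.val + 1 = k then F i.val else 0) = if 0 < k then F (k - 1) else 0 := by
  rcases k with _ | k
  · simp
  · have := sum_ite_val_eq (n := n) F k
    rw [if_pos (by omega)] at this
    simpa using this

/-- The weight with (zero-based) index i has class i + 1 in ℤ/(n+1), and this class alone determines
the partner. -/
theorem partner_unique_A {n : ℕ} {τ : Fin n → Fin n}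
    (hQ : ∀ j, ∃ c : Fin n → ℤ, ∀ i, (if j = i then 1 else 0) + (if τ j = i then 1 else 0) =
      ∑ l, c l * CartanMatrix.A n l i) : τ = Fin.rev := by
  funext j
  obtain ⟨c, hc⟩ := hQ j
  have h := apply_add_apply_eq_zero (m := n + 1) (fun i => ((i.val + 1 : ℕ) : ZMod (n + 1))) ?_ hc
  · rw [← Nat.cast_add, ZMod.natCast_eq_zero_iff] at h
    obtain ⟨q, hq⟩ := h
    -- The sum of the two classes lies between 2 and 2n, so n + 1 is its only possible multiple.
    have hq1 : q = 1 := by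
      have := j.2
      have := (τ j).2
      have h1 : q < 2 := by
        by_contra h2
        have : (n + 1) * 2 ≤ (n + 1) * q := Nat.mul_le_mul_left _ (by omega)
        omega
      have h0 : q ≠ 0 := by rintro rfl; omega
      omega
    subst hq1
    apply Fin.ext
    rw [Fin.val_rev]
    omega
  · intro l
    have h1 (i : Fin n) : ((CartanMatrix.A n l i : ℤ) : ZMod (n + 1)) * ((i.val + 1 : ℕ) : ZMod (n + 1))
        = 2 * (if i.val = l.val then ((i.val + 1 : ℕ) : ZMod (n + 1)) else 0) -
          (if i.val = l.val + 1 then ((i.val + 1 : ℕ) : ZMod (n + 1)) else 0) -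
          (if i.val + 1 = l.val then ((i.val + 1 : ℕ) : ZMod (n + 1)) else 0) := by
      simp only [CartanMatrix.A, Matrix.of_apply, Fin.ext_iff]
      split_ifs <;> first | omega | (push_cast; ring)
    simp only [h1, Finset.sum_sub_distrib, ← Finset.mul_sum]
    rw [sum_ite_val_eq (fun i => ((i + 1 : ℕ) : ZMod (n + 1))),
      sum_ite_val_eq (fun i => ((i + 1 : ℕ) : ZMod (n + 1))),
      sum_ite_val_succ_eq (fun i => ((i + 1 : ℕ) : ZMod (n + 1))) _ l.2.le, if_pos l.2]
    have h2 : (if l.val + 1 < n then ((l.val + 1 + 1 : ℕ) : ZMod (n + 1)) else 0) =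
        ((l.val + 1 + 1 : ℕ) : ZMod (n + 1)) := by
      split_ifs with h
      · rfl
      · rw [eq_comm, ZMod.natCast_eq_zero_iff]
        exact ⟨1, by have := l.2; omega⟩
    have h3 : (if 0 < l.val then ((l.val - 1 + 1 : ℕ) : ZMod (n + 1)) else 0) = (l.val : ZMod (n + 1)) := by
      split_ifs with h
      · rw [Nat.sub_add_cancel h]
      · rw [show l.val = 0 by omega]; simp
    rw [h2, h3]
    push_cast
    ring

/-- The entry -2 occurs once in the Cartan matrix and pins the last two nodes; the chain does the
rest. -/
theorem partner_unique_B {n : ℕ} (hn : 3 ≤ n) {τ : Fin n → Fin n} (hτ : Function.Injective τ)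
    (hA : ∀ i j, CartanMatrix.B n (τ i) (τ j) = CartanMatrix.B n i j) : τ = id := by
  have h2 (i j : Fin n) : CartanMatrix.B n i j = -2 ↔ i.val = n - 2 ∧ j.val = n - 1 := by
    simp only [CartanMatrix.B, Matrix.of_apply, Fin.ext_iff]
    refine ⟨fun h => ?_, fun h => ?_⟩
    · split_ifs at h <;> omega
    · split_ifs <;> omega
  have h3 := (h2 ⟨n - 2, by omega⟩ ⟨n - 1, by omega⟩).2 ⟨rfl, rfl⟩
  rw [← hA, h2] at h3
  have hfix (i : Fin n) (hi : n - 2 ≤ i.val) : τ i = i := by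
    have : i = ⟨n - 2, by omega⟩ ∨ i = ⟨n - 1, by omega⟩ := by
      simp only [Fin.ext_iff]; omega
    rcases this with h | h <;> rw [h]
    · exact Fin.ext h3.1
    · exact Fin.ext h3.2
  funext i
  by_cases hi : n - 2 ≤ i.val
  · exact hfix i hi
  refine chain_fixed hτ hA (n - 2) (fun i hi => hfix i hi.ge) (fun j hj => ⟨j, hj, hfix j hj⟩)
    ?_ ?_ (by omega) i (by omega)
  all_goals
    intro i j hij hi
    simp only [CartanMatrix.B, Matrix.of_apply, Fin.ext_iff] at hi ⊢
    split_ifs at hi ⊢ <;> omega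

theorem partner_unique_C {n : ℕ} (hn : 2 ≤ n) {τ : Fin n → Fin n} (hτ : Function.Injective τ)
    (hA : ∀ i j, CartanMatrix.C n (τ i) (τ j) = CartanMatrix.C n i j) : τ = id := by
  have h2 (i j : Fin n) : CartanMatrix.C n i j = -2 ↔ i.val = n - 1 ∧ j.val = n - 2 := by
    simp only [CartanMatrix.C, Matrix.of_apply, Fin.ext_iff]
    refine ⟨fun h => ?_, fun h => ?_⟩
    · split_ifs at h <;> omega
    · split_ifs <;> omega
  have h3 := (h2 ⟨n - 1, by omega⟩ ⟨n - 2, by omega⟩).2 ⟨rfl, rfl⟩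
  rw [← hA, h2] at h3
  have hfix (i : Fin n) (hi : n - 2 ≤ i.val) : τ i = i := by
    have : i = ⟨n - 2, by omega⟩ ∨ i = ⟨n - 1, by omega⟩ := by
      simp only [Fin.ext_iff]; omega
    rcases this with h | h <;> rw [h]
    · exact Fin.ext h3.2
    · exact Fin.ext h3.1
  funext i
  by_cases hi : n - 2 ≤ i.val
  · exact hfix i hi
  refine chain_fixed hτ hA (n - 2) (fun i hi => hfix i hi.ge) (fun j hj => ⟨j, hj, hfix j hj⟩)
    ?_ ?_ (by omega) i (by omega)
  all_goals
    intro i j hij hi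
    simp only [CartanMatrix.C, Matrix.of_apply, Fin.ext_iff] at hi ⊢
    split_ifs at hi ⊢ <;> omega

/-! ### Rows of the Cartan matrix of type D -/

variable {n : ℕ} {R : Type*} [CommRing R] (F : ℕ → R) (l : Fin n)

theorem sum_D_of_lt (h : l.val + 3 < n) :
    ∑ i : Fin n, ((CartanMatrix.D n l i : ℤ) : R) * F i.val =
      2 * F l.val - F (l.val + 1) - (if 0 < l.val then F (l.val - 1) else 0) := by
  have h1 (i : Fin n) : ((CartanMatrix.D n l i : ℤ) : R) * F i.val =
      2 * (if i.val = l.val then F i.val else 0) - (if i.val = l.val + 1 then F i.val else 0)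
        - (if i.val + 1 = l.val then F i.val else 0) := by
    have h2 : CartanMatrix.D n l i = 2 * (if i.val = l.val then 1 else 0)
        - (if i.val = l.val + 1 then 1 else 0) - (if i.val + 1 = l.val then 1 else 0) := by
      simp only [CartanMatrix.D, Matrix.of_apply, Fin.ext_iff]
      split_ifs <;> omega
    rw [h2]
    push_cast
    simp only [sub_mul, mul_assoc, ite_mul, one_mul, zero_mul]
  simp only [h1, Finset.sum_sub_distrib, ← Finset.mul_sum]
  rw [sum_ite_val_eq, if_pos l.2, sum_ite_val_eq, if_pos (by omega), sum_ite_val_succ_eq _ _ l.2.le]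

theorem sum_D_of_eq (hn : 4 ≤ n) (h : l.val + 3 = n) :
    ∑ i : Fin n, ((CartanMatrix.D n l i : ℤ) : R) * F i.val =
      2 * F (n - 3) - F (n - 4) - F (n - 2) - F (n - 1) := by
  have h1 (i : Fin n) : ((CartanMatrix.D n l i : ℤ) : R) * F i.val =
      2 * (if i.val = n - 3 then F i.val else 0) - (if i.val = n - 4 then F i.val else 0)
        - (if i.val = n - 2 then F i.val else 0) - (if i.val = n - 1 then F i.val else 0) := by
    have h2 : CartanMatrix.D n l i = 2 * (if i.val = n - 3 then 1 else 0)
        - (if i.val = n - 4 then 1 else 0) - (if i.val = n - 2 then 1 else 0)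
        - (if i.val = n - 1 then 1 else 0) := by
      simp only [CartanMatrix.D, Matrix.of_apply, Fin.ext_iff]
      split_ifs <;> omega
    rw [h2]
    push_cast
    simp only [sub_mul, mul_assoc, ite_mul, one_mul, zero_mul]
  simp only [h1, Finset.sum_sub_distrib, ← Finset.mul_sum]
  rw [sum_ite_val_eq, if_pos (by omega), sum_ite_val_eq, if_pos (by omega), sum_ite_val_eq,
    if_pos (by omega), sum_ite_val_eq, if_pos (by omega)]

theorem sum_D_of_gt (hn : 4 ≤ n) (h : n ≤ l.val + 2) :
    ∑ i : Fin n, ((CartanMatrix.D n l i : ℤ) : R) * F i.val = 2 * F l.val - F (n - 3) := by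
  have h1 (i : Fin n) : ((CartanMatrix.D n l i : ℤ) : R) * F i.val =
      2 * (if i.val = l.val then F i.val else 0) - (if i.val = n - 3 then F i.val else 0) := by
    have h2 : CartanMatrix.D n l i = 2 * (if i.val = l.val then 1 else 0)
        - (if i.val = n - 3 then 1 else 0) := by
      simp only [CartanMatrix.D, Matrix.of_apply, Fin.ext_iff]
      split_ifs <;> omega
    rw [h2]
    push_cast
    simp only [sub_mul, mul_assoc, ite_mul, one_mul, zero_mul]
  simp only [h1, Finset.sum_sub_distrib, ← Finset.mul_sum]
  rw [sum_ite_val_eq, if_pos l.2, sum_ite_val_eq, if_pos (by omega)]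

/-- The chain nodes get the values 2, 4, 6, ..., and the fork ends get `a₁` and `a₂`. The three
conditions are the equations of the rows at the two ends and at the branch node. -/
theorem class_D (hn : 4 ≤ n) (a₁ a₂ : R) (h3 : 2 * a₁ = 2 * ((n : R) - 2))
    (h4 : 2 * a₂ = 2 * ((n : R) - 2)) (h5 : a₁ + a₂ = 2 * ((n : R) - 1)) (f : ℕ → R)
    (hf : ∀ i, i + 2 < n → f i = 2 * ((i : R) + 1)) (hf1 : f (n - 2) = a₁) (hf2 : f (n - 1) = a₂)
    (l : Fin n) : ∑ i : Fin n, ((CartanMatrix.D n l i : ℤ) : R) * f i.val = 0 := by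
  have c3 : ((n - 3 : ℕ) : R) = n - 3 := by rw [Nat.cast_sub (by omega)]; norm_num
  have c4 : ((n - 4 : ℕ) : R) = n - 4 := by rw [Nat.cast_sub (by omega)]; norm_num
  rcases lt_trichotomy (l.val + 3) n with h | h | h
  · rw [sum_D_of_lt f l h, hf _ (by omega), hf _ (by omega)]
    split_ifs with h0
    · rw [hf _ (by omega), Nat.cast_sub (by omega)]
      push_cast
      ring
    · rw [show l.val = 0 by omega]
      push_cast
      ring
  · rw [sum_D_of_eq f l hn h, hf _ (by omega), hf _ (by omega), hf1, hf2, c3, c4]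
    linear_combination -h5
  · rw [sum_D_of_gt f l hn (by omega), hf (n - 3) (by omega), c3]
    have : l.val = n - 2 ∨ l.val = n - 1 := by omega
    rcases this with h0 | h0 <;> rw [h0]
    · rw [hf1]
      linear_combination h3
    · rw [hf2]
      linear_combination h4

end Types


/-! ### Identification of the opposition, and the constant κ -/

section InvolutionTypes

open Matrix

theorem partner_unique_D {n : ℕ} (hn : 4 ≤ n) {τ : Fin n → Fin n} (hτ : Function.Injective τ)
    (hA : ∀ i j, CartanMatrix.D n (τ i) (τ j) = CartanMatrix.D n i j)
    (hQ : ∀ j, ∃ c : Fin n → ℤ, ∀ i, (if j = i then 1 else 0) + (if τ j = i then 1 else 0) =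
      ∑ l, c l * CartanMatrix.D n l i) : τ = (SimpleType.D n hn).partner := by
  have hadd {m : ℕ} (a₁ a₂ : ZMod m) (h3 : 2 * a₁ = 2 * ((n : ZMod m) - 2))
      (h4 : 2 * a₂ = 2 * ((n : ZMod m) - 2)) (h5 : a₁ + a₂ = 2 * ((n : ZMod m) - 1)) (j : Fin n) :
      (fun i : ℕ => if i = n - 2 then a₁ else if i = n - 1 then a₂ else 2 * ((i : ZMod m) + 1)) j.val +
      (fun i : ℕ => if i = n - 2 then a₁ else if i = n - 1 then a₂ else 2 * ((i : ZMod m) + 1))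
        (τ j).val = 0 := by
    obtain ⟨c, hc⟩ := hQ j
    refine apply_add_apply_eq_zero (fun i => (fun i : ℕ => if i = n - 2 then a₁ else
      if i = n - 1 then a₂ else 2 * ((i : ZMod m) + 1)) i.val) ?_ hc
    refine class_D hn a₁ a₂ h3 h4 h5 (fun i : ℕ => if i = n - 2 then a₁ else
      if i = n - 1 then a₂ else 2 * ((i : ZMod m) + 1)) (fun i hi => ?_) ?_ ?_
    · rw [if_neg (by omega), if_neg (by omega)]
    · simp
    · rw [if_neg (by omega), if_pos rfl]
  -- Modulo 2 the chain nodes have class 0 and the fork ends class 1. This excludes the triality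
  -- symmetries when n = 4.
  have hspin (j : Fin n) (hj : n - 2 ≤ j.val) : n - 2 ≤ (τ j).val := by
    have two : (2 : ZMod 2) = 0 := rfl
    have h := hadd (m := 2) 1 1 (by simp [two]) (by simp [two])
      (by rw [one_add_one_eq_two, two]; simp) j
    by_contra h'
    have hj' : j.val = n - 2 ∨ j.val = n - 1 := by omega
    have h1 : (τ j).val ≠ n - 2 := by omega
    have h2 : (τ j).val ≠ n - 1 := by omega
    have h3 : n - 1 ≠ n - 2 := by omega
    rcases hj' with hj' | hj' <;> simp [hj', h1, h2, h3, two] at h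
  have hne : n - 1 ≠ n - 2 := by omega
  have hcase (j : Fin n) : (τ j).val < n - 2 ∨ (τ j).val = n - 2 ∨ (τ j).val = n - 1 := by
    have := (τ j).2; omega
  have hl2 : n - 2 < n := by omega
  have hl1 : n - 1 < n := by omega
  have htail (j : Fin n) (hj : n - 2 ≤ j.val) : τ j = (SimpleType.D n hn).partner j := by
    have hj' : j = ⟨n - 2, hl2⟩ ∨ j = ⟨n - 1, hl1⟩ := by
      simp only [Fin.ext_iff]; omega
    have h1 := hspin j hj
    rcases Nat.even_or_odd n with he | ho
    · have hp : (SimpleType.D n hn).partner = id := if_pos he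
      rw [hp]
      obtain ⟨k, hk⟩ := he
      have hn4 : ∀ k : ZMod 4, 2 * ((k + k) - 2) = 0 ∧ 2 * ((k + k) - 1) = 2 := by decide
      have hnk : ((n : ℕ) : ZMod 4) = (k : ZMod 4) + k := by rw [hk]; push_cast; ring
      -- For even n the fork ends have classes 2 and 0 modulo 4; as 2 + 0 ≠ 0, they cannot be
      -- exchanged.
      have h := hadd (m := 4) 2 0 (by rw [hnk, (hn4 k).1]; rfl) (by rw [hnk, (hn4 k).1]; rfl)
        (by rw [hnk, (hn4 k).2]; rfl) j
      have two : (2 : ZMod 4) ≠ 0 := by decide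
      rcases hj' with rfl | rfl
      · rcases hcase ⟨n - 2, hl2⟩ with h2 | h2 | h2
        · omega
        · exact Fin.ext h2
        · simp [h2, hne, two] at h
      · rcases hcase ⟨n - 1, hl1⟩ with h2 | h2 | h2
        · omega
        · simp [h2, hne, two] at h
        · exact Fin.ext h2
    · have hp : (SimpleType.D n hn).partner = Equiv.swap ⟨n - 2, by omega⟩ ⟨n - 1, by omega⟩ :=
        if_neg (Nat.not_even_iff_odd.2 ho)
      rw [hp]
      obtain ⟨k, hk⟩ := ho
      have hn4 : ∀ k : ZMod 4, 2 * ((2 * k + 1) - 2) = 2 ∧ 2 * ((2 * k + 1) - 1) = 0 := by decide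
      have hnk : ((n : ℕ) : ZMod 4) = 2 * (k : ZMod 4) + 1 := by rw [hk]; push_cast; ring
      -- For odd n the classes are 1 and 3 modulo 4; neither is its own negative, so the ends are
      -- exchanged.
      have h := hadd (m := 4) 1 3 (by rw [hnk, (hn4 k).1]; rfl) (by rw [hnk, (hn4 k).1]; rfl)
        (by rw [hnk, (hn4 k).2]; rfl) j
      have two : (1 + 1 : ZMod 4) ≠ 0 := by decide
      have six : (3 + 3 : ZMod 4) ≠ 0 := by decide
      rcases hj' with rfl | rfl
      · rw [Equiv.swap_apply_left]
        rcases hcase ⟨n - 2, hl2⟩ with h2 | h2 | h2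
        · omega
        · simp only [h2, if_true] at h
          exact absurd h two
        · exact Fin.ext h2
      · rw [Equiv.swap_apply_right]
        rcases hcase ⟨n - 1, hl1⟩ with h2 | h2 | h2
        · omega
        · exact Fin.ext h2
        · simp only [h2, if_true, if_neg hne] at h
          exact absurd h six
  have hpp (j : Fin n) : n - 2 ≤ ((SimpleType.D n hn).partner j).val ↔ n - 2 ≤ j.val := by
    simp only [SimpleType.partner]
    split_ifs
    · rfl
    · rw [Equiv.swap_apply_def]
      split_ifs with h1 h2 <;> simp_all <;> omega
  have hinv (j : Fin n) : (SimpleType.D n hn).partner ((SimpleType.D n hn).partner j) = j := by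
    simp only [SimpleType.partner]
    split_ifs
    · rfl
    · simp
  -- The branch node is the only neighbour of a fork end.
  have h3 : τ ⟨n - 3, by omega⟩ = ⟨n - 3, by omega⟩ := by
    have h4 (j : Fin n) (hj : n - 2 ≤ j.val) : CartanMatrix.D n ⟨n - 3, by omega⟩ j = -1 := by
      simp only [CartanMatrix.D, Matrix.of_apply, Fin.ext_iff]
      split_ifs <;> omega
    have h5 := h4 ((SimpleType.D n hn).partner ⟨n - 2, by omega⟩) ((hpp _).2 le_rfl)
    rw [← hA, htail _ ((hpp _).2 le_rfl), hinv] at h5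
    apply Fin.ext
    revert h5
    generalize τ ⟨n - 3, by omega⟩ = k
    intro h5
    simp only [CartanMatrix.D, Matrix.of_apply, Fin.ext_iff] at h5
    split_ifs at h5 <;> simp <;> omega
  funext i
  by_cases hi : n - 2 ≤ i.val
  · exact htail i hi
  have hpi : (SimpleType.D n hn).partner i = i := by
    simp only [SimpleType.partner]
    split_ifs
    · rfl
    · refine Equiv.swap_apply_of_ne_of_ne ?_ ?_ <;> simp only [ne_eq, Fin.ext_iff] <;> omega
  rw [hpi]
  refine chain_fixed hτ hA (n - 3) (fun i hi => ?_) (fun j hj => ?_) ?_ ?_ (by omega) i (by omega)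
  · rw [show i = ⟨n - 3, by omega⟩ from Fin.ext hi, h3]
  · by_cases hj' : j.val = n - 3
    · refine ⟨j, hj, ?_⟩
      rw [show j = ⟨n - 3, by omega⟩ from Fin.ext hj', h3]
    · have h6 : n - 2 ≤ j.val := by omega
      refine ⟨(SimpleType.D n hn).partner j, ?_, ?_⟩
      · have := (hpp j).2 h6
        omega
      · rw [htail _ ((hpp j).2 h6), hinv]
  all_goals
    intro i j hij hi
    simp only [CartanMatrix.D, Matrix.of_apply, Fin.ext_iff] at hi ⊢
    split_ifs at hi ⊢ <;> omega

theorem partner_unique {n : ℕ} (T : SimpleType n) {τ : Fin n → Fin n} (hτ : Function.Injective τ)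
    (hA : ∀ i j, T.cartanMatrix (τ i) (τ j) = T.cartanMatrix i j)
    (hQ : ∀ j, ∃ c : Fin n → ℤ, ∀ i, (if j = i then 1 else 0) + (if τ j = i then 1 else 0) =
      ∑ l, c l * T.cartanMatrix l i) : τ = T.partner := by
  cases T with
  | A n h => exact partner_unique_A hQ
  | B n h => exact partner_unique_B h hτ hA
  | C n h => exact partner_unique_C h hτ hA
  | D n h => exact partner_unique_D h hτ hA hQ
  | E6 =>
    funext j
    -- The row sums of the Cartan matrix separate the nodes {1,5,6}, {2,4} and {3}; the classes
    -- modulo 3 then single out the partner inside each group.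
    have h1 := mulVec_comp hτ hA (v := 1) (fun _ => rfl) j
    obtain ⟨c, hc⟩ := hQ j
    have h2 := apply_add_apply_eq_zero (m := 3) ![1, 2, 0, 1, 2, 0] (by decide) hc
    generalize τ j = k at h1 h2
    clear hc hQ hA hτ
    revert j k
    decide
  | E7 => exact eq_id_of_mulVec_pow hτ hA 3 (by decide)
  | E8 => exact eq_id_of_mulVec_pow hτ hA 4 (by decide)
  | F4 => exact eq_id_of_mulVec_pow hτ hA 2 (by decide)
  | G2 => exact eq_id_of_mulVec_pow hτ hA 1 (by decide)

theorem partner_partner {n : ℕ} (T : SimpleType n) (j : Fin n) : T.partner (T.partner j) = j := by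
  cases T with
  | A n h => exact Fin.rev_rev j
  | D n h =>
    simp only [SimpleType.partner]
    split_ifs
    · rfl
    · simp
  | E6 => revert j; decide
  | _ => rfl

/-- Each index moved by the partner map contributes one half. In type A a fixed zero-based index j
satisfies 2j + 1 = n, so 2⌊n/2⌋ indices are moved. -/
theorem kappa_sq {n : ℕ} (T : SimpleType n) :
    T.kappa ^ 2 = ∏ j, (if T.partner j = j then (1 : ℝ) else 1 / 2) := by
  cases T with
  | A n h =>
    change ((1 / 2 : ℝ) ^ (n / 2)) ^ 2 = ∏ j : Fin n, if j.rev = j then (1 : ℝ) else 1 / 2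
    rw [Finset.prod_ite, Finset.prod_const_one, one_mul, Finset.prod_const, ← pow_mul]
    congr 1
    have h2 : (Finset.univ.filter fun j : Fin n => ¬ j.rev = j).card =
        ((Finset.range n).filter (fun k => ¬ 2 * k + 1 = n)).card := by
      refine Finset.card_bij (fun j _ => j.val) (fun j hj => ?_) (fun _ _ _ _ h => Fin.ext h)
        fun k hk => ?_
      · have := j.2
        simp [Fin.ext_iff, Fin.val_rev] at hj ⊢
        omega
      · simp at hk
        refine ⟨⟨k, hk.1⟩, ?_, rfl⟩
        simp [Fin.ext_iff, Fin.val_rev]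
        omega
    rw [h2]
    have h3 := Finset.card_filter_add_card_filter_not (s := Finset.range n) (fun k => 2 * k + 1 = n)
    rw [Finset.card_range] at h3
    rcases Nat.even_or_odd' n with ⟨k, rfl | rfl⟩
    · have h4 : (Finset.range (2 * k)).filter (fun i => 2 * i + 1 = 2 * k) = ∅ := by
        ext; simp; omega
      rw [h4] at h3
      simp at h3 ⊢
      omega
    · have h4 : (Finset.range (2 * k + 1)).filter (fun i => 2 * i + 1 = 2 * k + 1) = {k} := by
        ext i; simp only [Finset.mem_filter, Finset.mem_range, Finset.mem_singleton]; omega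
      rw [h4] at h3
      simp at h3 ⊢
      omega
  | D n h =>
    simp only [SimpleType.kappa, SimpleType.partner]
    split_ifs with he
    · simp
    · rw [← Finset.prod_subset (Finset.subset_univ
        {(⟨n - 2, by omega⟩ : Fin n), (⟨n - 1, by omega⟩ : Fin n)})]
      · rw [Finset.prod_pair (by simp; omega), Equiv.swap_apply_left, Equiv.swap_apply_right,
          if_neg (by simp; omega), if_neg (by simp; omega), sq]
      · intro j _ hj
        simp only [Finset.mem_insert, Finset.mem_singleton, not_or] at hj
        rw [Equiv.swap_apply_of_ne_of_ne hj.1 hj.2, if_pos rfl]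
  | E6 =>
    simp [SimpleType.kappa, SimpleType.partner, Fin.prod_univ_succ]
    norm_num [Fin.ext_iff]
  | _ => simp [SimpleType.kappa, SimpleType.partner]

theorem kappa_pos {n : ℕ} (T : SimpleType n) : 0 < T.kappa := by
  cases T <;> simp only [SimpleType.kappa] <;> try split_ifs
  all_goals positivity

end InvolutionTypes


/-! ### Formal exponential sums -/

section Formal

variable {V : Type*} [AddCommGroup V] [Module ℝ V]

/-- Formal linear combinations of exponentials. -/
abbrev ExpAlg (V : Type*) [AddCommGroup V] : Type _ := AddMonoidAlgebra ℂ V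

open AddMonoidAlgebra (single)

theorem exists_of_coeff_mul_ne_zero {f g : ExpAlg V} {μ : V} (h : (f * g).coeff μ ≠ 0) :
    ∃ a b, f.coeff a ≠ 0 ∧ g.coeff b ≠ 0 ∧ a + b = μ := by
  classical
  have := AddMonoidAlgebra.support_coeff_mul_subset f g (Finsupp.mem_support_iff.2 h)
  obtain ⟨a, ha, b, hb, hab⟩ := Finset.mem_add.1 this
  exact ⟨a, b, Finsupp.mem_support_iff.1 ha, Finsupp.mem_support_iff.1 hb, hab⟩

theorem eq_of_coeff_single_ne_zero {a μ : V} {c : ℂ} (h : (single a c).coeff μ ≠ 0) : a = μ := by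
  classical
  by_contra h'
  exact h (by rw [AddMonoidAlgebra.coeff_single, Finsupp.single_apply, if_neg h'])

/-- The subalgebra of formal sums with all exponents in a given group. -/
def expSubalgebra (L : AddSubgroup V) : Subalgebra ℂ (ExpAlg V) where
  carrier := {f | ∀ μ, f.coeff μ ≠ 0 → μ ∈ L}
  mul_mem' {f g} hf hg μ h := by
    obtain ⟨a, b, ha, hb, rfl⟩ := exists_of_coeff_mul_ne_zero h
    exact L.add_mem (hf a ha) (hg b hb)
  add_mem' {f g} hf hg μ h := by
    by_contra hμ
    refine h ?_
    rw [AddMonoidAlgebra.coeff_add, Finsupp.add_apply, not_imp_comm.1 (hf μ) hμ,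
      not_imp_comm.1 (hg μ) hμ, add_zero]
  algebraMap_mem' c μ h := by
    rw [← eq_of_coeff_single_ne_zero h]
    exact L.zero_mem

theorem single_mem_expSubalgebra {L : AddSubgroup V} {μ : V} (hμ : μ ∈ L) (c : ℂ) :
    single μ c ∈ expSubalgebra L := fun _ h => eq_of_coeff_single_ne_zero h ▸ hμ

variable (φ : V →ₗ[ℝ] ℝ)

/-- The formal sums with all exponents in the half space `φ < d`. -/
def below (d : ℝ) : Submodule ℂ (ExpAlg V) where
  carrier := {f | ∀ μ, f.coeff μ ≠ 0 → φ μ < d}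
  add_mem' {f g} hf hg μ h := by
    by_contra hμ
    refine h ?_
    rw [AddMonoidAlgebra.coeff_add, Finsupp.add_apply, not_imp_comm.1 (hf μ) hμ,
      not_imp_comm.1 (hg μ) hμ, add_zero]
  zero_mem' μ h := absurd rfl h
  smul_mem' c f hf μ h := hf μ fun h' => h (by
    rw [AddMonoidAlgebra.coeff_smul_apply, h', smul_zero])

/-- The formal sums with all exponents in the half space `φ ≤ d`. -/
def atMost (d : ℝ) : Submodule ℂ (ExpAlg V) where
  carrier := {f | ∀ μ, f.coeff μ ≠ 0 → φ μ ≤ d}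
  add_mem' {f g} hf hg μ h := by
    by_contra hμ
    refine h ?_
    rw [AddMonoidAlgebra.coeff_add, Finsupp.add_apply, not_imp_comm.1 (hf μ) hμ,
      not_imp_comm.1 (hg μ) hμ, add_zero]
  zero_mem' μ h := absurd rfl h
  smul_mem' c f hf μ h := hf μ fun h' => h (by
    rw [AddMonoidAlgebra.coeff_smul_apply, h', smul_zero])

variable {φ}

theorem below_le_atMost (d : ℝ) : below φ d ≤ atMost φ d := fun _ hf μ h => (hf μ h).le

theorem mul_mem_below {d d' : ℝ} {f g : ExpAlg V} (hf : f ∈ below φ d) (hg : g ∈ atMost φ d') :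
    f * g ∈ below φ (d + d') := fun μ h => by
  obtain ⟨a, b, ha, hb, rfl⟩ := exists_of_coeff_mul_ne_zero h
  rw [map_add]
  exact add_lt_add_of_lt_of_le (hf a ha) (hg b hb)

theorem mul_mem_atMost {d d' : ℝ} {f g : ExpAlg V} (hf : f ∈ atMost φ d) (hg : g ∈ atMost φ d') :
    f * g ∈ atMost φ (d + d') := fun μ h => by
  obtain ⟨a, b, ha, hb, rfl⟩ := exists_of_coeff_mul_ne_zero h
  rw [map_add]
  exact add_le_add (hf a ha) (hg b hb)

theorem single_mem_atMost (μ : V) (c : ℂ) : single μ c ∈ atMost φ (φ μ) := fun _ h =>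
  (congrArg φ (eq_of_coeff_single_ne_zero h)).ge

theorem one_mem_atMost : (1 : ExpAlg V) ∈ atMost φ 0 := by
  have := single_mem_atMost (φ := φ) (0 : V) 1
  rwa [map_zero] at this

theorem pow_mem_atMost {d : ℝ} {f : ExpAlg V} (hf : f ∈ atMost φ d) (k : ℕ) :
    f ^ k ∈ atMost φ (k * d) := by
  induction k with
  | zero => simpa using one_mem_atMost
  | succ k ih =>
    rw [pow_succ]
    convert mul_mem_atMost ih hf using 2
    push_cast
    ring

theorem prod_mem_atMost {κ : Type*} (s : Finset κ) {f : κ → ExpAlg V} {d : κ → ℝ}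
    (hf : ∀ i ∈ s, f i ∈ atMost φ (d i)) : ∏ i ∈ s, f i ∈ atMost φ (∑ i ∈ s, d i) := by
  classical
  induction s using Finset.induction_on with
  | empty => simpa using one_mem_atMost
  | insert a s ha ih =>
    rw [Finset.prod_insert ha, Finset.sum_insert ha]
    exact mul_mem_atMost (hf a (Finset.mem_insert_self a s))
      (ih fun i hi => hf i (Finset.mem_insert_of_mem hi))

variable (φ) in
/-- `f` has leading term `c • exp λ` with respect to the linear form `φ`. -/
def HasLeading (f : ExpAlg V) (lam : V) (c : ℂ) : Prop := f - single lam c ∈ below φ (φ lam)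

theorem HasLeading.coeff_of_le {f : ExpAlg V} {lam μ : V} {c : ℂ} (h : HasLeading φ f lam c)
    (hμ : φ lam ≤ φ μ) : f.coeff μ = (single lam c).coeff μ := by
  by_contra h'
  refine hμ.not_gt (h μ ?_)
  rwa [AddMonoidAlgebra.coeff_sub, Finsupp.sub_apply, sub_ne_zero]

theorem HasLeading.coeff_eq {f : ExpAlg V} {lam : V} {c : ℂ} (h : HasLeading φ f lam c) :
    f.coeff lam = c := by
  rw [h.coeff_of_le le_rfl, AddMonoidAlgebra.coeff_single, Finsupp.single_eq_same]

theorem HasLeading.mem_atMost {f : ExpAlg V} {lam : V} {c : ℂ} (h : HasLeading φ f lam c) :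
    f ∈ atMost φ (φ lam) := by
  rw [← sub_add_cancel f (single lam c)]
  exact add_mem (below_le_atMost _ h) (single_mem_atMost lam c)

theorem hasLeading_iff {f : ExpAlg V} {lam : V} {c : ℂ} :
    HasLeading φ f lam c ↔ f.coeff lam = c ∧ ∀ μ, f.coeff μ ≠ 0 → μ = lam ∨ φ μ < φ lam := by
  constructor
  · refine fun h => ⟨h.coeff_eq, fun μ hμ => ?_⟩
    by_contra! h'
    rw [h.coeff_of_le h'.2] at hμ
    exact h'.1 (eq_of_coeff_single_ne_zero hμ).symm
  · classical
    rintro ⟨h1, h2⟩ μ hμ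
    rcases eq_or_ne μ lam with rfl | hne
    · rw [AddMonoidAlgebra.coeff_sub, Finsupp.sub_apply, h1, AddMonoidAlgebra.coeff_single,
        Finsupp.single_eq_same, sub_self] at hμ
      exact absurd rfl hμ
    · refine (h2 μ fun h0 => hμ ?_).resolve_left hne
      rw [AddMonoidAlgebra.coeff_sub, Finsupp.sub_apply, h0, AddMonoidAlgebra.coeff_single,
        Finsupp.single_apply, if_neg hne.symm, sub_zero]

theorem hasLeading_one : HasLeading φ (1 : ExpAlg V) 0 1 := by
  rw [HasLeading, AddMonoidAlgebra.one_def, sub_self]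
  exact zero_mem _

theorem HasLeading.mul {f g : ExpAlg V} {lam mu : V} {c d : ℂ} (hf : HasLeading φ f lam c)
    (hg : HasLeading φ g mu d) : HasLeading φ (f * g) (lam + mu) (c * d) := by
  have h : f * g - single (lam + mu) (c * d) =
      (f - single lam c) * g + (g - single mu d) * single lam c := by
    rw [← AddMonoidAlgebra.single_mul_single, sub_mul, sub_mul, mul_comm g, mul_comm (single mu d)]
    abel
  rw [HasLeading, h, map_add]
  refine add_mem (mul_mem_below hf hg.mem_atMost) ?_
  rw [add_comm (φ lam)]
  exact mul_mem_below hg (single_mem_atMost lam c)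

theorem HasLeading.pow {f : ExpAlg V} {lam : V} {c : ℂ} (hf : HasLeading φ f lam c) (k : ℕ) :
    HasLeading φ (f ^ k) (k • lam) (c ^ k) := by
  induction k with
  | zero => simpa using hasLeading_one
  | succ k ih =>
    rw [pow_succ, pow_succ, succ_nsmul]
    exact ih.mul hf

theorem HasLeading.prod {κ : Type*} (s : Finset κ) {f : κ → ExpAlg V} {lam : κ → V} {c : κ → ℂ}
    (hf : ∀ i ∈ s, HasLeading φ (f i) (lam i) (c i)) :
    HasLeading φ (∏ i ∈ s, f i) (∑ i ∈ s, lam i) (∏ i ∈ s, c i) := by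
  classical
  induction s using Finset.induction_on with
  | empty => simpa using hasLeading_one
  | insert a s ha ih =>
    rw [Finset.prod_insert ha, Finset.sum_insert ha, Finset.prod_insert ha]
    exact (hf a (Finset.mem_insert_self a s)).mul
      (ih fun i hi => hf i (Finset.mem_insert_of_mem hi))

/-- The coefficients may be zero, a summand then being strictly below the exponent. This lets sums
over the Weyl group or over permutations keep only the terms that matter. -/
theorem HasLeading.sum {κ : Type*} (s : Finset κ) {f : κ → ExpAlg V} {lam : V} {c : κ → ℂ}
    (hf : ∀ i ∈ s, HasLeading φ (f i) lam (c i)) :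
    HasLeading φ (∑ i ∈ s, f i) lam (∑ i ∈ s, c i) := by
  have h : ∑ i ∈ s, f i - single lam (∑ i ∈ s, c i) = ∑ i ∈ s, (f i - single lam (c i)) := by
    rw [Finset.sum_sub_distrib]
    congr 1
    exact map_sum (AddMonoidAlgebra.singleAddHom lam) c s
  rw [HasLeading, h]
  exact sum_mem hf

theorem HasLeading.smul {f : ExpAlg V} {lam : V} {c : ℂ} (hf : HasLeading φ f lam c) (d : ℂ) :
    HasLeading φ (d • f) lam (d * c) := by
  rw [HasLeading, ← smul_eq_mul, ← AddMonoidAlgebra.smul_single, ← smul_sub]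
  exact Submodule.smul_mem _ d hf

end Formal

/-! ### Evaluation and the Weyl group action -/

section Eval

open AddMonoidAlgebra (single)

variable {ι V N : Type*} [AddCommGroup V] [Module ℝ V] [AddCommGroup N] [Module ℝ N]
  {P : RootPairing ι ℝ V N}

theorem expFun_add (μ ν : V) (x : N) : expFun P (μ + ν) x = expFun P μ x * expFun P ν x := by
  simp only [expFun, ← Complex.exp_add, map_add, LinearMap.add_apply, Complex.ofReal_add, mul_add]

@[simp] theorem expFun_zero (x : N) : expFun P 0 x = 1 := by simp [expFun]

variable (P) in
/-- Evaluation of formal exponential sums. -/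
noncomputable def evalExp (x : N) : ExpAlg V →ₐ[ℂ] ℂ :=
  AddMonoidAlgebra.lift ℂ ℂ V
    { toFun := fun μ => expFun P μ.toAdd x
      map_one' := expFun_zero x
      map_mul' := fun μ ν => expFun_add μ.toAdd ν.toAdd x }

@[simp] theorem evalExp_single (μ : V) (c : ℂ) (x : N) :
    evalExp P x (single μ c) = c * expFun P μ x := by
  rw [evalExp, AddMonoidAlgebra.lift_single]
  rfl

theorem evalExp_apply (f : ExpAlg V) (x : N) :
    evalExp P x f = ∑ μ ∈ f.coeff.support, f.coeff μ * expFun P μ x := by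
  rw [evalExp, AddMonoidAlgebra.lift_apply]
  rfl

theorem expFun_smul (w : P.weylGroup) (μ : V) (x : N) :
    expFun P (w • μ) x = expFun P μ (coact w x) := by
  rw [expFun, expFun, pairing_smul]

theorem conj_expFun (μ : V) (x : N) :
    (starRingEnd ℂ) (expFun P μ x) = expFun P (-μ) x := by
  rw [expFun, ← Complex.exp_conj, expFun]
  congr 1
  simp [Complex.conj_ofNat]

/-- The Weyl group action on formal exponential sums. -/
noncomputable def actExp (w : P.weylGroup) : ExpAlg V ≃ₐ[ℂ] ExpAlg V :=
  AddMonoidAlgebra.domCongr ℂ ℂ (DistribMulAction.toAddEquiv V w)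

theorem coeff_actExp (w : P.weylGroup) (f : ExpAlg V) (μ : V) :
    (actExp w f).coeff μ = f.coeff (w⁻¹ • μ) :=
  AddMonoidAlgebra.coeff_domCongr _ _ _

@[simp] theorem actExp_single (w : P.weylGroup) (μ : V) (c : ℂ) :
    actExp w (single μ c) = single (w • μ) c :=
  AddMonoidAlgebra.domCongr_single _ _ _

theorem evalExp_actExp (w : P.weylGroup) (f : ExpAlg V) (x : N) :
    evalExp P x (actExp w f) = evalExp P (coact w x) f := by
  have : (evalExp P x).comp (actExp w).toAlgHom = evalExp P (coact w x) :=
    AddMonoidAlgebra.algHom_ext (fun μ => by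
      change evalExp P x (actExp w (single μ 1)) = evalExp P (coact w x) (single μ 1)
      rw [actExp_single, evalExp_single, evalExp_single, expFun_smul]) (by ext)
  exact DFunLike.congr_fun this f

theorem actExp_mul (w w' : P.weylGroup) (f : ExpAlg V) :
    actExp (w * w') f = actExp w (actExp w' f) := by
  refine AddMonoidAlgebra.coeff_injective (Finsupp.ext fun μ => ?_)
  simp only [coeff_actExp, mul_inv_rev, mul_smul]

variable (P) in
/-- The derivative of formal exponential sums in the direction of a coweight (divided by
`2 π i`). -/
noncomputable def derivExp (x : N) (f : ExpAlg V) : ExpAlg V :=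
  AddMonoidAlgebra.ofCoeff (Finsupp.onFinset f.coeff.support
    (fun μ => ((P.toLinearMap μ x : ℝ) : ℂ) * f.coeff μ)
    fun μ h => Finsupp.mem_support_iff.2 fun h' => h (by rw [h', mul_zero]))

theorem coeff_derivExp (x : N) (f : ExpAlg V) (μ : V) :
    (derivExp P x f).coeff μ = ((P.toLinearMap μ x : ℝ) : ℂ) * f.coeff μ := rfl

/-- The chain rule for an invariant sum: acting on a directional derivative only transforms the
direction. -/
theorem actExp_derivExp (w : P.weylGroup) {f : ExpAlg V} (hf : actExp w f = f) (x : N) :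
    actExp w (derivExp P x f) = derivExp P (coact w⁻¹ x) f := by
  refine AddMonoidAlgebra.coeff_injective (Finsupp.ext fun μ => ?_)
  rw [coeff_actExp, coeff_derivExp, coeff_derivExp, ← coeff_actExp, hf, pairing_smul]

theorem derivExp_sub_smul (x y : N) (c : ℝ) (f : ExpAlg V) :
    derivExp P (x - c • y) f = derivExp P x f - (c : ℂ) • derivExp P y f := by
  refine AddMonoidAlgebra.coeff_injective (Finsupp.ext fun μ => ?_)
  rw [AddMonoidAlgebra.coeff_sub, Finsupp.sub_apply, AddMonoidAlgebra.coeff_smul_apply]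
  simp only [coeff_derivExp, map_sub, map_smul, smul_eq_mul, Complex.ofReal_sub,
    Complex.ofReal_mul]
  ring

theorem derivExp_mem_expSubalgebra {L : AddSubgroup V} {f : ExpAlg V} (hf : f ∈ expSubalgebra L)
    (x : N) : derivExp P x f ∈ expSubalgebra L := fun μ h => hf μ fun h' => h (by
  rw [coeff_derivExp, h', mul_zero])

theorem evalExp_derivExp (x y : N) (f : ExpAlg V) :
    evalExp P y (derivExp P x f) =
      ∑ μ ∈ f.coeff.support, ((P.toLinearMap μ x : ℝ) : ℂ) * f.coeff μ * expFun P μ y := by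
  rw [evalExp_apply]
  refine Finset.sum_subset (fun μ h => ?_) fun μ _ h => ?_
  · rw [Finsupp.mem_support_iff, coeff_derivExp] at h
    exact Finsupp.mem_support_iff.2 (right_ne_zero_of_mul h)
  · rw [Finsupp.notMem_support_iff.1 h, zero_mul]

end Eval


section FormalWeyl

open AddMonoidAlgebra (single)

variable {n : ℕ} {ι V N : Type*} [Finite ι] [AddCommGroup V] [Module ℝ V] [AddCommGroup N]
  [Module ℝ N] {P : RootPairing ι ℝ V N} [P.IsRootSystem]

noncomputable instance : Fintype P.weylGroup := Fintype.ofFinite _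

/-! ### Orbit sums and alternating sums -/

theorem finite_orbit (lam : V) : (MulAction.orbit P.weylGroup lam).Finite :=
  Set.finite_range _

variable (P) in
/-- The formal orbit sum. -/
noncomputable def orbitSum (lam : V) : ExpAlg V :=
  ∑ ν ∈ (finite_orbit (P := P) lam).toFinset, single ν 1

theorem evalExp_orbitSum (lam : V) (x : N) : evalExp P x (orbitSum P lam) = orbitC P lam x := by
  rw [orbitSum, map_sum, orbitC, finsum_mem_eq_finite_toFinset_sum _ (finite_orbit lam)]
  simp

open Classical in
theorem coeff_orbitSum (lam μ : V) :
    (orbitSum P lam).coeff μ = if μ ∈ MulAction.orbit P.weylGroup lam then 1 else 0 := by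
  rw [orbitSum, AddMonoidAlgebra.coeff_sum, Finsupp.finsetSum_apply]
  simp [AddMonoidAlgebra.coeff_single, Finsupp.single_apply]

theorem coeff_orbitSum_ne_zero {lam μ : V} (h : (orbitSum P lam).coeff μ ≠ 0) :
    ∃ w : P.weylGroup, w • lam = μ := by
  classical
  rw [coeff_orbitSum] at h
  by_contra h'
  exact h (if_neg h')

theorem actExp_orbitSum (w : P.weylGroup) (lam : V) :
    actExp w (orbitSum P lam) = orbitSum P lam := by
  classical
  refine AddMonoidAlgebra.coeff_injective (Finsupp.ext fun μ => ?_)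
  rw [coeff_actExp, coeff_orbitSum, coeff_orbitSum]
  simp only [← MulAction.orbit_eq_iff, MulAction.orbit_smul]

variable (P) in
/-- The sign character. -/
noncomputable def sgn (w : P.weylGroup) : ℝ := LinearMap.det (P.weylGroupRootRep w)

theorem sgn_one : sgn P 1 = 1 := by rw [sgn, map_one, map_one]

theorem sgn_mul (w w' : P.weylGroup) : sgn P (w * w') = sgn P w * sgn P w' := by
  rw [sgn, map_mul, map_mul]
  rfl

/-- A reflection is v ↦ v + f(v) α with f(α) = -2, and such a map has determinant 1 + f(α). -/
theorem sgn_refl (i : ι) : sgn P (refl P i) = -1 := by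
  have : Module.Finite ℝ V := ⟨(Set.finite_range P.root).toFinset, by
    rw [Set.Finite.coe_toFinset]; exact RootPairing.IsRootSystem.span_root_eq_top⟩
  have h : P.weylGroupRootRep (refl P i) =
      LinearMap.transvection (-(P.toLinearMap.flip (P.coroot i))) (P.root i) := by
    ext v
    change refl P i • v = v + (-(P.toLinearMap v (P.coroot i))) • P.root i
    rw [refl_smul, neg_smul, sub_eq_add_neg]
  rw [sgn, h, LinearMap.transvection.det]
  simp only [LinearMap.neg_apply, LinearMap.flip_apply]
  rw [RootPairing.root_coroot_two]
  norm_num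

variable (P) in
/-- The formal alternating sum. -/
noncomputable def alternatingSum (lam : V) : ExpAlg V :=
  ∑ w : P.weylGroup, single (w • lam) ((sgn P w : ℝ) : ℂ)

theorem evalExp_alternatingSum (lam : V) (x : N) :
    evalExp P x (alternatingSum P lam) = orbitS P lam x := by
  rw [alternatingSum, map_sum, orbitS, finsum_eq_sum_of_fintype]
  refine Finset.sum_congr ?_ fun w _ => evalExp_single _ _ _
  convert rfl

theorem actExp_alternatingSum (i : ι) (lam : V) :
    actExp (refl P i) (alternatingSum P lam) = -alternatingSum P lam := by
  rw [alternatingSum, map_sum, ← Finset.sum_neg_distrib]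
  refine Fintype.sum_equiv (Equiv.mulLeft (refl P i)) _
    (fun w => -single (w • lam) ((sgn P w : ℝ) : ℂ)) fun w => ?_
  rw [actExp_single, Equiv.coe_mulLeft, sgn_mul, sgn_refl, ← mul_smul, ← AddMonoidAlgebra.single_neg]
  congr 1
  push_cast
  ring

variable [P.IsCrystallographic] [P.IsReduced] (b : P.Base)

theorem orbitSum_mem {lam : V} (h : lam ∈ weightLattice P) :
    orbitSum P lam ∈ expSubalgebra (weightLattice P) := fun μ hμ => by
  obtain ⟨w, rfl⟩ := coeff_orbitSum_ne_zero hμ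
  exact smul_mem_weightLattice w h

theorem alternatingSum_mem {lam : V} (h : lam ∈ weightLattice P) :
    alternatingSum P lam ∈ expSubalgebra (weightLattice P) := by
  exact sum_mem fun w _ => single_mem_expSubalgebra (smul_mem_weightLattice w h) _

/-! ### Leading terms and anti-invariant sums -/

/-- The height form: the pairing with the sum of the positive coroots. -/
noncomputable def height : V →ₗ[ℝ] ℝ := P.toLinearMap.flip (posCosum b)

theorem height_apply (v : V) : height b v = P.toLinearMap v (posCosum b) := rfl

theorem height_root (j : b.support) : height b (P.root j) = 2 := root_posCosum b j

theorem hasLeading_orbitSum {lam : V} (h : IsDominant b lam) :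
    HasLeading (height b) (orbitSum P lam) lam 1 := by
  classical
  refine hasLeading_iff.2 ⟨?_, fun μ hμ => ?_⟩
  · rw [coeff_orbitSum, if_pos (MulAction.mem_orbit_self lam)]
  · obtain ⟨w, rfl⟩ := coeff_orbitSum_ne_zero hμ
    exact h.smul_eq_or_lt b (fun j => by rw [root_posCosum]; norm_num) w

theorem hasLeading_alternatingSum :
    HasLeading (height b) (alternatingSum P (rho b)) (rho b) 1 := by
  classical
  have h (w : P.weylGroup) : HasLeading (height b) (single (w • rho b) ((sgn P w : ℝ) : ℂ)) (rho b)
      (if w = 1 then 1 else 0) := by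
    rcases eq_or_ne w 1 with rfl | hw
    · rw [one_smul, sgn_one, if_pos rfl, HasLeading, Complex.ofReal_one, sub_self]
      exact zero_mem _
    · rw [if_neg hw, HasLeading, AddMonoidAlgebra.single_zero, sub_zero]
      intro μ hμ
      rw [← eq_of_coeff_single_ne_zero hμ]
      exact (eq_one_or_lt_of_regular b (fun j => by rw [rho_coroot]; norm_num)
        (fun j => by rw [root_posCosum]; norm_num) w).resolve_left hw
  have h2 := HasLeading.sum Finset.univ (fun w _ => h w)
  rw [Finset.sum_ite_eq' Finset.univ (1 : P.weylGroup), if_pos (Finset.mem_univ _)] at h2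
  exact h2

/-- An element of the support of greatest height. -/
theorem exists_max_height {f : ExpAlg V} (hf : f ≠ 0) :
    ∃ μ, f.coeff μ ≠ 0 ∧ ∀ ν, f.coeff ν ≠ 0 → height b ν ≤ height b μ := by
  have : f.coeff.support.Nonempty := by
    rw [Finsupp.support_nonempty_iff]
    exact fun h => hf (AddMonoidAlgebra.coeff_eq_zero.1 h)
  obtain ⟨μ, h1, h2⟩ := f.coeff.support.exists_max_image (height b) this
  exact ⟨μ, Finsupp.mem_support_iff.1 h1, fun ν hν => h2 ν (Finsupp.mem_support_iff.2 hν)⟩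

theorem isDominant_of_max_height {f : ExpAlg V}
    (hf : ∀ (j : b.support) (μ : V), f.coeff μ ≠ 0 → f.coeff (refl P j • μ) ≠ 0) {μ : V}
    (hμ : f.coeff μ ≠ 0) (hmax : ∀ ν, f.coeff ν ≠ 0 → height b ν ≤ height b μ) :
    IsDominant b μ := fun j => by
  have h := hmax _ (hf j μ hμ)
  rw [refl_smul, map_sub, map_smul, height_root, smul_eq_mul] at h
  linarith

/-- A highest exponent μ is dominant. It lies on no wall, since its coefficient there would equal
its own negative. Integrality makes μ - ρ dominant, and the height bound leaves μ = ρ, whose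
coefficient was assumed zero. -/
theorem eq_zero_of_antiinvariant {g : ExpAlg V} (hg : ∀ j : b.support, actExp (refl P j) g = -g)
    (hL : g ∈ expSubalgebra (weightLattice P)) (hh : g ∈ atMost (height b) (height b (rho b)))
    (h0 : g.coeff (rho b) = 0) : g = 0 := by
  by_contra hne
  have hc (j : b.support) (μ : V) : g.coeff (refl P j • μ) = - g.coeff μ := by
    have := congrArg (fun f : ExpAlg V => f.coeff μ) (hg j)
    simpa [coeff_actExp] using this
  obtain ⟨μ, hμ, hmax⟩ := exists_max_height b hne
  have hdom := isDominant_of_max_height b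
    (fun j ν hν => by rw [hc]; exact neg_ne_zero.2 hν) hμ hmax
  have hpos (j : b.support) : 1 ≤ P.toLinearMap μ (P.coroot j) := by
    obtain ⟨k, hk⟩ := hL μ hμ j
    have h1 := hdom j
    have h2 : k ≠ 0 := by
      rintro rfl
      have h3 := hc j μ
      rw [refl_smul, hk, Int.cast_zero, zero_smul, sub_zero, self_eq_neg] at h3
      exact hμ h3
    rw [hk] at h1 ⊢
    have h3 : 0 ≤ k := by exact_mod_cast h1
    exact_mod_cast (by omega : 1 ≤ k)
  have hdom' : IsDominant b (μ - rho b) := fun j => by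
    rw [map_sub, LinearMap.sub_apply, rho_coroot]
    linarith [hpos j]
  have h1 : P.toLinearMap (μ - rho b) (posCosum b) ≤ 0 := by
    rw [map_sub, LinearMap.sub_apply]
    linarith [hh μ hμ, height_apply b μ, height_apply b (rho b)]
  have h2 : μ = rho b := eq_of_coroot_eq b fun j => by
    have := hdom'.coroot_eq_zero b h1 j
    rw [map_sub, LinearMap.sub_apply] at this
    linarith
  exact hμ (h2 ▸ h0)

/-- S_ρ is the smallest anti-invariant. The Jacobian and the Weyl denominator are both recognised
through this characterisation. -/
theorem eq_smul_alternatingSum {f : ExpAlg V} (hf : ∀ j : b.support, actExp (refl P j) f = -f)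
    (hL : f ∈ expSubalgebra (weightLattice P)) (hh : f ∈ atMost (height b) (height b (rho b))) :
    f = f.coeff (rho b) • alternatingSum P (rho b) := by
  rw [← sub_eq_zero]
  refine eq_zero_of_antiinvariant b (fun j => ?_) ?_ ?_ ?_
  · rw [map_sub, hf, map_smul, actExp_alternatingSum]
    simp only [smul_neg]
    abel
  · exact sub_mem hL (Subalgebra.smul_mem _ (alternatingSum_mem (rho_mem_weightLattice b)) _)
  · exact sub_mem hh (Submodule.smul_mem _ _ (hasLeading_alternatingSum b).mem_atMost)
  · rw [AddMonoidAlgebra.coeff_sub, Finsupp.sub_apply, AddMonoidAlgebra.coeff_smul_apply,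
      (hasLeading_alternatingSum b).coeff_eq, smul_eq_mul, mul_one, sub_self]

/-! ### Invariants are polynomials in the fundamental orbit sums -/

/-- The orbit sums of the fundamental weights. -/
noncomputable def fundSum (j : b.support) : ExpAlg V := orbitSum P (fundamentalWeight b j)

theorem fundSum_mem (j : b.support) : fundSum b j ∈ expSubalgebra (weightLattice P) :=
  orbitSum_mem (fundamentalWeight_mem_weightLattice b j)

theorem hasLeading_fundSum (j : b.support) :
    HasLeading (height b) (fundSum b j) (fundamentalWeight b j) 1 :=
  hasLeading_orbitSum b (isDominant_fundamentalWeight b j)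

theorem exists_prod_leading {μ : V} (hL : μ ∈ weightLattice P) (hμ : IsDominant b μ) :
    ∃ k : b.support → ℕ, HasLeading (height b) (∏ j, fundSum b j ^ k j) μ 1 := by
  choose m hm using hL
  have h0 (j : b.support) : 0 ≤ m j := by
    have := hμ j
    rw [hm] at this
    exact_mod_cast this
  refine ⟨fun j => (m j).toNat, ?_⟩
  have h := HasLeading.prod Finset.univ fun j _ => (hasLeading_fundSum b j).pow (m j).toNat
  simp only [one_pow, Finset.prod_const_one] at h
  have h2 : ∑ j : b.support, (m j).toNat • fundamentalWeight b j = μ := by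
    rw [← sum_coroot_smul_fundamentalWeight b μ]
    refine Finset.sum_congr rfl fun j _ => ?_
    rw [hm, ← Nat.cast_smul_eq_nsmul ℝ, ← Int.cast_natCast, Int.toNat_of_nonneg (h0 j)]
  rwa [h2] at h

/-- Invariant formal exponential sums are polynomials in the fundamental orbit sums. -/
theorem mem_adjoin_fundSum {f : ExpAlg V} (hf : ∀ j : b.support, actExp (refl P j) f = f)
    (hL : f ∈ expSubalgebra (weightLattice P)) :
    f ∈ Algebra.adjoin ℂ (Set.range (fundSum b)) := by
  -- Weights have integral heights, so induction on a strict height bound peels off one layer at a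
  -- time. At bound zero nothing is left, because a highest exponent is dominant and has nonnegative
  -- height.
  obtain ⟨d, hd⟩ : ∃ d : ℕ, f ∈ below (height b) d := by
    by_cases h0 : f = 0
    · exact ⟨0, h0 ▸ zero_mem _⟩
    · obtain ⟨μ, -, hμ⟩ := exists_max_height b h0
      obtain ⟨d, hd⟩ := exists_nat_gt (height b μ)
      exact ⟨d, fun ν hν => (hμ ν hν).trans_lt hd⟩
  induction d generalizing f with
  | zero =>
    by_cases h0 : f = 0
    · exact h0 ▸ zero_mem _
    exfalso
    obtain ⟨μ, hμ, hmax⟩ := exists_max_height b h0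
    have hdom := isDominant_of_max_height b (fun j ν hν => by
      have := congrArg (fun f : ExpAlg V => f.coeff (refl P j • ν)) (hf j)
      simp only [coeff_actExp, inv_smul_smul] at this
      rwa [← this]) hμ hmax
    have := hd μ hμ
    rw [Nat.cast_zero] at this
    exact this.not_ge hdom.posCosum_nonneg
  | succ d ih =>
    classical
    have hle (μ : V) (hμ : f.coeff μ ≠ 0) : height b μ ≤ d := by
      obtain ⟨k, hk⟩ := exists_int_posCosum b (hL μ hμ)
      have h1 := hd μ hμ
      rw [height_apply, hk] at h1 ⊢
      have h2 : k < d + 1 := by exact_mod_cast h1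
      exact_mod_cast (by omega : k ≤ d)
    have hdom (μ : V) (hμ : f.coeff μ ≠ 0) (hh : height b μ = d) : IsDominant b μ :=
      isDominant_of_max_height b (fun j ν hν => by
        have := congrArg (fun f : ExpAlg V => f.coeff (refl P j • ν)) (hf j)
        simp only [coeff_actExp, inv_smul_smul] at this
        rwa [← this]) hμ (fun ν hν => hh ▸ hle ν hν)
    -- The top layer consists of dominant weights, each the leading exponent of a monomial in the
    -- fundamental sums. Subtracting these monomials with the right coefficients lowers the bound.
    set s := f.coeff.support.filter fun μ => height b μ = d with hs
    have hks (μ : V) : ∃ k : b.support → ℕ,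
        μ ∈ s → HasLeading (height b) (∏ j, fundSum b j ^ k j) μ 1 := by
      by_cases h : μ ∈ s
      · rw [hs, Finset.mem_filter, Finsupp.mem_support_iff] at h
        obtain ⟨k, hk⟩ := exists_prod_leading b (hL μ h.1) (hdom μ h.1 h.2)
        exact ⟨k, fun _ => hk⟩
      · exact ⟨0, fun h' => absurd h' h⟩
    choose k hk using hks
    set g := ∑ μ ∈ s, f.coeff μ • ∏ j, fundSum b j ^ k μ j with hg
    have hgA : g ∈ Algebra.adjoin ℂ (Set.range (fundSum b)) :=
      sum_mem fun μ _ => Subalgebra.smul_mem _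
        (prod_mem fun j _ => pow_mem
          (show fundSum b j ∈ Algebra.adjoin ℂ (Set.range (fundSum b)) from
            Algebra.subset_adjoin (Set.mem_range_self j)) _) _
    have hgL : g ∈ expSubalgebra (weightLattice P) :=
      sum_mem fun μ _ => Subalgebra.smul_mem _
        (prod_mem fun j _ => pow_mem (fundSum_mem b j) _) _
    have hginv (j : b.support) : actExp (refl P j) g = g := by
      simp only [hg, map_sum, map_smul, map_prod, map_pow, fundSum, actExp_orbitSum]
    have hlow : f - g ∈ below (height b) d := by
      have h1 : f - g = (f - ∑ μ ∈ s, single μ (f.coeff μ)) -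
          ∑ μ ∈ s, (f.coeff μ • ∏ j, fundSum b j ^ k μ j - single μ (f.coeff μ)) := by
        rw [Finset.sum_sub_distrib]
        abel
      rw [h1]
      refine sub_mem (fun μ hμ => ?_) (sum_mem fun μ hμ => ?_)
      · rw [AddMonoidAlgebra.coeff_sub, Finsupp.sub_apply, AddMonoidAlgebra.coeff_sum,
          Finsupp.finsetSum_apply] at hμ
        simp only [AddMonoidAlgebra.coeff_single, Finsupp.single_apply, Finset.sum_ite_eq'] at hμ
        split_ifs at hμ with h2
        · exact absurd (sub_self _) hμ
        · rw [sub_zero] at hμ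
          refine lt_of_le_of_ne (hle μ hμ) fun h3 => h2 ?_
          rw [hs, Finset.mem_filter, Finsupp.mem_support_iff]
          exact ⟨hμ, h3⟩
      · have h2 := (hk μ hμ).smul (f.coeff μ)
        rw [mul_one, HasLeading] at h2
        rwa [(Finset.mem_filter.1 hμ).2] at h2
    rw [← sub_add_cancel f g]
    exact add_mem (ih (fun j => by rw [map_sub, hf, hginv]) (sub_mem hL hgL) hlow) hgA

end FormalWeyl


section Jacobian

open AddMonoidAlgebra (single)

variable {n : ℕ} {ι V N : Type*} [Finite ι] [AddCommGroup V] [Module ℝ V] [AddCommGroup N]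
  [Module ℝ N] {P : RootPairing ι ℝ V N} [P.IsRootSystem]

/-! ### The Jacobian of the fundamental orbit sums -/

theorem HasLeading.derivExp {φ : V →ₗ[ℝ] ℝ} {f : ExpAlg V} {lam : V} {c : ℂ}
    (hf : HasLeading φ f lam c) (x : N) :
    HasLeading φ (derivExp P x f) lam ((P.toLinearMap lam x : ℝ) * c) := by
  rw [hasLeading_iff] at hf ⊢
  exact ⟨by rw [coeff_derivExp, hf.1], fun μ hμ => hf.2 μ (right_ne_zero_of_mul hμ)⟩

variable [P.IsCrystallographic] [P.IsReduced] (b : P.Base)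

/-- The matrix of logarithmic derivatives of the fundamental orbit sums. -/
noncomputable def jacobian : Matrix b.support b.support (ExpAlg V) :=
  Matrix.of fun k j => derivExp P (P.coroot k) (fundSum b j)

open Classical in
-- Differentiating exp(ω_j) along α_k^∨ multiplies it by δ_jk, so the leading coefficients form the
-- identity matrix and the determinant has leading term exp(ρ).
theorem hasLeading_jacobian (k j : b.support) :
    HasLeading (height b) (jacobian b k j) (fundamentalWeight b j)
      ((1 : Matrix b.support b.support ℂ) k j) := by
  have := (hasLeading_fundSum b j).derivExp (P := P) (P.coroot k)
  rw [fundamentalWeight_coroot b j k] at this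
  rw [jacobian, Matrix.of_apply]
  convert this using 1
  rw [Matrix.one_apply, mul_one]
  simp only [eq_comm (a := k)]
  split_ifs <;> simp

open Classical in
theorem hasLeading_det_jacobian :
    HasLeading (height b) (jacobian b).det (rho b) 1 := by
  rw [Matrix.det_apply', ← Matrix.det_one (n := b.support) (R := ℂ), Matrix.det_apply']
  refine HasLeading.sum _ fun σ _ => ?_
  have h := (HasLeading.prod Finset.univ fun i _ => hasLeading_jacobian b (σ i) i).smul
    (((Equiv.Perm.sign σ : ℤˣ) : ℤ) : ℂ)
  rwa [Int.cast_smul_eq_zsmul, zsmul_eq_mul] at h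

open Classical in
-- The determinant is anti-invariant with leading term exp(ρ), which characterises S_ρ.
theorem det_jacobian : (jacobian b).det = alternatingSum P (rho b) := by
  have h := eq_smul_alternatingSum b (f := (jacobian b).det) (fun j => ?_) ?_
    (hasLeading_det_jacobian b).mem_atMost
  · rwa [(hasLeading_det_jacobian b).coeff_eq, one_smul] at h
  · set c : b.support → ExpAlg V := fun k =>
      -algebraMap ℂ (ExpAlg V) ((P.toLinearMap (P.root j) (P.coroot k) : ℝ) : ℂ) with hc
    have hz (l : b.support) : actExp (refl P j) (fundSum b l) = fundSum b l := actExp_orbitSum _ _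
    -- The reflection subtracts from row k the multiple ⟨α_j, α_k^∨⟩ of row j, a rank-one
    -- modification with determinant 1 - ⟨α_j, α_j^∨⟩ = -1.
    have h1 : (jacobian b).map (actExp (refl P j)) =
        (1 + Matrix.replicateCol Unit c * Matrix.replicateRow Unit (Pi.single j (1 : ExpAlg V))) *
          jacobian b := by
      ext1 k l
      rw [Matrix.map_apply, jacobian, Matrix.of_apply, actExp_derivExp _ (hz l),
        refl_inv, coact_refl, derivExp_sub_smul, add_mul, one_mul, Matrix.add_apply,
        Matrix.mul_assoc, Matrix.mul_apply]
      simp only [Finset.univ_unique, Finset.sum_singleton, Matrix.replicateCol_apply,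
        Matrix.mul_apply, Matrix.replicateRow_apply, Pi.single_apply, ite_mul, one_mul, zero_mul,
        Finset.sum_ite_eq', Finset.mem_univ, if_true, Matrix.of_apply, hc, neg_mul]
      rw [Algebra.smul_def, sub_eq_add_neg]
    have h2 : actExp (refl P j) (jacobian b).det = ((jacobian b).map (actExp (refl P j))).det :=
      (actExp (refl P j)).toRingHom.map_det _
    rw [h2, h1, Matrix.det_mul, Matrix.det_one_add_replicateCol_mul_replicateRow,
      single_one_dotProduct, hc]
    simp only [RootPairing.root_coroot_two]
    rw [Complex.ofReal_ofNat, map_ofNat]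
    ring
  · rw [Matrix.det_apply]
    exact sum_mem fun σ _ => zsmul_mem (prod_mem fun i _ =>
      (derivExp_mem_expSubalgebra (fundSum_mem b i) _)) _

/-! ### The denominator formula -/

/-- The Weyl denominator. -/
noncomputable def denominator : ExpAlg V :=
  ∏ i ∈ posRoots b, (single ((1 / 2 : ℝ) • P.root i) 1 - single (-((1 / 2 : ℝ) • P.root i)) 1)

theorem sum_half_posRoots : ∑ i ∈ posRoots b, (1 / 2 : ℝ) • P.root i = rho b := by
  rw [← Finset.smul_sum]
  change (1 / 2 : ℝ) • posSum b = _
  rw [← two_smul_rho, smul_smul]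
  norm_num

theorem hasLeading_denominator : HasLeading (height b) (denominator b) (rho b) 1 := by
  have h := HasLeading.prod (φ := height b) (posRoots b) (c := fun _ => 1)
    (f := fun i => single ((1 / 2 : ℝ) • P.root i) 1 - single (-((1 / 2 : ℝ) • P.root i)) 1)
    (lam := fun i => (1 / 2 : ℝ) • P.root i) fun i hi => ?_
  · rwa [sum_half_posRoots, Finset.prod_const_one] at h
  · rw [HasLeading, sub_sub_cancel_left]
    refine neg_mem fun μ hμ => ?_
    rw [← eq_of_coeff_single_ne_zero hμ, map_neg, map_smul, smul_eq_mul]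
    have := pos_root_pos b (posCosum b) (fun j => by rw [root_posCosum]; norm_num)
      ((mem_posRoots b).1 hi)
    rw [← height_apply] at this
    linarith

/-- Weyl's denominator formula: the product over the positive roots is anti-invariant with leading
term exp(ρ). -/
theorem denominator_eq : denominator b = alternatingSum P (rho b) := by
  have h := eq_smul_alternatingSum b (f := denominator b) (fun j => ?_) ?_
    (hasLeading_denominator b).mem_atMost
  · rwa [(hasLeading_denominator b).coeff_eq, one_smul] at h
  · have h1 := prod_posRoots_reflectionPerm b (fun i =>
      (single ((1 / 2 : ℝ) • P.root i) 1 - single (-((1 / 2 : ℝ) • P.root i)) 1 : ExpAlg V)) j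
    have h2 : actExp (refl P j) (denominator b) = ∏ i ∈ posRoots b,
        (single ((1 / 2 : ℝ) • P.root (P.reflectionPerm j i)) 1 -
          single (-((1 / 2 : ℝ) • P.root (P.reflectionPerm j i))) 1 : ExpAlg V) := by
      rw [denominator, map_prod]
      refine Finset.prod_congr rfl fun i _ => ?_
      rw [map_sub, actExp_single, actExp_single, smul_neg, smul_smul_real, smul_root]
      rfl
    rw [← h2, root_reflectionPerm_self'] at h1
    set g : ExpAlg V := single ((1 / 2 : ℝ) • P.root j) 1 - single (-((1 / 2 : ℝ) • P.root j)) 1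
    have h3 : (single ((1 / 2 : ℝ) • -P.root j) 1 - single (-((1 / 2 : ℝ) • -P.root j)) 1 : ExpAlg V)
        = -g := by
      rw [smul_neg, neg_neg, neg_sub]
    rw [h3] at h1
    have hg : g ≠ 0 := by
      classical
      intro h0
      have h4 := congrArg (fun f : ExpAlg V => f.coeff ((1 / 2 : ℝ) • P.root j)) h0
      simp only [g, AddMonoidAlgebra.coeff_sub, Finsupp.sub_apply, AddMonoidAlgebra.coeff_single,
        Finsupp.single_apply, if_true, AddMonoidAlgebra.coeff_zero, Finsupp.coe_zero,
        Pi.zero_apply] at h4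
      rw [if_neg] at h4
      · simp at h4
      · intro h5
        have h6 := congrArg (height b) h5
        rw [map_neg, map_smul, height_root] at h6
        norm_num at h6
    -- The rational structure makes `V` torsion-free, so its group algebra is a domain and the
    -- factor belonging to α_j can be cancelled.
    let : Module ℚ V := Module.compHom V (algebraMap ℚ ℝ)
    have : NoZeroDivisors (ExpAlg V) := inferInstance
    refine mul_right_cancel₀ hg ?_
    rw [h1]
    change denominator b * -g = _
    ring
  -- The single factors have half-roots as exponents; pulling out exp(ρ) shows that the product has
  -- only weights.
  · have h1 : denominator b = single (rho b) 1 *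
        ∏ i ∈ posRoots b, (1 - single (-P.root i) 1 : ExpAlg V) := by
      have h2 : (single (rho b) 1 : ExpAlg V) =
          ∏ i ∈ posRoots b, single ((1 / 2 : ℝ) • P.root i) 1 := by
        rw [AddMonoidAlgebra.prod_single, sum_half_posRoots, Finset.prod_const_one]
      rw [h2, ← Finset.prod_mul_distrib, denominator]
      refine Finset.prod_congr rfl fun i _ => ?_
      rw [mul_sub, mul_one, AddMonoidAlgebra.single_mul_single, mul_one]
      congr 2
      module
    rw [h1]
    refine mul_mem (single_mem_expSubalgebra (rho_mem_weightLattice b) _)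
      (prod_mem fun i _ => sub_mem (one_mem _) (single_mem_expSubalgebra ?_ _))
    exact neg_mem (root_mem_weightLattice i)

theorem expFun_eq_one_iff (μ : V) (x : N) :
    expFun P μ x = 1 ↔ ∃ k : ℤ, P.toLinearMap μ x = k := by
  rw [expFun, Complex.exp_eq_one_iff]
  refine exists_congr fun k => ?_
  rw [mul_comm (k : ℂ), mul_right_inj' Complex.two_pi_I_ne_zero]
  norm_cast

/-- By the product formula S_ρ vanishes exactly on the affine reflection hyperplanes. -/
theorem orbitS_rho_ne_zero_iff (x : N) :
    orbitS P (rho b) x ≠ 0 ↔ ∀ i, ∀ k : ℤ, P.toLinearMap (P.root i) x ≠ k := by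
  have h1 : orbitS P (rho b) x = ∏ i ∈ posRoots b,
      expFun P (-((1 / 2 : ℝ) • P.root i)) x * (expFun P (P.root i) x - 1) := by
    rw [← evalExp_alternatingSum, ← denominator_eq, denominator, map_prod]
    refine Finset.prod_congr rfl fun i _ => ?_
    rw [map_sub, evalExp_single, evalExp_single, one_mul, one_mul, mul_sub, mul_one, ← expFun_add]
    congr 2
    module
  have h2 (i : ι) : (expFun P (-((1 / 2 : ℝ) • P.root i)) x * (expFun P (P.root i) x - 1) ≠ 0) ↔
      ∀ k : ℤ, P.toLinearMap (P.root i) x ≠ k := by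
    rw [mul_ne_zero_iff, sub_ne_zero, ne_eq (expFun P (P.root i) x), expFun_eq_one_iff]
    simp [expFun]
  rw [h1, Finset.prod_ne_zero_iff]
  constructor
  · intro h i k
    by_cases hi : b.IsPos i
    · exact (h2 i).1 (h i ((mem_posRoots b).2 hi)) k
    · rw [← isPos_reflectionPerm_self_iff] at hi
      have := (h2 _).1 (h _ ((mem_posRoots b).2 hi)) (-k)
      rw [root_reflectionPerm_self'] at this
      intro h3
      refine this ?_
      simp [h3]
  · exact fun h i _ => (h2 i).2 (h i)

end Jacobian


section Reality

open AddMonoidAlgebra (single)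

variable {n : ℕ} {ι V N : Type*} [Finite ι] [AddCommGroup V] [Module ℝ V] [AddCommGroup N]
  [Module ℝ N] {P : RootPairing ι ℝ V N} [P.IsRootSystem]

/-! ### Complex conjugation -/

/-- The automorphism negating all exponents. -/
noncomputable def negExp : ExpAlg V ≃ₐ[ℂ] ExpAlg V :=
  AddMonoidAlgebra.domCongr ℂ ℂ (AddEquiv.neg V)

theorem coeff_negExp (f : ExpAlg V) (μ : V) : (negExp f).coeff μ = f.coeff (-μ) :=
  AddMonoidAlgebra.coeff_domCongr _ _ _

@[simp] theorem negExp_single (μ : V) (c : ℂ) : negExp (single μ c) = single (-μ) c :=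
  AddMonoidAlgebra.domCongr_single _ _ _

theorem evalExp_negExp {f : ExpAlg V} (hf : ∀ μ, (starRingEnd ℂ) (f.coeff μ) = f.coeff μ) (x : N) :
    evalExp P x (negExp f) = (starRingEnd ℂ) (evalExp P x f) := by
  rw [evalExp_apply f, map_sum]
  conv_lhs => rw [← AddMonoidAlgebra.sum_coeff_single f, Finsupp.sum, map_sum, map_sum]
  refine Finset.sum_congr rfl fun μ _ => ?_
  rw [negExp_single, evalExp_single, map_mul, hf, conj_expFun]

theorem actExp_negExp (w : P.weylGroup) (f : ExpAlg V) :
    actExp w (negExp f) = negExp (actExp w f) := by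
  refine AddMonoidAlgebra.coeff_injective (Finsupp.ext fun μ => ?_)
  rw [coeff_actExp, coeff_negExp, coeff_negExp, coeff_actExp, smul_neg]

theorem negExp_mem {L : AddSubgroup V} {f : ExpAlg V} (hf : f ∈ expSubalgebra L) :
    negExp f ∈ expSubalgebra L := fun μ hμ => by
  rw [coeff_negExp] at hμ
  exact neg_mem_iff.1 (hf _ hμ)

theorem orbitSum_smul (w : P.weylGroup) (lam : V) : orbitSum P (w • lam) = orbitSum P lam := by
  classical
  refine AddMonoidAlgebra.coeff_injective (Finsupp.ext fun μ => ?_)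
  rw [coeff_orbitSum, coeff_orbitSum, MulAction.orbit_smul]

theorem negExp_orbitSum (lam : V) : negExp (orbitSum P lam) = orbitSum P (-lam) := by
  classical
  refine AddMonoidAlgebra.coeff_injective (Finsupp.ext fun μ => ?_)
  rw [coeff_negExp, coeff_orbitSum, coeff_orbitSum]
  have : -μ ∈ MulAction.orbit P.weylGroup lam ↔ μ ∈ MulAction.orbit P.weylGroup (-lam) := by
    simp only [MulAction.mem_orbit_iff, smul_neg, neg_eq_iff_eq_neg]
  simp only [this]

theorem conj_coeff_orbitSum (lam μ : V) :
    (starRingEnd ℂ) ((orbitSum P lam).coeff μ) = (orbitSum P lam).coeff μ := by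
  classical
  rw [coeff_orbitSum]
  split_ifs <;> simp

theorem conj_coeff_alternatingSum (lam μ : V) :
    (starRingEnd ℂ) ((alternatingSum P lam).coeff μ) = (alternatingSum P lam).coeff μ := by
  classical
  rw [alternatingSum, AddMonoidAlgebra.coeff_sum, Finsupp.finsetSum_apply, map_sum]
  refine Finset.sum_congr rfl fun w _ => ?_
  rw [AddMonoidAlgebra.coeff_single, Finsupp.single_apply]
  split_ifs <;> simp

variable [P.IsCrystallographic] [P.IsReduced] [P.IsIrreducible] (b : P.Base)
  (e : Fin n ≃ b.support) {T : SimpleType n}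

theorem exists_neg_fundamentalWeight (hT : b.cartanMatrix.submatrix e e = T.cartanMatrix)
    (j : Fin n) : ∃ w : P.weylGroup,
    -fundamentalWeight b (e j) = w • fundamentalWeight b (e (T.partner j)) := by
  classical
  obtain ⟨τ, hw, hA⟩ := exists_opposition b
  have hinj : Function.Injective τ := fun i j hij => by
    by_contra hne
    have h1 := hA i j
    have h2 := b.cartanMatrix_le_zero_of_ne i j hne
    rw [hij, b.cartanMatrix_apply_same] at h1
    omega
  have hτ : (fun i => e.symm (τ (e i))) = T.partner := by
    refine partner_unique T (fun i j hij => ?_) (fun i j => ?_) (fun j => ?_)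
    · exact e.injective (hinj (e.symm.injective hij))
    · rw [← hT]
      simp only [Matrix.submatrix_apply, Equiv.apply_symm_apply, hA]
    · obtain ⟨w, h⟩ := hw (e j)
      obtain ⟨c, hc⟩ := exists_cartan_combination b h
      refine ⟨fun l => c (e l), fun i => ?_⟩
      have := hc (e i)
      rw [← e.sum_comp] at this
      rw [← hT]
      simp only [Matrix.submatrix_apply]
      rw [← this]
      simp only [e.injective.eq_iff, Equiv.symm_apply_eq]
  rw [← hτ, Equiv.apply_symm_apply]
  exact hw (e j)

theorem conj_orbitZ (hT : b.cartanMatrix.submatrix e e = T.cartanMatrix)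
    (j : Fin n) (x : N) :
    (starRingEnd ℂ) (orbitZ b e j x) = orbitZ b e (T.partner j) x := by
  obtain ⟨w, hw⟩ := exists_neg_fundamentalWeight b e hT j
  rw [orbitZ, orbitZ, ← evalExp_orbitSum, ← evalExp_negExp (conj_coeff_orbitSum _),
    negExp_orbitSum, hw, orbitSum_smul, evalExp_orbitSum]

theorem complexX_conj (hT : b.cartanMatrix.submatrix e e = T.cartanMatrix)
    (x : N) (j : Fin n) :
    (starRingEnd ℂ) (complexX T b e x j) = complexX T b e x j := by
  rw [complexX]
  split_ifs with h1 h2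
  · rw [conj_orbitZ b e hT, h1]
  · rw [map_div₀, map_add, conj_orbitZ b e hT, conj_orbitZ b e hT, partner_partner, add_comm,
      Complex.conj_ofNat]
  · rw [map_div₀, map_sub, conj_orbitZ b e hT, conj_orbitZ b e hT, partner_partner, map_mul,
      Complex.conj_ofNat, Complex.conj_I, mul_neg, div_neg, ← neg_div, neg_sub]

theorem ofReal_transformX (hT : b.cartanMatrix.submatrix e e = T.cartanMatrix)
    (x : N) (j : Fin n) :
    ((transformX T b e x j : ℝ) : ℂ) = complexX T b e x j :=
  Complex.conj_eq_iff_re.1 (complexX_conj b e hT x j)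

/-- A dual mark is the largest pairing of ω_j with a coroot. It is unchanged by W and, coroots being
closed under negation, by passing to -ω_j. -/
theorem dualMark_partner_le (hT : b.cartanMatrix.submatrix e e = T.cartanMatrix)
    (j : Fin n) : dualMark b e (T.partner j) ≤ dualMark b e j := by
  obtain ⟨w, hw⟩ := exists_neg_fundamentalWeight b e hT j
  obtain ⟨i, hi⟩ := exists_coroot_eq_dualMark b e (T.partner j)
  rw [← hi, ← inv_smul_smul w (fundamentalWeight b (e (T.partner j))), ← hw, pairing_smul,
    coact_coroot, map_neg, LinearMap.neg_apply, ← map_neg, ← coroot_reflectionPerm_self']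
  exact pairing_coroot_le_dualMark b e j _

theorem dualMark_partner (hT : b.cartanMatrix.submatrix e e = T.cartanMatrix)
    (j : Fin n) : dualMark b e (T.partner j) = dualMark b e j := by
  refine le_antisymm (dualMark_partner_le b e hT j) ?_
  conv_lhs => rw [← partner_partner T j]
  exact dualMark_partner_le b e hT _

/-! ### The formal `X`-transform -/

variable (T)

/-- This is the link between the m-degree and exponents: in Z_j no exponent pairs with a coroot to
more than m_j^∨. -/
theorem fundSum_mem_atMost (j : Fin n) (i : ι) :
    fundSum b (e j) ∈ atMost (P.toLinearMap.flip (P.coroot i)) (dualMark b e j) := fun μ hμ => by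
  obtain ⟨w, rfl⟩ := coeff_orbitSum_ne_zero hμ
  rw [LinearMap.flip_apply, pairing_smul, coact_coroot]
  exact pairing_coroot_le_dualMark b e j _

/-- The functions `X_j` as formal exponential sums. -/
noncomputable def formalX (j : Fin n) : ExpAlg V :=
  if T.partner j = j then fundSum b (e j)
  else if j < T.partner j then (1 / 2 : ℂ) • (fundSum b (e j) + fundSum b (e (T.partner j)))
  else (1 / (2 * Complex.I) : ℂ) • (fundSum b (e (T.partner j)) - fundSum b (e j))

theorem evalExp_fundSum (j : Fin n) (x : N) : evalExp P x (fundSum b (e j)) = orbitZ b e j x :=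
  evalExp_orbitSum _ _

theorem evalExp_formalX (j : Fin n) (x : N) : evalExp P x (formalX b e T j) = complexX T b e x j := by
  rw [formalX, complexX]
  split_ifs <;> simp only [map_smul, map_add, map_sub, evalExp_fundSum, smul_eq_mul] <;> ring

theorem formalX_mem (j : Fin n) : formalX b e T j ∈ expSubalgebra (weightLattice P) := by
  rw [formalX]
  split_ifs
  · exact fundSum_mem b _
  · exact Subalgebra.smul_mem _ (add_mem (fundSum_mem b _) (fundSum_mem b _)) _
  · exact Subalgebra.smul_mem _ (sub_mem (fundSum_mem b _) (fundSum_mem b _)) _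

theorem fundSum_eq (j : Fin n) : fundSum b (e j) =
    if T.partner j = j then formalX b e T j
    else if j < T.partner j then formalX b e T j + Complex.I • formalX b e T (T.partner j)
    else formalX b e T (T.partner j) - Complex.I • formalX b e T j := by
  have h1 : T.partner (T.partner j) = j := partner_partner T j
  have hI : Complex.I * (1 / (2 * Complex.I)) = 1 / 2 := by
    field_simp
  split_ifs with h2 h3
  · rw [formalX, if_pos h2]
  · rw [formalX, formalX, h1, if_neg h2, if_pos h3, if_neg (Ne.symm h2), if_neg h3.not_gt, smul_smul,
      hI]
    module
  · have h4 : T.partner j < j := lt_of_le_of_ne (not_lt.1 h3) h2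
    rw [formalX, formalX, h1, if_neg h2, if_pos h4, if_neg (Ne.symm h2), if_neg h3, smul_smul, hI]
    module

theorem actExp_formalX (w : P.weylGroup) (j : Fin n) :
    actExp w (formalX b e T j) = formalX b e T j := by
  have h (j : b.support) : actExp w (fundSum b j) = fundSum b j := actExp_orbitSum _ _
  rw [formalX]
  split_ifs <;> simp only [map_smul, map_add, map_sub, h]

variable {T}
theorem formalX_mem_atMost (hT : b.cartanMatrix.submatrix e e = T.cartanMatrix)
    (j : Fin n) (i : ι) :
    formalX b e T j ∈ atMost (P.toLinearMap.flip (P.coroot i)) (dualMark b e j) := by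
  have h1 := fundSum_mem_atMost b e j i
  have h2 := fundSum_mem_atMost b e (T.partner j) i
  rw [dualMark_partner b e hT] at h2
  rw [formalX]
  split_ifs
  · exact h1
  · exact Submodule.smul_mem _ _ (add_mem h1 h2)
  · exact Submodule.smul_mem _ _ (sub_mem h2 h1)

theorem evalReal_transformX (hT : b.cartanMatrix.submatrix e e = T.cartanMatrix)
    (p : MvPolynomial (Fin n) ℂ) (x : N) :
    evalReal p (transformX T b e x) = evalExp P x (MvPolynomial.aeval (formalX b e T) p) := by
  have h1 : (fun j => ((transformX T b e x j : ℝ) : ℂ)) =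
      fun j => evalExp P x (formalX b e T j) :=
    funext fun j => by rw [ofReal_transformX b e hT, evalExp_formalX]
  rw [evalReal, h1, ← MvPolynomial.coe_aeval_eq_eval]
  have := MvPolynomial.comp_aeval (R := ℂ) (formalX b e T) (evalExp P x)
  exact (DFunLike.congr_fun this p).symm

theorem mem_range_aeval_formalX {f : ExpAlg V} (hf : ∀ j : b.support, actExp (refl P j) f = f)
    (hL : f ∈ expSubalgebra (weightLattice P)) :
    ∃ p : MvPolynomial (Fin n) ℂ, MvPolynomial.aeval (formalX b e T) p = f := by
  have h1 : Algebra.adjoin ℂ (Set.range (fundSum b)) ≤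
      (MvPolynomial.aeval (R := ℂ) (formalX b e T)).range := by
    rw [Algebra.adjoin_le_iff]
    rintro _ ⟨j, rfl⟩
    have hX (j : Fin n) : formalX b e T j ∈ (MvPolynomial.aeval (R := ℂ) (formalX b e T)).range :=
      ⟨MvPolynomial.X j, MvPolynomial.aeval_X _ _⟩
    obtain ⟨j, rfl⟩ := e.surjective j
    rw [fundSum_eq b e T]
    split_ifs
    · exact hX j
    · exact add_mem (hX _) (Subalgebra.smul_mem _ (hX _) _)
    · exact sub_mem (hX _) (Subalgebra.smul_mem _ (hX _) _)
  exact h1 (mem_adjoin_fundSum b hf hL)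

/-- The weight polynomial exists. -/
theorem exists_isWeightPolynomial (hT : b.cartanMatrix.submatrix e e = T.cartanMatrix) :
    ∃ K, IsWeightPolynomial T b e K := by
  have hL := alternatingSum_mem (rho_mem_weightLattice b)
  -- S_ρ times its conjugate is invariant because the two signs cancel.
  obtain ⟨K, hK⟩ := mem_range_aeval_formalX b e
    (f := alternatingSum P (rho b) * negExp (alternatingSum P (rho b)))
    (fun j => by rw [map_mul, actExp_negExp, actExp_alternatingSum, map_neg, neg_mul_neg])
    (mul_mem hL (negExp_mem hL))
  refine ⟨K, fun x => ?_⟩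
  rw [evalReal_transformX b e hT, hK, map_mul, evalExp_negExp (conj_coeff_alternatingSum _),
    evalExp_alternatingSum, Complex.mul_conj, Complex.normSq_eq_norm_sq]

end Reality


section Alcove

open AddMonoidAlgebra (single)

variable {n : ℕ} {ι V N : Type*} [Finite ι] [AddCommGroup V] [Module ℝ V] [AddCommGroup N]
  [Module ℝ N] {P : RootPairing ι ℝ V N} [P.IsRootSystem] [P.IsCrystallographic] [P.IsReduced]
  (b : P.Base)

/-! ### The coroot lattice -/

theorem exists_int_of_mem_corootLattice {v : V} (hv : v ∈ weightLattice P) {q : N}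
    (hq : q ∈ corootLattice b) : ∃ k : ℤ, P.toLinearMap v q = k := by
  induction hq using AddSubgroup.closure_induction with
  | mem x hx =>
    obtain ⟨i, -, rfl⟩ := hx
    exact hv i
  | zero => exact ⟨0, by simp⟩
  | add x y _ _ hx hy =>
    obtain ⟨k, hk⟩ := hx
    obtain ⟨l, hl⟩ := hy
    exact ⟨k + l, by rw [map_add, hk, hl]; push_cast; rfl⟩
  | neg x _ hx =>
    obtain ⟨k, hk⟩ := hx
    exact ⟨-k, by rw [map_neg, hk]; push_cast; rfl⟩

theorem mem_corootLattice_of_fundamentalWeight {q : N}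
    (h : ∀ j : b.support, ∃ k : ℤ, P.toLinearMap (fundamentalWeight b j) q = k) :
    q ∈ corootLattice b := by
  rw [← sum_fundamentalWeight_smul_coroot b q]
  refine sum_mem fun j _ => ?_
  obtain ⟨k, hk⟩ := h j
  rw [hk, Int.cast_smul_eq_zsmul]
  exact zsmul_mem (show P.coroot j ∈ corootLattice b from
    AddSubgroup.subset_closure ⟨j, j.2, rfl⟩) k

theorem coroot_mem_corootLattice (i : ι) : P.coroot i ∈ corootLattice b :=
  mem_corootLattice_of_fundamentalWeight b fun j => fundamentalWeight_mem_weightLattice b j i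

theorem coact_mem_corootLattice (w : P.weylGroup) {q : N} (hq : q ∈ corootLattice b) :
    coact w q ∈ corootLattice b :=
  mem_corootLattice_of_fundamentalWeight b fun j => by
    rw [← pairing_smul]
    exact exists_int_of_mem_corootLattice b
      (smul_mem_weightLattice w (fundamentalWeight_mem_weightLattice b j)) hq

theorem expFun_add_mem {μ : V} (hμ : μ ∈ weightLattice P) (x : N) {q : N}
    (hq : q ∈ corootLattice b) : expFun P μ (x + q) = expFun P μ x := by
  have h1 : expFun P μ (x + q) = expFun P μ x * expFun P μ q := by
    simp only [expFun, ← Complex.exp_add, map_add, Complex.ofReal_add, mul_add]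
  rw [h1, (expFun_eq_one_iff μ q).2 (exists_int_of_mem_corootLattice b hμ hq), mul_one]

theorem evalExp_add_mem {f : ExpAlg V} (hf : f ∈ expSubalgebra (weightLattice P)) (x : N) {q : N}
    (hq : q ∈ corootLattice b) : evalExp P (x + q) f = evalExp P x f := by
  rw [evalExp_apply, evalExp_apply]
  refine Finset.sum_congr rfl fun μ hμ => ?_
  rw [expFun_add_mem b (hf μ (Finsupp.mem_support_iff.1 hμ)) x hq]

/-! ### The invariant form -/

variable (P) in
/-- The canonical Weyl group invariant form on the coweight space. -/
noncomputable def form (x y : N) : ℝ :=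
  ∑ᶠ i, P.toLinearMap (P.root i) x * P.toLinearMap (P.root i) y

theorem form_eq_sum [Fintype ι] (x y : N) :
    form P x y = ∑ i, P.toLinearMap (P.root i) x * P.toLinearMap (P.root i) y :=
  finsum_eq_sum_of_fintype _

theorem form_coact (w : P.weylGroup) (x y : N) : form P (coact w x) (coact w y) = form P x y := by
  have := Fintype.ofFinite ι
  simp only [form_eq_sum, root_smul_coact]
  exact Equiv.sum_comp (MulAction.toPerm w)
    fun i => P.toLinearMap (P.root i) x * P.toLinearMap (P.root i) y

theorem form_sub_smul (x y z : N) (c : ℝ) : form P x (y - c • z) = form P x y - c * form P x z := by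
  have := Fintype.ofFinite ι
  simp only [form_eq_sum, Finset.mul_sum, ← Finset.sum_sub_distrib, map_sub, map_smul, smul_eq_mul]
  exact Finset.sum_congr rfl fun i _ => by ring

theorem form_comm (x y : N) : form P x y = form P y x := by
  simp only [form, mul_comm]

theorem form_self_nonneg (x : N) : 0 ≤ form P x x := by
  have := Fintype.ofFinite ι
  rw [form_eq_sum]
  exact Finset.sum_nonneg fun i _ => mul_self_nonneg _

theorem sq_root_le_form (x : N) (i : ι) : P.toLinearMap (P.root i) x ^ 2 ≤ form P x x := by
  have := Fintype.ofFinite ι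
  rw [form_eq_sum, sq]
  exact Finset.single_le_sum (f := fun i => P.toLinearMap (P.root i) x * P.toLinearMap (P.root i) x)
    (fun i _ => mul_self_nonneg _) (Finset.mem_univ i)

theorem form_coroot_self_pos (i : ι) : 0 < form P (P.coroot i) (P.coroot i) := by
  have := sq_root_le_form (P := P) (P.coroot i) i
  rw [RootPairing.root_coroot_two] at this
  linarith

/-- Invariance under the reflection in `i`, which negates the coroot, forces the form against that
coroot to be proportional to the root. -/
theorem form_coroot (i : ι) (x : N) : form P x (P.coroot i) =
    P.toLinearMap (P.root i) x * (form P (P.coroot i) (P.coroot i) / 2) := by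
  have h := form_coact (P := P) (refl P i) (P.coroot i) x
  rw [coact_refl, coact_refl, RootPairing.root_coroot_two, form_sub_smul] at h
  have h1 : P.coroot i - (2 : ℝ) • P.coroot i = (0 : N) - (1 : ℝ) • P.coroot i := by module
  have h0 (y : N) : form P y 0 = 0 := by
    simp [form]
  rw [h1, form_comm _ x, form_comm _ (P.coroot i), form_sub_smul, form_sub_smul, h0, h0] at h
  rw [form_comm (P.coroot i) x] at h
  linarith

/-! ### Affine Weyl group equivalence -/

/-- Equivalence under the affine Weyl group. -/
def AffWeylEquiv (x y : N) : Prop := ∃ w : P.weylGroup, y - coact w x ∈ corootLattice b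

theorem affWeylEquiv_refl (x : N) : AffWeylEquiv b x x :=
  ⟨1, by rw [coact_one, sub_self]; exact zero_mem _⟩

theorem AffWeylEquiv.coact {x y : N} (h : AffWeylEquiv b x y) (w : P.weylGroup) {q : N}
    (hq : q ∈ corootLattice b) : AffWeylEquiv b x (OrbitCubature.coact w y + q) := by
  obtain ⟨u, hu⟩ := h
  refine ⟨u * w, ?_⟩
  rw [coact_mul]
  have : OrbitCubature.coact w y + q - OrbitCubature.coact w (OrbitCubature.coact u x) =
      OrbitCubature.coact w (y - OrbitCubature.coact u x) + q := by
    rw [map_sub]; abel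
  rw [this]
  exact add_mem (coact_mem_corootLattice b w hu) hq

/-- The affine reflections preserve equivalence classes. -/
theorem AffWeylEquiv.reflect {x y : N} (h : AffWeylEquiv b x y) (i : ι) (k : ℤ) :
    AffWeylEquiv b x (y - (P.toLinearMap (P.root i) y - k) • P.coroot i) := by
  have h1 := h.coact b (refl P i) (zsmul_mem (coroot_mem_corootLattice b i) k)
  rw [coact_refl, ← Int.cast_smul_eq_zsmul ℝ] at h1
  convert h1 using 1
  module

/-- Each simple root takes on the class of `x` values in finitely many cosets of ℤ, and the bound on
the distance to `z` confines them to an interval. -/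
theorem finite_affWeylEquiv (x z : N) (C : ℝ) :
    {y | AffWeylEquiv b x y ∧ form P (y - z) (y - z) ≤ C}.Finite := by
  classical
  have hinj : Function.Injective fun (y : N) (j : b.support) => P.toLinearMap (P.root j) y :=
    fun y y' h => eq_of_root_eq b fun j => congrFun h j
  refine Set.Finite.of_finite_image ?_ (hinj.injOn)
  set S : b.support → Set ℝ := fun j => ⋃ w : P.weylGroup,
    (fun k : ℤ => P.toLinearMap (P.root j) (coact w x) + k) '' 
      {k : ℤ | |P.toLinearMap (P.root j) (coact w x) + k - P.toLinearMap (P.root j) z| ≤ √C} with hS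
  have hfin (j : b.support) : (S j).Finite := by
    refine Set.finite_iUnion fun w => Set.Finite.image _ ?_
    set c := P.toLinearMap (P.root j) (coact w x) - P.toLinearMap (P.root j) z
    refine (Set.finite_Icc ⌊-√C - c⌋ ⌈√C - c⌉).subset fun k hk => ?_
    rw [Set.mem_ofPred_eq, add_sub_right_comm, abs_le] at hk
    constructor
    · have h1 : -√C - c ≤ k := by linarith [hk.1]
      exact_mod_cast (Int.floor_le _).trans h1
    · have h1 : (k : ℝ) ≤ √C - c := by linarith [hk.2]
      exact_mod_cast h1.trans (Int.le_ceil _)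
  refine (Set.Finite.pi' hfin).subset ?_
  rintro _ ⟨y, ⟨⟨w, hw⟩, hC⟩, rfl⟩ j
  obtain ⟨k, hk⟩ := exists_int_of_mem_corootLattice b (root_mem_weightLattice (P := P) j) hw
  rw [map_sub] at hk
  refine Set.mem_iUnion.2 ⟨w, k, ?_, ?_⟩
  · rw [Set.mem_ofPred_eq]
    have h1 := (sq_root_le_form (P := P) (y - z) j).trans hC
    rw [map_sub] at h1
    rw [← hk, add_sub_cancel]
    exact Real.abs_le_sqrt h1
  · change _ + (k : ℝ) = _
    rw [← hk]
    ring

theorem exists_min_affWeylEquiv (x z : N) : ∃ y, AffWeylEquiv b x y ∧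
    ∀ y', AffWeylEquiv b x y' → form P (y - z) (y - z) ≤ form P (y' - z) (y' - z) := by
  obtain ⟨y, hy, hmin⟩ := Set.exists_min_image _ (fun y => form P (y - z) (y - z))
    (finite_affWeylEquiv b x z (form P (x - z) (x - z))) ⟨x, affWeylEquiv_refl b x, le_rfl⟩
  refine ⟨y, hy.1, fun y' hy' => ?_⟩
  by_cases h : form P (y' - z) (y' - z) ≤ form P (x - z) (x - z)
  · exact hmin y' ⟨hy', h⟩
  · exact hy.2.trans (not_le.1 h).le

/-- The change in squared distance to `z` is a positive multiple of the product of the signed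
distances of `y` and `z` to the hyperplane, so reflecting brings `y` closer exactly when the
hyperplane separates the two points. -/
theorem form_reflect (y z : N) (i : ι) (k : ℝ) :
    form P (y - (P.toLinearMap (P.root i) y - k) • P.coroot i - z)
      (y - (P.toLinearMap (P.root i) y - k) • P.coroot i - z) =
    form P (y - z) (y - z) + (P.toLinearMap (P.root i) y - k) *
      (P.toLinearMap (P.root i) z - k) * form P (P.coroot i) (P.coroot i) := by
  rw [sub_right_comm, form_sub_smul, form_comm _ (y - z), form_comm _ (P.coroot i), form_sub_smul,
    form_sub_smul, form_comm (P.coroot i) (y - z), form_coroot i (y - z), map_sub]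
  ring

/-! ### The fundamental alcove -/

/-- The closed fundamental alcove. -/
def alcove : Set N :=
  {x | (∀ j : b.support, 0 ≤ P.toLinearMap (P.root j) x) ∧ P.toLinearMap (highestRoot b) x ≤ 1}

/-- The open fundamental alcove. -/
def openAlcove : Set N :=
  {x | (∀ j : b.support, 0 < P.toLinearMap (P.root j) x) ∧ P.toLinearMap (highestRoot b) x < 1}

theorem openAlcove_subset_alcove : openAlcove b ⊆ alcove b := fun _ hx =>
  ⟨fun j => (hx.1 j).le, hx.2.le⟩

variable [P.IsIrreducible]

/-- The barycentric coordinates are y_j = ⟨α_j, x⟩, with y₀ the slack in the inequality for the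
highest root. -/
theorem simplexF_eq_alcove (e : Fin n ≃ b.support) : simplexF b e = alcove b := by
  classical
  ext x
  constructor
  · rintro ⟨y₀, y, h0, hy, hs, rfl⟩
    have h1 (j : Fin n) : P.toLinearMap (P.root (e j))
        (∑ j, y j • fundamentalCoweight b (e j)) = y j := by
      simp [root_fundamentalCoweight]
    refine ⟨fun j => ?_, ?_⟩
    · obtain ⟨j, rfl⟩ := e.surjective j
      rw [h1]
      exact hy j
    · rw [highestRoot_pairing b e]
      simp only [h1, mul_comm (mark b e _)]
      linarith
  · rintro ⟨h1, h2⟩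
    refine ⟨1 - P.toLinearMap (highestRoot b) x, fun j => P.toLinearMap (P.root (e j)) x,
      by linarith, fun j => h1 _, ?_, ?_⟩
    · rw [highestRoot_pairing b e]
      simp only [mul_comm (mark b e _)]
      ring
    · rw [e.sum_comp fun j => P.toLinearMap (P.root j) x • fundamentalCoweight b j,
        sum_root_smul_fundamentalCoweight]

theorem root_mem_Ioo {x : N} (hx : x ∈ openAlcove b) {i : ι} (hi : b.IsPos i) :
    P.toLinearMap (P.root i) x ∈ Set.Ioo 0 1 :=
  ⟨pos_root_pos b x hx.1 hi, (root_le_highestRoot b i fun j => (hx.1 j).le).trans_lt hx.2⟩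

theorem root_ne_int {x : N} (hx : x ∈ openAlcove b) (i : ι) (k : ℤ) :
    P.toLinearMap (P.root i) x ≠ k := by
  have key (i : ι) (hi : b.IsPos i) (k : ℤ) : P.toLinearMap (P.root i) x ≠ k := fun h => by
    have h1 := root_mem_Ioo b hx hi
    rw [h] at h1
    have h2 : 0 < k := by exact_mod_cast h1.1
    have h3 : k < 1 := by exact_mod_cast h1.2
    omega
  by_cases hi : b.IsPos i
  · exact key i hi k
  · have h1 := key _ ((isPos_reflectionPerm_self_iff b i).2 hi) (-k)
    rw [root_reflectionPerm_self'] at h1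
    intro h2
    refine h1 ?_
    simp [h2]

theorem mem_openAlcove_of_root_ne {x : N} (hx : x ∈ alcove b)
    (h : ∀ i, ∀ k : ℤ, P.toLinearMap (P.root i) x ≠ k) : x ∈ openAlcove b := by
  obtain ⟨i, hi, -⟩ := exists_highestRoot_eq b
  refine ⟨fun j => lt_of_le_of_ne (hx.1 j) ?_, lt_of_le_of_ne hx.2 ?_⟩
  · have := h j 0
    rw [Int.cast_zero] at this
    exact this.symm
  · rw [hi]
    have := h i 1
    rwa [Int.cast_one] at this

theorem nonempty_openAlcove : (openAlcove b).Nonempty := by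
  classical
  set S := P.toLinearMap (highestRoot b) (∑ j, fundamentalCoweight b j) with hS
  have h1 (j : b.support) : P.toLinearMap (P.root j) (∑ j, fundamentalCoweight b j) = 1 := by
    simp [root_fundamentalCoweight]
  have h2 : 0 ≤ S := by
    obtain ⟨i⟩ := nonempty_index P
    by_cases hi : b.IsPos i
    · have := root_le_highestRoot b i (x := ∑ j, fundamentalCoweight b j)
        (fun j => by rw [h1]; exact zero_le_one)
      exact (pos_root_nonneg b _ (fun j => by rw [h1]; exact zero_le_one) hi).trans this
    · have hi' := (isPos_reflectionPerm_self_iff b i).2 hi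
      have := root_le_highestRoot b (P.reflectionPerm i i) (x := ∑ j, fundamentalCoweight b j)
        (fun j => by rw [h1]; exact zero_le_one)
      exact (pos_root_nonneg b _ (fun j => by rw [h1]; exact zero_le_one) hi').trans this
  -- With this scaling the highest root takes the value S / (1 + S) < 1.
  refine ⟨(1 / (1 + S)) • ∑ j, fundamentalCoweight b j, fun j => ?_, ?_⟩
  · rw [map_smul, h1, smul_eq_mul, mul_one]
    positivity
  · rw [map_smul, ← hS, smul_eq_mul, one_div, inv_mul_lt_iff₀ (by positivity)]
    linarith

/-- Every point is equivalent to a point of the fundamental alcove. -/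
theorem exists_affWeylEquiv_mem_alcove (x : N) : ∃ y ∈ alcove b, AffWeylEquiv b x y := by
  obtain ⟨z, hz⟩ := nonempty_openAlcove b
  obtain ⟨y, hy, hmin⟩ := exists_min_affWeylEquiv b x z
  -- As `y` is the point of its class closest to `z`, no reflection hyperplane separates it from the
  -- interior point `z`.
  have key (i : ι) (k : ℤ) : 0 ≤ (P.toLinearMap (P.root i) y - k) *
      (P.toLinearMap (P.root i) z - k) := by
    have h1 := hmin _ (hy.reflect b i k)
    rw [form_reflect] at h1
    refine nonneg_of_mul_nonneg_left (b := form P (P.coroot i) (P.coroot i)) ?_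
      (form_coroot_self_pos i)
    linarith
  refine ⟨y, ⟨fun j => ?_, ?_⟩, hy⟩
  · have h1 := key j 0
    rw [Int.cast_zero, sub_zero, sub_zero] at h1
    exact nonneg_of_mul_nonneg_left h1 (hz.1 j)
  · obtain ⟨i, hi, -⟩ := exists_highestRoot_eq b
    have h1 := key i 1
    have h2 := hz.2
    rw [hi] at h2 ⊢
    rw [Int.cast_one] at h1
    by_contra! h3
    nlinarith [mul_pos (sub_pos.2 h3) (sub_pos.2 h2)]

end Alcove


section Uniqueness

open AddMonoidAlgebra (single)

variable {n : ℕ} {ι V N : Type*} [Finite ι] [AddCommGroup V] [Module ℝ V] [AddCommGroup N]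
  [Module ℝ N] {P : RootPairing ι ℝ V N} [P.IsRootSystem] [P.IsCrystallographic] [P.IsReduced]
  (b : P.Base)

/-! ### Uniqueness of the representative in the alcove -/

theorem derivExp_sum_smul {κ : Type*} (s : Finset κ) (c : κ → ℝ) (x : κ → N) (f : ExpAlg V) :
    derivExp P (∑ k ∈ s, c k • x k) f = ∑ k ∈ s, (c k : ℂ) • derivExp P (x k) f := by
  refine AddMonoidAlgebra.coeff_injective (Finsupp.ext fun μ => ?_)
  rw [AddMonoidAlgebra.coeff_sum, Finsupp.finsetSum_apply]
  simp only [AddMonoidAlgebra.coeff_smul_apply, coeff_derivExp, map_sum, map_smul, smul_eq_mul,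
    Complex.ofReal_sum, Complex.ofReal_mul, Finset.sum_mul, mul_assoc]

open Classical in
/-- At a regular point, a direction in which all derivatives of the fundamental orbit functions
vanish is zero. -/
theorem eq_zero_of_evalExp_derivExp {x : N} (hx : orbitS P (rho b) x ≠ 0) {v : N}
    (hv : ∀ j, evalExp P x (derivExp P v (fundSum b j)) = 0) : v = 0 := by
  set c : b.support → ℂ := fun k => ((P.toLinearMap (fundamentalWeight b k) v : ℝ) : ℂ) with hc
  set M : Matrix b.support b.support ℂ := (jacobian b).map (evalExp P x) with hM
  have hdet : M.det ≠ 0 := by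
    have h1 : evalExp P x (jacobian b).det = M.det := (evalExp P x).toRingHom.map_det _
    rw [← h1, det_jacobian, evalExp_alternatingSum]
    exact hx
  have h0 : Matrix.vecMul c M = 0 := by
    ext j
    have h1 := hv j
    rw [← sum_fundamentalWeight_smul_coroot b v, derivExp_sum_smul, map_sum] at h1
    simp only [map_smul, smul_eq_mul] at h1
    exact h1
  have h2 := Matrix.eq_zero_of_vecMul_eq_zero hdet h0
  rw [← sum_fundamentalWeight_smul_coroot b v]
  refine Finset.sum_eq_zero fun k _ => ?_
  have h3 : P.toLinearMap (fundamentalWeight b k) v = 0 := by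
    have := congrFun h2 k
    simp only [hc, Pi.zero_apply] at this
    exact_mod_cast this
  rw [h3, zero_smul]

theorem orbitS_ne_zero_of_mem_openAlcove [P.IsIrreducible] {x : N} (hx : x ∈ openAlcove b) :
    orbitS P (rho b) x ≠ 0 :=
  (orbitS_rho_ne_zero_iff b x).2 (root_ne_int b hx)

/-- A fixed point in the open alcove has trivial linear part. -/
theorem eq_one_of_fixed [P.IsIrreducible] {x q : N} (hx : x ∈ openAlcove b) {w : P.weylGroup}
    (hq : q ∈ corootLattice b) (hfix : coact w x + q = x) : w = 1 := by
  refine inv_eq_one.1 (weyl_ext' fun v => ?_)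
  -- Invariance of the orbit sums makes their derivatives at the fixed point agree along v and its
  -- transform. The Jacobian is invertible there, so the two directions coincide.
  have h1 : v - (1 : ℝ) • coact w⁻¹ v = 0 := by
    refine eq_zero_of_evalExp_derivExp b (orbitS_ne_zero_of_mem_openAlcove b hx) fun j => ?_
    have hinv : actExp w (fundSum b j) = fundSum b j := actExp_orbitSum _ _
    have hmem := derivExp_mem_expSubalgebra (P := P) (fundSum_mem b j) v
    have h2 : evalExp P x (derivExp P v (fundSum b j)) =
        evalExp P x (derivExp P (coact w⁻¹ v) (fundSum b j)) := by
      conv_lhs => rw [← hfix]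
      rw [evalExp_add_mem b hmem _ hq, ← evalExp_actExp, actExp_derivExp w hinv]
    rw [derivExp_sub_smul, map_sub, h2, Complex.ofReal_one, one_smul, sub_self]
  rw [one_smul, sub_eq_zero] at h1
  rw [coact_one]
  exact h1.symm

variable [P.IsIrreducible]

theorem convex_openAlcove : Convex ℝ (openAlcove b) := by
  refine Convex.inter (s := {x | ∀ j : b.support, 0 < P.toLinearMap (P.root j) x})
    (t := {x | P.toLinearMap (highestRoot b) x < 1}) ?_ ?_
  · have : {x | ∀ j : b.support, 0 < P.toLinearMap (P.root j) x} =
        ⋂ j : b.support, {x | 0 < P.toLinearMap (P.root j) x} := by ext; simp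
    rw [this]
    exact convex_iInter fun j => convex_halfSpace_gt (P.toLinearMap (P.root j)).isLinear 0
  · exact convex_halfSpace_lt (P.toLinearMap (highestRoot b)).isLinear 1

/-- An affine Weyl group element mapping one point of the open alcove into it preserves it. -/
theorem mapsTo_openAlcove {x q : N} {w : P.weylGroup} (hq : q ∈ corootLattice b)
    (hx : x ∈ openAlcove b) (hgx : coact w x + q ∈ openAlcove b) {y : N} (hy : y ∈ openAlcove b) :
    coact w y + q ∈ openAlcove b := by
  -- The position of `x` and its image pins the integer `k` = ⟨α_i, q⟩: it is 0 if w keeps the root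
  -- positive and 1 otherwise. The same `k` then works for `y`.
  have key (i : ι) (hi : b.IsPos i) : P.toLinearMap (P.root i) (coact w y + q) ∈ Set.Ioo 0 1 := by
    obtain ⟨k, hk⟩ := exists_int_of_mem_corootLattice b (root_mem_weightLattice (P := P) i) hq
    have h1 := root_mem_Ioo b hgx hi
    rw [map_add, root_smul_coact, hk] at h1 ⊢
    by_cases hwi : b.IsPos (w • i)
    · have h2 := root_mem_Ioo b hx hwi
      have h3 := root_mem_Ioo b hy hwi
      have h4 : (-1 : ℝ) < k := by linarith [h1.1, h2.2]
      have h5 : (k : ℝ) < 1 := by linarith [h1.2, h2.1]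
      have h6 : -1 < k := by exact_mod_cast h4
      have h7 : k < 1 := by exact_mod_cast h5
      obtain rfl : k = 0 := by omega
      simpa using h3
    · rw [← isPos_reflectionPerm_self_iff] at hwi
      have h2 := root_mem_Ioo b hx hwi
      have h3 := root_mem_Ioo b hy hwi
      rw [root_reflectionPerm_self', map_neg, LinearMap.neg_apply] at h2 h3
      have h4 : (0 : ℝ) < k := by linarith [h1.1, h2.1]
      have h5 : (k : ℝ) < 2 := by linarith [h1.2, h2.2]
      have h6 : 0 < k := by exact_mod_cast h4
      have h7 : k < 2 := by exact_mod_cast h5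
      obtain rfl : k = 1 := by omega
      rw [Int.cast_one]
      constructor <;> linarith [h3.1, h3.2]
  refine ⟨fun j => (key j (b.isPos_of_mem_support j.2)).1, ?_⟩
  obtain ⟨i, hi, -⟩ := exists_highestRoot_eq b
  rw [hi]
  by_cases hp : b.IsPos i
  · exact (key i hp).2
  · have h1 := key _ ((isPos_reflectionPerm_self_iff b i).2 hp)
    rw [root_reflectionPerm_self', map_neg, LinearMap.neg_apply] at h1
    linarith [h1.1]

/-- The affine map g preserves the open alcove. A power of it is a translation, trivial because the
alcove is bounded, so g has finite order; averaging an orbit gives a fixed point in the convex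
alcove, and `eq_one_of_fixed` applies. -/
theorem eq_one_of_mapsTo_openAlcove {x q : N} {w : P.weylGroup} (hq : q ∈ corootLattice b)
    (hx : x ∈ openAlcove b) (hgx : coact w x + q ∈ alcove b) : w = 1 ∧ q = 0 := by
  have hgx' : coact w x + q ∈ openAlcove b := by
    refine mem_openAlcove_of_root_ne b hgx fun i k h => ?_
    obtain ⟨l, hl⟩ := exists_int_of_mem_corootLattice b (root_mem_weightLattice (P := P) i) hq
    rw [map_add, root_smul_coact, hl] at h
    refine root_ne_int b hx (w • i) (k - l) ?_
    push_cast
    linarith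
  set g : N → N := fun y => coact w y + q with hg
  have hmaps : Set.MapsTo g (openAlcove b) (openAlcove b) :=
    fun y hy => mapsTo_openAlcove b hq hx hgx' hy
  have hit (k : ℕ) : g^[k] x ∈ openAlcove b := hmaps.iterate k hx
  have hlin (k : ℕ) (y y' : N) : g^[k] y - g^[k] y' = coact (w ^ k) (y - y') := by
    induction k with
    | zero => simp
    | succ k ih =>
      rw [Function.iterate_succ_apply', Function.iterate_succ_apply', pow_succ, coact_mul, ← ih]
      simp [hg]
  set m := orderOf w with hm
  have hmpos : 0 < m := orderOf_pos w
  set t := g^[m] x - x with ht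
  have htrans (y : N) : g^[m] y = y + t := by
    have h1 := hlin m y x
    rw [pow_orderOf_eq_one, coact_one] at h1
    rw [ht, ← sub_eq_zero]
    have h2 : g^[m] y - (y + (g^[m] x - x)) = (g^[m] y - g^[m] x) - (y - x) := by abel
    rw [h2, h1, sub_self]
  have htk (k : ℕ) : (g^[m])^[k] x = x + (k : ℝ) • t := by
    induction k with
    | zero => simp
    | succ k ih =>
      rw [Function.iterate_succ_apply', ih, htrans]
      push_cast
      module
  have ht0 : t = 0 := by
    refine eq_of_root_eq b fun j => ?_
    rw [map_zero]
    by_contra hne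
    obtain ⟨k, hk⟩ := exists_nat_gt (1 / |P.toLinearMap (P.root j) t|)
    have h1 : (g^[m])^[k] x ∈ openAlcove b := (hmaps.iterate m).iterate k hx
    rw [htk] at h1
    have h2 := root_mem_Ioo b h1 (b.isPos_of_mem_support j.2)
    have h3 := root_mem_Ioo b hx (b.isPos_of_mem_support j.2)
    rw [map_add, map_smul, smul_eq_mul] at h2
    have h4 : |(k : ℝ) * P.toLinearMap (P.root j) t| < 1 := by
      rw [abs_lt]
      constructor <;> linarith [h2.1, h2.2, h3.1, h3.2]
    rw [abs_mul, Nat.abs_cast] at h4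
    rw [div_lt_iff₀ (abs_pos.2 hne)] at hk
    linarith
  set x₀ : N := (m : ℝ)⁻¹ • ∑ i ∈ Finset.range m, g^[i] x with hx₀
  have hm0 : (m : ℝ) ≠ 0 := by exact_mod_cast hmpos.ne'
  have hx₀mem : x₀ ∈ openAlcove b := by
    have h1 := (convex_openAlcove b).sum_mem (t := Finset.range m) (w := fun _ => (m : ℝ)⁻¹)
      (z := fun i => g^[i] x) (fun _ _ => by positivity)
      (by rw [Finset.sum_const, Finset.card_range, nsmul_eq_mul, mul_inv_cancel₀ hm0])
      (fun i _ => hit i)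
    rwa [← Finset.smul_sum] at h1
  have hfix : coact w x₀ + q = x₀ := by
    have h1 : coact w x₀ + q = (m : ℝ)⁻¹ • ∑ i ∈ Finset.range m, g^[i + 1] x := by
      simp only [Function.iterate_succ_apply', hg, Finset.sum_add_distrib, Finset.sum_const,
        Finset.card_range, smul_add, hx₀, map_smul, map_sum]
      rw [← Nat.cast_smul_eq_nsmul ℝ m q, smul_smul, inv_mul_cancel₀ hm0, one_smul]
    rw [h1, hx₀]
    congr 1
    have h2 := Finset.sum_range_succ (fun i => g^[i] x) m
    rw [Finset.sum_range_succ', htrans, ht0, add_zero] at h2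
    exact add_right_cancel h2
  have hw := eq_one_of_fixed b hx₀mem hq hfix
  refine ⟨hw, ?_⟩
  rw [hw, coact_one] at hfix
  exact left_eq_add.1 hfix.symm

/-- Equivalent points of the closed alcove coincide. -/
theorem eq_of_affWeylEquiv {x y : N} (hx : x ∈ alcove b) (hy : y ∈ alcove b)
    (h : AffWeylEquiv b x y) : y = x := by
  obtain ⟨z, hz⟩ := nonempty_openAlcove b
  obtain ⟨w, hw⟩ := h
  have : Finite {u : P.weylGroup // y - coact u y ∈ corootLattice b} := inferInstance
  have : Nonempty {u : P.weylGroup // y - coact u y ∈ corootLattice b} :=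
    ⟨1, by rw [coact_one, sub_self]; exact zero_mem _⟩
  -- The elements u are the linear parts of the affine maps fixing `y`. Choose the one that best
  -- aligns the transported direction from x to z with the direction from y to z.
  obtain ⟨⟨u, hu⟩, hmax⟩ := Finite.exists_max
    fun u : {u : P.weylGroup // y - coact u y ∈ corootLattice b} =>
      form P (z - y) (coact u.1 (coact w (z - x)))
  set v := coact u (coact w (z - x)) with hv
  -- By maximality the direction `v` points to the same side as `z` of every hyperplane through `y`.
  have hrefl (i : ι) (k : ℤ) (hk : P.toLinearMap (P.root i) y = k) :
      0 ≤ P.toLinearMap (P.root i) v * (P.toLinearMap (P.root i) z - k) := by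
    have h1 : y - coact (u * refl P i) y ∈ corootLattice b := by
      have h2 : y - coact (u * refl P i) y =
          coact (refl P i) (y - coact u y) + k • P.coroot i := by
        rw [coact_mul, map_sub, coact_refl _ y, hk, Int.cast_smul_eq_zsmul]
        abel
      rw [h2]
      exact add_mem (coact_mem_corootLattice b _ hu) (zsmul_mem (coroot_mem_corootLattice b i) k)
    have h3 := hmax ⟨u * refl P i, h1⟩
    simp only [coact_mul] at h3
    rw [← hv, coact_refl, form_sub_smul, form_coroot, map_sub, hk] at h3
    have h4 := form_coroot_self_pos (P := P) i
    refine nonneg_of_mul_nonneg_left (b := form P (P.coroot i) (P.coroot i) / 2) ?_ (by linarith)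
    linarith
  obtain ⟨i, hi, -⟩ := exists_highestRoot_eq b
  -- Walls not containing `y` are harmless for small t, and the previous step handles those through
  -- `y`.
  have hsmall : ∀ᶠ t : ℝ in nhdsWithin 0 (Set.Ioi 0), y + t • v ∈ alcove b := by
    have hpos (c d : ℝ) (hc : 0 ≤ c) (hcd : c = 0 → 0 ≤ d) :
        ∀ᶠ t : ℝ in nhdsWithin 0 (Set.Ioi 0), 0 ≤ c + t * d := by
      rcases hc.eq_or_lt with h0 | h0
      · filter_upwards [self_mem_nhdsWithin] with t ht
        rw [← h0, zero_add]
        exact mul_nonneg (le_of_lt ht) (hcd h0.symm)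
      · have h1 : Filter.Tendsto (fun t : ℝ => c + t * d) (nhds 0) (nhds (c + 0 * d)) :=
          (continuous_const.add (continuous_id.mul continuous_const)).tendsto 0
        rw [zero_mul, add_zero] at h1
        filter_upwards [nhdsWithin_le_nhds (h1.eventually (lt_mem_nhds h0))] with t ht
        exact ht.le
    have h1 : ∀ᶠ t : ℝ in nhdsWithin 0 (Set.Ioi 0), ∀ j : b.support,
        0 ≤ P.toLinearMap (P.root j) y + t * P.toLinearMap (P.root j) v := by
      rw [Filter.eventually_all]
      intro j
      refine hpos _ _ (hy.1 j) fun h0 => ?_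
      have h2 := hrefl j 0 (by rw [h0, Int.cast_zero])
      rw [Int.cast_zero, sub_zero] at h2
      exact nonneg_of_mul_nonneg_left h2 (hz.1 j)
    have h2 : ∀ᶠ t : ℝ in nhdsWithin 0 (Set.Ioi 0),
        0 ≤ (1 - P.toLinearMap (highestRoot b) y) + t * (-P.toLinearMap (highestRoot b) v) := by
      refine hpos _ _ (sub_nonneg.2 hy.2) fun h0 => ?_
      have hz2 := hz.2
      rw [hi] at h0 hz2 ⊢
      have h3 := hrefl i 1 (by rw [Int.cast_one]; linarith)
      rw [Int.cast_one] at h3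
      by_contra! h4
      nlinarith [mul_pos (neg_lt_zero.1 h4) (sub_pos.2 hz2)]
    filter_upwards [h1, h2] with t ht1 ht2
    refine ⟨fun j => ?_, ?_⟩
    · rw [map_add, map_smul, smul_eq_mul]
      exact ht1 j
    · rw [map_add, map_smul, smul_eq_mul]
      linarith
  obtain ⟨t, ht, ht0, ht1⟩ := (hsmall.and (Ioc_mem_nhdsGT (zero_lt_one' ℝ))).exists
  have hxt : x + t • (z - x) ∈ openAlcove b := by
    refine ⟨fun j => ?_, ?_⟩
    · rw [map_add, map_smul, map_sub, smul_eq_mul]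
      nlinarith [hx.1 j, mul_pos ht0 (hz.1 j), mul_nonneg (sub_nonneg.2 ht1) (hx.1 j)]
    · rw [map_add, map_smul, map_sub, smul_eq_mul]
      nlinarith [hx.2, mul_pos ht0 (sub_pos.2 hz.2), mul_nonneg (sub_nonneg.2 ht1)
        (sub_nonneg.2 hx.2)]
  have hq : y - coact (w * u) x ∈ corootLattice b := by
    have h1 : y - coact (w * u) x = (y - coact u y) + coact u (y - coact w x) := by
      rw [coact_mul, map_sub]
      abel
    rw [h1]
    exact add_mem hu (coact_mem_corootLattice b u hw)
  -- One affine Weyl group element carries `x` to `y` and an interior point back into the alcove, so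
  -- it is the identity.
  have hmap : coact (w * u) (x + t • (z - x)) + (y - coact (w * u) x) = y + t • v := by
    rw [map_add, map_smul, hv, ← coact_mul]
    abel
  have h1 := eq_one_of_mapsTo_openAlcove b hq hxt (by rw [hmap]; exact ht)
  rw [h1.1, coact_one, sub_eq_zero] at h1
  exact h1.2

end Uniqueness


section Injectivity

open AddMonoidAlgebra (single)

variable {n : ℕ} {ι V N : Type*} [Finite ι] [AddCommGroup V] [Module ℝ V] [AddCommGroup N]
  [Module ℝ N] {P : RootPairing ι ℝ V N} [P.IsRootSystem] [P.IsCrystallographic] [P.IsReduced]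
  (b : P.Base)

/-! ### The fundamental orbit functions separate orbits -/

theorem exists_separating {x : N} (hx : x ∉ corootLattice b) :
    ∃ μ ∈ weightLattice P, expFun P μ x ≠ 1 := by
  by_contra! h
  exact hx (mem_corootLattice_of_fundamentalWeight b fun j =>
    (expFun_eq_one_iff _ x).1 (h _ (fundamentalWeight_mem_weightLattice b j)))

theorem evalExp_eq_of_invariant {x y : N}
    (h : ∀ j, evalExp P x (fundSum b j) = evalExp P y (fundSum b j)) {f : ExpAlg V}
    (hf : ∀ j : b.support, actExp (refl P j) f = f) (hL : f ∈ expSubalgebra (weightLattice P)) :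
    evalExp P x f = evalExp P y f := by
  have h1 : Algebra.adjoin ℂ (Set.range (fundSum b)) ≤
      AlgHom.equalizer (evalExp P x) (evalExp P y) := by
    rw [Algebra.adjoin_le_iff]
    rintro _ ⟨j, rfl⟩
    exact h j
  exact h1 (mem_adjoin_fundSum b hf hL)

/-- If `y` is outside the class of `x`, a product of separating factors gives f vanishing on the
W-orbit of x but not at y. The invariant product of f(y) - u • f over all u in W then vanishes at y,
yet equals f(y)^|W| ≠ 0 at x. -/
theorem affWeylEquiv_of_evalExp_eq {x y : N}
    (h : ∀ j, evalExp P x (fundSum b j) = evalExp P y (fundSum b j)) : AffWeylEquiv b x y := by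
  by_contra hne
  have hne' (w : P.weylGroup) : ∃ μ ∈ weightLattice P, expFun P μ (y - coact w x) ≠ 1 :=
    exists_separating b fun hw => hne ⟨w, hw⟩
  choose μ hμL hμ using hne'
  set f : ExpAlg V := ∏ w : P.weylGroup,
    (single (μ w) 1 - algebraMap ℂ (ExpAlg V) (expFun P (μ w) (coact w x))) with hf
  have hfL : f ∈ expSubalgebra (weightLattice P) :=
    prod_mem fun w _ => sub_mem (single_mem_expSubalgebra (hμL w) 1) (algebraMap_mem _ _)
  have hev (z : N) : evalExp P z f =
      ∏ w : P.weylGroup, (expFun P (μ w) z - expFun P (μ w) (coact w x)) := by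
    rw [hf, map_prod]
    refine Finset.prod_congr rfl fun w _ => ?_
    rw [map_sub, evalExp_single, one_mul, AlgHom.commutes]
    rfl
  have hfx (u : P.weylGroup) : evalExp P (coact u x) f = 0 := by
    rw [hev]
    exact Finset.prod_eq_zero (Finset.mem_univ u) (sub_self _)
  have hfy : evalExp P y f ≠ 0 := by
    rw [hev, Finset.prod_ne_zero_iff]
    intro w _ h0
    have h1 : expFun P (μ w) y = expFun P (μ w) (y - coact w x) * expFun P (μ w) (coact w x) := by
      simp only [expFun, ← Complex.exp_add, map_sub, Complex.ofReal_sub]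
      congr 1
      ring
    rw [h1, ← sub_one_mul, mul_eq_zero, sub_eq_zero] at h0
    rcases h0 with h0 | h0
    · exact hμ w h0
    · simp [expFun] at h0
  set g : ExpAlg V := ∏ u : P.weylGroup, (algebraMap ℂ (ExpAlg V) (evalExp P y f) - actExp u f)
    with hg
  have hginv (j : b.support) : actExp (refl P j) g = g := by
    rw [hg, map_prod]
    refine Fintype.prod_equiv (Equiv.mulLeft (refl P j)) _ _ fun u => ?_
    rw [map_sub, AlgEquiv.commutes, Equiv.coe_mulLeft, actExp_mul]
  have hgL : g ∈ expSubalgebra (weightLattice P) := by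
    refine prod_mem fun u _ => sub_mem (algebraMap_mem _ _) fun ν hν => ?_
    rw [coeff_actExp] at hν
    have := smul_mem_weightLattice u (hfL _ hν)
    rwa [smul_inv_smul] at this
  have h1 := evalExp_eq_of_invariant b h hginv hgL
  have hgev (z : N) : evalExp P z g =
      ∏ u : P.weylGroup, (evalExp P y f - evalExp P (coact u z) f) := by
    rw [hg, map_prod]
    refine Finset.prod_congr rfl fun u _ => ?_
    rw [map_sub, AlgHom.commutes, evalExp_actExp]
    rfl
  have h2 : evalExp P y g = 0 := by
    rw [hgev]
    exact Finset.prod_eq_zero (Finset.mem_univ (1 : P.weylGroup)) (by rw [coact_one, sub_self])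
  rw [h2, hgev] at h1
  simp only [hfx, sub_zero, Finset.prod_const] at h1
  exact hfy (eq_zero_of_pow_eq_zero h1)

variable [P.IsIrreducible] (e : Fin n ≃ b.support) {T : SimpleType n}

theorem evalExp_fundSum_eq_of_transformX_eq (hT : b.cartanMatrix.submatrix e e = T.cartanMatrix)
    {x y : N} (h : transformX T b e x = transformX T b e y) (j : b.support) :
    evalExp P x (fundSum b j) = evalExp P y (fundSum b j) := by
  have h1 (j : Fin n) : evalExp P x (formalX b e T j) = evalExp P y (formalX b e T j) := by
    rw [evalExp_formalX, evalExp_formalX, ← ofReal_transformX b e hT, ← ofReal_transformX b e hT, h]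
  obtain ⟨j, rfl⟩ := e.surjective j
  rw [fundSum_eq b e T]
  split_ifs <;> simp only [map_add, map_sub, map_smul, h1]

theorem injOn_transformX (hT : b.cartanMatrix.submatrix e e = T.cartanMatrix) :
    Set.InjOn (transformX T b e) (simplexF b e) := by
  intro x hx y hy h
  rw [simplexF_eq_alcove] at hx hy
  exact (eq_of_affWeylEquiv b hx hy
    (affWeylEquiv_of_evalExp_eq b (evalExp_fundSum_eq_of_transformX_eq b e hT h))).symm

/-! ### The grid -/

theorem gridF_subset_simplexF {M : ℕ} (hM : 0 < M) : gridF b e M ⊆ simplexF b e := by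
  rintro x ⟨u₀, u, hu, rfl⟩
  have hM' : (M : ℝ) ≠ 0 := by exact_mod_cast hM.ne'
  refine ⟨u₀ / M, fun j => u j / M, by positivity, fun j => by positivity, ?_, rfl⟩
  rw [← div_self hM', ← hu, add_div, Finset.sum_div]
  simp only [div_mul_eq_mul_div]

theorem finite_gridF (M : ℕ) : (gridF b e M).Finite := by
  have h1 : {u : Fin n → ℕ | ∀ j, u j ∈ Set.Iic M}.Finite :=
    Set.Finite.pi' fun _ => Set.finite_Iic M
  refine (h1.image fun u => ∑ j, ((u j : ℝ) / M) • fundamentalCoweight b (e j)).subset ?_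
  rintro x ⟨u₀, u, hu, rfl⟩
  refine ⟨u, fun j => ?_, rfl⟩
  have h2 (j : Fin n) : (u j : ℝ) ≤ u j * mark b e j := by
    obtain ⟨m, hm, h⟩ := exists_nat_mark b e j
    rw [h]
    exact_mod_cast Nat.le_mul_of_pos_right _ hm
  have h3 : (u j : ℝ) * mark b e j ≤ ∑ j, (u j : ℝ) * mark b e j :=
    Finset.single_le_sum (f := fun j => (u j : ℝ) * mark b e j)
      (fun i _ => (Nat.cast_nonneg (u i)).trans (h2 i)) (Finset.mem_univ j)
  have h4 : (u j : ℝ) ≤ M := by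
    rw [← hu]
    linarith [h2 j, (Nat.cast_nonneg u₀ : (0 : ℝ) ≤ u₀)]
  exact_mod_cast h4

theorem mem_gridF_iff {M : ℕ} (hM : 0 < M) (x : N) : x ∈ gridF b e M ↔
    x ∈ alcove b ∧ ∀ j : b.support, ∃ k : ℤ, (M : ℝ) * P.toLinearMap (P.root j) x = k := by
  classical
  have hM' : (0 : ℝ) < M := by exact_mod_cast hM
  have h1 (y : Fin n → ℝ) (j : Fin n) : P.toLinearMap (P.root (e j))
      (∑ j, y j • fundamentalCoweight b (e j)) = y j := by
    simp [root_fundamentalCoweight]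
  constructor
  · intro hx
    refine ⟨simplexF_eq_alcove b e ▸ gridF_subset_simplexF b e hM hx, fun j => ?_⟩
    obtain ⟨u₀, u, -, rfl⟩ := hx
    obtain ⟨j, rfl⟩ := e.surjective j
    refine ⟨u j, ?_⟩
    rw [h1 (fun j => (u j : ℝ) / M) j]
    field_simp
    simp
  · rintro ⟨hx, hk⟩
    choose k hk using hk
    choose m hm1 hm using exists_nat_mark b e
    have hk0 (j : b.support) : 0 ≤ k j := by
      have := mul_nonneg hM'.le (hx.1 j)
      rw [hk] at this
      exact_mod_cast this
    have hsum : (∑ j, ((k (e j)).toNat * m j : ℕ) : ℝ) = M * P.toLinearMap (highestRoot b) x := by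
      rw [highestRoot_pairing b e, Finset.mul_sum]
      push_cast
      refine Finset.sum_congr rfl fun j _ => ?_
      rw [hm, ← mul_assoc, mul_comm (M : ℝ) (m j : ℝ), mul_assoc, hk, mul_comm (m j : ℝ)]
      congr 1
      exact_mod_cast Int.toNat_of_nonneg (hk0 (e j))
    have hle : ∑ j, (k (e j)).toNat * m j ≤ M := by
      have : (∑ j, ((k (e j)).toNat * m j : ℕ) : ℝ) ≤ M := by
        rw [hsum]
        nlinarith [hx.2]
      exact_mod_cast this
    refine ⟨M - ∑ j, (k (e j)).toNat * m j, fun j => (k (e j)).toNat, ?_, ?_⟩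
    · rw [Nat.cast_sub hle]
      simp only [hm]
      push_cast
      ring
    · have h2 (j : b.support) : P.toLinearMap (P.root j) x = ((k j).toNat : ℝ) / M := by
        rw [eq_div_iff hM'.ne', mul_comm, hk]
        exact_mod_cast (Int.toNat_of_nonneg (hk0 j)).symm
      simp only [← h2]
      rw [e.sum_comp fun j => P.toLinearMap (P.root j) x • fundamentalCoweight b j,
        sum_root_smul_fundamentalCoweight]

end Injectivity


section Discrete

open AddMonoidAlgebra (single)

variable {n : ℕ} {ι V N : Type*} [Finite ι] [AddCommGroup V] [Module ℝ V] [AddCommGroup N]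
  [Module ℝ N] {P : RootPairing ι ℝ V N} [P.IsRootSystem] [P.IsCrystallographic] [P.IsReduced]
  (b : P.Base)

/-! ### The determinant of the Cartan matrix -/

theorem form_sum_smul {κ : Type*} (s : Finset κ) (x : N) (c : κ → ℝ) (y : κ → N) :
    form P x (∑ k ∈ s, c k • y k) = ∑ k ∈ s, c k * form P x (y k) := by
  have := Fintype.ofFinite ι
  simp only [form_eq_sum, map_sum, map_smul, smul_eq_mul, Finset.mul_sum]
  rw [Finset.sum_comm]
  exact Finset.sum_congr rfl fun _ _ => Finset.sum_congr rfl fun _ _ => by ring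

theorem form_self_pos {x : N} (hx : x ≠ 0) : 0 < form P x x := by
  refine lt_of_le_of_ne (form_self_nonneg x) fun h => hx ?_
  refine P.toLinearMap.flip.toPerfPair.injective ?_
  rw [map_zero]
  have h1 : P.toLinearMap.flip x = 0 := by
    refine LinearMap.ext_on_range (v := P.root) RootPairing.IsRootSystem.span_root_eq_top
      fun i => ?_
    have := sq_root_le_form (P := P) x i
    rw [← h] at this
    simpa using pow_eq_zero_iff (two_ne_zero) |>.1 (le_antisymm this (sq_nonneg _))
  exact h1

open Classical in
-- Scaling the rows by half the squared lengths of the simple coroots turns the Cartan matrix into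
-- their Gram matrix, which is positive definite.
theorem det_cartanMatrix_pos : 0 < b.cartanMatrix.det := by
  set d : b.support → ℝ := fun i => form P (P.coroot i) (P.coroot i) / 2 with hd
  have hdpos (i : b.support) : 0 < d i := half_pos (form_coroot_self_pos i.1)
  set A : Matrix b.support b.support ℝ := b.cartanMatrix.map (Int.cast : ℤ → ℝ) with hA
  have hgram (i j : b.support) :
      (Matrix.diagonal d * A) i j = form P (P.coroot j) (P.coroot i) := by
    rw [Matrix.diagonal_mul, form_coroot, mul_comm, root_coroot_eq_cast]
    rfl
  have hpos : (Matrix.diagonal d * A).PosDef := by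
    refine Matrix.PosDef.of_dotProduct_mulVec_pos (Matrix.IsHermitian.ext fun i j => ?_)
      fun c hc => ?_
    · rw [hgram, hgram, form_comm]
      rfl
    · have hx : ∑ i, c i • P.coroot i.1 ≠ 0 := fun h0 => hc <| funext fun i => by
        have := congrArg (P.toLinearMap (fundamentalWeight b i)) h0
        simpa [fundamentalWeight_coroot] using this
      have h1 := form_self_pos (P := P) hx
      rw [form_sum_smul] at h1
      simp only [form_comm (∑ i, c i • P.coroot i.1), form_sum_smul] at h1
      simp only [dotProduct, Matrix.mulVec, hgram, star_trivial]
      refine h1.trans_le (le_of_eq (Finset.sum_congr rfl fun i _ => ?_))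
      congr 1
      exact Finset.sum_congr rfl fun j _ => by rw [mul_comm, form_comm]
  have h1 := hpos.det_pos
  rw [Matrix.det_mul, Matrix.det_diagonal] at h1
  have h2 : 0 < A.det := pos_of_mul_pos_right h1 (Finset.prod_nonneg fun i _ => (hdpos i).le)
  have h3 : A.det = ((b.cartanMatrix.det : ℤ) : ℝ) := (Int.cast_det _).symm
  rw [h3] at h2
  exact_mod_cast h2

/-! ### Small elements of the root lattice -/

theorem exists_mul_coroot_pos {v : V} (hv : v ≠ 0) {c : b.support → ℝ}
    (hc : v = ∑ j, c j • P.root j) : ∃ j, 0 < c j * P.toLinearMap v (P.coroot j) := by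
  by_contra! h
  have h1 := form_self_pos (P := P.flip) hv
  conv at h1 => rhs; rhs; rw [hc]
  rw [form_sum_smul] at h1
  refine h1.not_ge (Finset.sum_nonpos fun j _ => ?_)
  have h2 := form_coroot (P := P.flip) j.1 v
  change form P.flip v (P.root j) = P.toLinearMap v (P.coroot j) *
    (form P.flip (P.root j) (P.root j) / 2) at h2
  have h3 : 0 < form P.flip (P.root j) (P.root j) := form_coroot_self_pos (P := P.flip) j.1
  rw [h2, ← mul_assoc]
  exact mul_nonpos_of_nonpos_of_nonneg (h j) (by linarith)

/-- For v ≠ 0, positivity of (v, v) = Σ c_j (v, α_j) provides j such that c_j and ⟨v, α_j^∨⟩ = ±1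
have the same sign. Reflecting in α_j lowers |c_j| by one and keeps both hypotheses, so induction on
Σ |c_j| brings v to zero. -/
theorem eq_zero_of_small {v : V} {c : b.support → ℤ} (hc : v = ∑ j, (c j : ℝ) • P.root j)
    (h : ∀ i, |P.toLinearMap v (P.coroot i)| ≤ 1) : v = 0 := by
  classical
  obtain ⟨d, hd⟩ : ∃ d : ℕ, ∑ j, |c j| ≤ d := ⟨(∑ j, |c j|).toNat, Int.self_le_toNat _⟩
  induction d generalizing v c with
  | zero =>
    have h0 (j : b.support) : c j = 0 := by
      have h1 : |c j| ≤ ∑ j, |c j| :=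
        Finset.single_le_sum (f := fun j => |c j|) (fun i _ => abs_nonneg _) (Finset.mem_univ j)
      have h2 := abs_nonneg (c j)
      rw [← abs_eq_zero]
      omega
    rw [hc]
    simp [h0]
  | succ d ih =>
    by_contra hv
    obtain ⟨j, hj⟩ := exists_mul_coroot_pos b hv hc
    obtain ⟨k, hk⟩ : ∃ k : ℤ, P.toLinearMap v (P.coroot j) = k := by
      have hmem : v ∈ weightLattice P := by
        rw [hc]
        refine sum_mem fun j _ => ?_
        rw [Int.cast_smul_eq_zsmul]
        exact zsmul_mem (root_mem_weightLattice (P := P) j.1) _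
      exact hmem j
    have hk1 : |k| ≤ 1 := by
      have := h j
      rw [hk] at this
      exact_mod_cast this
    have hck : 0 < c j * k := by
      rw [hk] at hj
      exact_mod_cast hj
    have hs : refl P j • v = ∑ l, ((c l - if l = j then k else 0 : ℤ) : ℝ) • P.root l := by
      rw [refl_smul, hk]
      conv_lhs => rw [hc]
      push_cast
      simp only [sub_smul, Finset.sum_sub_distrib, ite_smul, zero_smul, Finset.sum_ite_eq',
        Finset.mem_univ, if_true]
    have h1 : refl P j • v = 0 := by
      refine ih hs (fun i => ?_) ?_
      · rw [pairing_smul, coact_coroot]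
        exact h _
      · rw [← Finset.add_sum_erase _ _ (Finset.mem_univ j)] at hd ⊢
        have h2 : ∑ l ∈ Finset.univ.erase j, |c l - if l = j then k else 0| =
            ∑ l ∈ Finset.univ.erase j, |c l| :=
          Finset.sum_congr rfl fun l hl => by rw [if_neg (Finset.ne_of_mem_erase hl), sub_zero]
        rw [h2, if_pos rfl]
        have h3 : |c j - k| + 1 ≤ |c j| := by
          rcases pos_and_pos_or_neg_and_neg_of_mul_pos hck with h4 | h4
          · rw [abs_of_pos h4.2] at hk1
            rw [abs_of_nonneg (by omega), abs_of_pos h4.1]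
            omega
          · rw [abs_of_neg h4.2] at hk1
            rw [abs_of_nonpos (by omega), abs_of_neg h4.1]
            omega
        push_cast at hd
        linarith
    refine hv ?_
    rw [← inv_smul_smul (refl P j.1) v, h1, smul_zero]

/-! ### The refined coweight lattice -/

/-- The lattice of points on which `M` times every simple root is integral. -/
def gridLattice (M : ℕ) : AddSubgroup N where
  carrier := {x | ∀ j : b.support, ∃ k : ℤ, (M : ℝ) * P.toLinearMap (P.root j) x = k}
  add_mem' {x y} hx hy j := by
    obtain ⟨k, hk⟩ := hx j
    obtain ⟨l, hl⟩ := hy j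
    exact ⟨k + l, by rw [map_add, mul_add, hk, hl]; push_cast; rfl⟩
  zero_mem' j := ⟨0, by simp⟩
  neg_mem' {x} hx j := by
    obtain ⟨k, hk⟩ := hx j
    exact ⟨-k, by rw [map_neg, mul_neg, hk]; push_cast; rfl⟩

theorem exists_int_of_mem_gridLattice {M : ℕ} {x : N} (hx : x ∈ gridLattice b M) (i : ι) :
    ∃ k : ℤ, (M : ℝ) * P.toLinearMap (P.root i) x = k := by
  have h1 : P.root i ∈ AddSubgroup.closure (P.root '' b.support) := by
    rcases b.root_mem_or_neg_mem i with h | h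
    · exact AddSubgroup.le_closure_toAddSubmonoid _ h
    · exact neg_mem_iff.1 (AddSubgroup.le_closure_toAddSubmonoid _ h)
  obtain ⟨c, hc⟩ := exists_int_repr b h1
  choose k hk using hx
  refine ⟨∑ j, c j * k j, ?_⟩
  rw [hc]
  push_cast
  simp only [map_sum, map_smul, LinearMap.sum_apply, LinearMap.smul_apply, smul_eq_mul,
    Finset.mul_sum, ← hk]
  exact Finset.sum_congr rfl fun j _ => by ring

theorem coact_mem_gridLattice {M : ℕ} (w : P.weylGroup) {x : N} (hx : x ∈ gridLattice b M) :
    coact w x ∈ gridLattice b M := fun j => by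
  rw [root_smul_coact]
  exact exists_int_of_mem_gridLattice b hx _

theorem corootLattice_le_gridLattice (M : ℕ) : corootLattice b ≤ gridLattice b M := fun x hx j => by
  obtain ⟨k, hk⟩ := exists_int_of_mem_corootLattice b (root_mem_weightLattice (P := P) j) hx
  exact ⟨M * k, by rw [hk]; push_cast; rfl⟩

theorem smul_fundamentalCoweight_mem_gridLattice {M : ℕ} (hM : 0 < M) (j : b.support) :
    (M : ℝ)⁻¹ • fundamentalCoweight b j ∈ gridLattice b M := fun k => by
  classical
  have : (M : ℝ) ≠ 0 := by exact_mod_cast hM.ne'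
  refine ⟨if j = k then 1 else 0, ?_⟩
  rw [map_smul, root_fundamentalCoweight, smul_eq_mul, mul_inv_cancel_left₀ this]
  split_ifs <;> simp

open Classical in
/-- The fundamental coweights as a basis. -/
noncomputable def coweightBasis : Module.Basis b.support ℝ N :=
  Module.Basis.ofEquivFun
    { toFun := fun x j => P.toLinearMap (P.root j) x
      map_add' := fun x y => by ext; simp
      map_smul' := fun c x => by ext; simp
      invFun := fun y => ∑ j, y j • fundamentalCoweight b j
      left_inv := sum_root_smul_fundamentalCoweight b
      right_inv := fun y => by ext j; simp [root_fundamentalCoweight] }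

theorem coweightBasis_repr (x : N) (j : b.support) :
    (coweightBasis b).repr x j = P.toLinearMap (P.root j) x := rfl

open Classical in
theorem coweightBasis_apply (j : b.support) : coweightBasis b j = fundamentalCoweight b j := by
  rw [coweightBasis, Module.Basis.coe_ofEquivFun]
  change ∑ k, (Pi.single j (1 : ℝ) : b.support → ℝ) k • fundamentalCoweight b k = _
  simp [Pi.single_apply]

open Classical in
-- In the basis ω_j^∨ / M of the finer lattice, the simple coroots have coordinate matrix M times
-- the Cartan matrix.
theorem relIndex_gridLattice {M : ℕ} (hM : 0 < M) :
    ((corootLattice b).relIndex (gridLattice b M) : ℤ) =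
      M ^ Fintype.card b.support * b.cartanMatrix.det := by
  have hM0 : (M : ℝ) ≠ 0 := by exact_mod_cast hM.ne'
  let B := (coweightBasis b).unitsSMul fun _ => (Units.mk0 (M : ℝ) hM0)⁻¹
  have hB (j : b.support) : B j = (M : ℝ)⁻¹ • fundamentalCoweight b j := by
    rw [Module.Basis.unitsSMul_apply, coweightBasis_apply]
    rfl
  have h1 : corootLattice b = .closure (Set.range b.toCoweightBasis) := by
    rw [corootLattice]
    congr 1
    ext x
    simp
  have h2 : gridLattice b M = .closure (Set.range B) := by
    refine le_antisymm (fun x hx => ?_) ?_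
    · choose k hk using hx
      rw [← sum_root_smul_fundamentalCoweight b x]
      refine sum_mem fun j _ => ?_
      have h3 : P.toLinearMap (P.root j) x • fundamentalCoweight b j = k j • B j := by
        rw [hB, ← Int.cast_smul_eq_zsmul ℝ, ← hk, smul_smul]
        congr 1
        field_simp
      rw [h3]
      exact zsmul_mem (AddSubgroup.subset_closure (Set.mem_range_self j)) _
    · rw [AddSubgroup.closure_le]
      rintro _ ⟨j, rfl⟩
      rw [hB]
      exact smul_fundamentalCoweight_mem_gridLattice b hM j
  have hle := corootLattice_le_gridLattice b M
  have h3 := AddSubgroup.relIndex_eq_natAbs_det _ _ hle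
    (b.toCoweightBasis.addSubgroupOfClosure _ h1) (B.addSubgroupOfClosure _ h2)
  have h4 : (B.addSubgroupOfClosure _ h2).det
      (fun i ↦ ⟨b.toCoweightBasis.addSubgroupOfClosure _ h1 i, hle (SetLike.coe_mem _)⟩) =
      M ^ Fintype.card b.support * b.cartanMatrix.det := by
    rw [Module.Basis.det_apply]
    refine Eq.trans ?_ (Matrix.det_smul b.cartanMatrix (M : ℤ))
    congr 1
    ext i j
    apply Int.cast_injective (α := ℝ)
    rw [Module.Basis.toMatrix_apply]
    have h5 := B.addSubgroupOfClosure_repr_apply _ h2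
      ⟨b.toCoweightBasis.addSubgroupOfClosure _ h1 j, hle (SetLike.coe_mem _)⟩ i
    refine h5.trans ?_
    rw [Module.Basis.addSubgroupOfClosure_apply, Module.Basis.repr_unitsSMul, coweightBasis_repr,
      RootPairing.Base.toCoweightBasis_apply, root_coroot_eq_cast]
    simp [Units.smul_def, Matrix.smul_apply]
    exact Or.inl rfl
  rw [h3, h4, Int.natCast_natAbs, abs_of_nonneg]
  have := det_cartanMatrix_pos b
  positivity

end Discrete


section DiscreteSum

open AddMonoidAlgebra (single)

variable {n : ℕ} {ι V N : Type*} [Finite ι] [AddCommGroup V] [Module ℝ V] [AddCommGroup N]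
  [Module ℝ N] {P : RootPairing ι ℝ V N} [P.IsRootSystem] [P.IsCrystallographic] [P.IsReduced]
  (b : P.Base)

/-! ### Sums over the finite torus subgroup -/

/-- The value of a formal exponential sum on the torus. -/
noncomputable def torusEval (f : ExpAlg V) (g : N ⧸ corootLattice b) : ℂ := evalExp P g.out f

/-- Weights are integral on the coroot lattice, so the representative chosen in `torusEval` does not
matter. -/
theorem torusEval_mk {f : ExpAlg V} (hf : f ∈ expSubalgebra (weightLattice P)) (x : N) :
    torusEval b f (QuotientAddGroup.mk x) = evalExp P x f := by
  obtain ⟨⟨q, hq⟩, h⟩ := QuotientAddGroup.mk_out_eq_add (corootLattice b) x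
  rw [torusEval, h]
  exact evalExp_add_mem b hf x hq

/-- The image of the refined coweight lattice in the torus. -/
noncomputable def gridTorus (M : ℕ) : AddSubgroup (N ⧸ corootLattice b) :=
  (gridLattice b M).map (QuotientAddGroup.mk' (corootLattice b))

theorem card_gridTorus (e : Fin n ≃ b.support) {M : ℕ} (hM : 0 < M) :
    (Nat.card (gridTorus b M) : ℤ) = M ^ n * (b.cartanMatrix.submatrix e e).det := by
  classical
  rw [Matrix.det_submatrix_equiv_self, gridTorus, ← AddSubgroup.relIndex_ker,
    QuotientAddGroup.ker_mk', relIndex_gridLattice b hM, ← Fintype.card_congr e, Fintype.card_fin]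

theorem finite_gridTorus (e : Fin n ≃ b.support) {M : ℕ} (hM : 0 < M) :
    Finite (gridTorus b M) := by
  classical
  refine Nat.finite_of_card_ne_zero fun h => ?_
  have h1 := card_gridTorus b e hM
  rw [h, Matrix.det_submatrix_equiv_self] at h1
  have h2 := det_cartanMatrix_pos b
  have : (0 : ℤ) < M ^ n * b.cartanMatrix.det := by positivity
  rw [← h1] at this
  exact lt_irrefl _ this

/-- Orthogonality of characters: translation by x multiplies the sum by a factor different from 1.
-/
theorem sum_expFun_gridTorus {M : ℕ} [Fintype (gridTorus b M)] {μ : V} (hμ : μ ∈ weightLattice P)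
    {x : N} (hx : x ∈ gridLattice b M) (hne : expFun P μ x ≠ 1) :
    ∑ g : gridTorus b M, torusEval b (single μ 1) g = 0 := by
  have hmem := single_mem_expSubalgebra hμ 1
  set h : gridTorus b M := ⟨QuotientAddGroup.mk x, ⟨x, hx, rfl⟩⟩ with hh
  have h1 : ∑ g : gridTorus b M, torusEval b (single μ 1) (h + g : gridTorus b M) =
      expFun P μ x * ∑ g : gridTorus b M, torusEval b (single μ 1) g := by
    rw [Finset.mul_sum]
    refine Finset.sum_congr rfl fun g _ => ?_
    obtain ⟨y, hy⟩ := QuotientAddGroup.mk_surjective g.1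
    have h2 : ((h + g : gridTorus b M) : N ⧸ corootLattice b) = QuotientAddGroup.mk (x + y) := by
      rw [AddSubgroup.coe_add, ← hy]
      rfl
    rw [h2, ← hy, torusEval_mk b hmem]
    rw [torusEval_mk b hmem, evalExp_single, evalExp_single, one_mul, one_mul]
    simp only [expFun, ← Complex.exp_add, map_add, Complex.ofReal_add, mul_add]
  have h4 := Equiv.sum_comp (Equiv.addLeft h) fun g : gridTorus b M => torusEval b (single μ 1) g
  simp only [Equiv.coe_addLeft] at h4
  rw [h4] at h1
  have h3 : (expFun P μ x - 1) * ∑ g : gridTorus b M, torusEval b (single μ 1) g = 0 := by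
    rw [sub_one_mul, ← h1, sub_self]
  exact (mul_eq_zero.1 h3).resolve_left (sub_ne_zero.2 hne)

theorem sum_torusEval {M : ℕ} [Fintype (gridTorus b M)] {f : ExpAlg V}
    (hf : f ∈ expSubalgebra (weightLattice P))
    (h : ∀ μ, f.coeff μ ≠ 0 → μ ≠ 0 → ∃ x ∈ gridLattice b M, expFun P μ x ≠ 1) :
    ∑ g : gridTorus b M, torusEval b f g = Nat.card (gridTorus b M) * f.coeff 0 := by
  have h1 (g : gridTorus b M) : torusEval b f g =
      ∑ μ ∈ f.coeff.support, f.coeff μ * torusEval b (single μ 1) g := by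
    rw [torusEval, evalExp_apply]
    simp [torusEval]
  simp only [h1]
  rw [Finset.sum_comm, Finset.sum_eq_single 0]
  · rw [← Finset.mul_sum]
    simp [torusEval, mul_comm]
  · intro μ hμ hμ0
    rw [Finsupp.mem_support_iff] at hμ
    obtain ⟨x, hx, hne⟩ := h μ hμ hμ0
    rw [← Finset.mul_sum, sum_expFun_gridTorus b (hf μ hμ) hx hne, mul_zero]
  · intro h0
    rw [Finsupp.notMem_support_iff.1 h0]
    simp

/-! ### Decomposition into orbits -/

variable [P.IsIrreducible] (e : Fin n ≃ b.support)

theorem mk_eq_mk_iff (x y : N) :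
    (QuotientAddGroup.mk x : N ⧸ corootLattice b) = QuotientAddGroup.mk y ↔
      y - x ∈ corootLattice b := by
  rw [QuotientAddGroup.eq, neg_add_eq_sub]

/-- The affine Weyl group preserves the refined lattice, so moving a lattice point into the alcove
lands in the grid. With the disjointness below, each grid point stands for `orbitSize` group
elements. -/
theorem coe_gridTorus {M : ℕ} (hM : 0 < M) : (gridTorus b M : Set (N ⧸ corootLattice b)) =
    ⋃ x ∈ gridF b e M, QuotientAddGroup.mk '' MulAction.orbit P.weylGroup.op x := by
  ext g
  simp only [Set.mem_iUnion]
  constructor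
  · rintro ⟨x, hx, rfl⟩
    obtain ⟨y, hy, w, hw⟩ := exists_affWeylEquiv_mem_alcove b x
    refine ⟨y, (mem_gridF_iff b e hM y).2 ⟨hy, ?_⟩, ?_⟩
    · have h1 := add_mem (coact_mem_gridLattice b w hx) (corootLattice_le_gridLattice b M hw)
      rwa [add_sub_cancel] at h1
    · rw [orbit_op_eq]
      refine ⟨coact w⁻¹ y, ⟨w⁻¹, rfl⟩, (mk_eq_mk_iff b _ _).2 ?_⟩
      have h1 := coact_mem_corootLattice b w⁻¹ hw
      rw [map_sub, coact_inv_coact] at h1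
      rw [← neg_sub]
      exact neg_mem h1
  · rintro ⟨x, hx, y, hy, rfl⟩
    rw [orbit_op_eq] at hy
    obtain ⟨w, rfl⟩ := hy
    exact ⟨_, coact_mem_gridLattice b w ((mem_gridF_iff b e hM x).1 hx).2, rfl⟩

theorem pairwiseDisjoint_orbits {M : ℕ} (hM : 0 < M) : (gridF b e M).PairwiseDisjoint
    fun x => ((QuotientAddGroup.mk : N → N ⧸ corootLattice b) ''
      MulAction.orbit P.weylGroup.op x) := by
  intro x hx y hy hxy
  rw [Function.onFun, Set.disjoint_left]
  rintro _ ⟨x', hx', rfl⟩ ⟨y', hy', h⟩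
  rw [orbit_op_eq] at hx' hy'
  obtain ⟨w, rfl⟩ := hx'
  obtain ⟨u, rfl⟩ := hy'
  rw [mk_eq_mk_iff] at h
  refine hxy (eq_of_affWeylEquiv b ((mem_gridF_iff b e hM y).1 hy).1
    ((mem_gridF_iff b e hM x).1 hx).1 ⟨u * w⁻¹, ?_⟩)
  have h1 := coact_mem_corootLattice b w⁻¹ h
  rwa [map_sub, coact_inv_coact, ← coact_mul] at h1

theorem finsum_gridF {M : ℕ} (hM : 0 < M) {f : ExpAlg V}
    (hf : f ∈ expSubalgebra (weightLattice P)) (hinv : ∀ w : P.weylGroup, actExp w f = f)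
    (h : ∀ μ, f.coeff μ ≠ 0 → μ ≠ 0 → ∃ x ∈ gridLattice b M, expFun P μ x ≠ 1) :
    ∑ᶠ x ∈ gridF b e M, (orbitSize b x : ℂ) * evalExp P x f =
      M ^ n * ((b.cartanMatrix.submatrix e e).det : ℂ) * f.coeff 0 := by
  have hfin := finite_gridTorus b e hM
  have := Fintype.ofFinite (gridTorus b M)
  have h1 := sum_torusEval b hf h
  have h2 : ((Nat.card (gridTorus b M) : ℂ)) =
      M ^ n * ((b.cartanMatrix.submatrix e e).det : ℂ) := by
    exact_mod_cast congrArg (Int.cast : ℤ → ℂ) (card_gridTorus b e hM)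
  rw [← h2, ← h1, ← finsum_eq_sum_of_fintype]
  have h3 : ∑ᶠ g : gridTorus b M, torusEval b f g =
      ∑ᶠ g ∈ (gridTorus b M : Set (N ⧸ corootLattice b)), torusEval b f g :=
    (finsum_set_coe_eq_finsum_mem _)
  have hofin (x : N) : ((QuotientAddGroup.mk : N → N ⧸ corootLattice b) ''
      MulAction.orbit P.weylGroup.op x).Finite := by
    rw [orbit_op_eq]
    exact (Set.finite_range _).image _
  rw [h3, coe_gridTorus b e hM, finsum_mem_biUnion (pairwiseDisjoint_orbits b e hM)
    (finite_gridF b e M) fun x _ => hofin x]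
  refine finsum_mem_congr rfl fun x hx => ?_
  have h4 : ∀ g ∈ ((QuotientAddGroup.mk : N → N ⧸ corootLattice b) ''
      MulAction.orbit P.weylGroup.op x), torusEval b f g = evalExp P x f := by
    rintro _ ⟨y, hy, rfl⟩
    rw [orbit_op_eq] at hy
    obtain ⟨w, rfl⟩ := hy
    rw [torusEval_mk b hf, ← evalExp_actExp, hinv]
  rw [finsum_mem_congr rfl h4, finsum_mem_eq_finite_toFinset_sum _ (hofin x), Finset.sum_const,
    nsmul_eq_mul, orbitSize, Set.ncard_eq_toFinset_card _ (hofin x)]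

/-! ### Polynomials of bounded degree -/

/-- An exponent trivial on the refined lattice has the form Mβ with β in the root lattice. The
integers ⟨β, α^∨⟩ are at most (2M - 1)/M < 2, hence at most 1, and at least -1 by negating the
coroot. The degree bound 2M - 1 is needed exactly here. -/
theorem exists_gridLattice_ne_one {M : ℕ} (hM : 0 < M) {μ : V}
    (hμ : ∀ i, P.toLinearMap μ (P.coroot i) ≤ 2 * M - 1) (h0 : μ ≠ 0) :
    ∃ x ∈ gridLattice b M, expFun P μ x ≠ 1 := by
  classical
  by_contra! h
  have hM0 : (0 : ℝ) < M := by exact_mod_cast hM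
  have h1 (j : b.support) : ∃ k : ℤ,
      P.toLinearMap μ ((M : ℝ)⁻¹ • fundamentalCoweight b j) = k :=
    (expFun_eq_one_iff _ _).1 (h _ (smul_fundamentalCoweight_mem_gridLattice b hM j))
  choose c hc using h1
  have h2 : (M : ℝ)⁻¹ • μ = ∑ j, (c j : ℝ) • P.root j := by
    conv_lhs => rw [← sum_repr_smul_root b μ, Finset.smul_sum]
    refine Finset.sum_congr rfl fun j _ => ?_
    rw [smul_smul, ← hc, map_smul, smul_eq_mul]
    congr 2
    rw [pairing_eq_sum_repr b]
    simp [root_fundamentalCoweight]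
  have hle (i : ι) : P.toLinearMap ((M : ℝ)⁻¹ • μ) (P.coroot i) ≤ 1 := by
    obtain ⟨k, hk⟩ : ∃ k : ℤ, P.toLinearMap ((M : ℝ)⁻¹ • μ) (P.coroot i) = k := by
      have hmem : (M : ℝ)⁻¹ • μ ∈ weightLattice P := by
        rw [h2]
        refine sum_mem fun j _ => ?_
        rw [Int.cast_smul_eq_zsmul]
        exact zsmul_mem (root_mem_weightLattice (P := P) j.1) _
      exact hmem i
    have h3 : (k : ℝ) < 2 := by
      rw [← hk, map_smul, LinearMap.smul_apply, smul_eq_mul, inv_mul_lt_iff₀ hM0]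
      linarith [hμ i]
    have h4 : k < 2 := by exact_mod_cast h3
    rw [hk]
    exact_mod_cast (by omega : k ≤ 1)
  have h5 := eq_zero_of_small b h2 fun i => abs_le.2 ⟨by
    have := hle (P.reflectionPerm i i)
    rw [coroot_reflectionPerm_self', map_neg] at this
    linarith, hle i⟩
  exact h0 ((smul_eq_zero.1 h5).resolve_left (inv_ne_zero hM0.ne'))

variable {T : SimpleType n}

theorem aeval_formalX_mem (p : MvPolynomial (Fin n) ℂ) :
    MvPolynomial.aeval (formalX b e T) p ∈ expSubalgebra (weightLattice P) := by
  rw [MvPolynomial.aeval_def, MvPolynomial.eval₂_eq']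
  exact sum_mem fun m _ => mul_mem (algebraMap_mem _ _)
    (prod_mem fun j _ => pow_mem (formalX_mem b e T j) _)

theorem actExp_aeval_formalX (w : P.weylGroup) (p : MvPolynomial (Fin n) ℂ) :
    actExp w (MvPolynomial.aeval (formalX b e T) p) = MvPolynomial.aeval (formalX b e T) p := by
  have h := MvPolynomial.comp_aeval (R := ℂ) (formalX b e T) (actExp w : ExpAlg V ≃ₐ[ℂ] ExpAlg V).toAlgHom
  have h1 := DFunLike.congr_fun h p
  simp only [AlgHom.comp_apply] at h1
  refine h1.trans ?_
  congr 1
  congr 1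
  funext j
  exact actExp_formalX b e T w j

theorem aeval_formalX_mem_atMost (hT : b.cartanMatrix.submatrix e e = T.cartanMatrix)
    {p : MvPolynomial (Fin n) ℂ} {d : ℝ} (hp : MDegreeLE b e p d) (i : ι) :
    MvPolynomial.aeval (formalX b e T) p ∈ atMost (P.toLinearMap.flip (P.coroot i)) d := by
  rw [MvPolynomial.aeval_def, MvPolynomial.eval₂_eq']
  refine sum_mem fun m hm => ?_
  rw [← Algebra.smul_def]
  refine Submodule.smul_mem _ _ fun μ hμ => le_trans ?_ (hp m hm)
  exact prod_mem_atMost Finset.univ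
    (fun j _ => pow_mem_atMost (formalX_mem_atMost b e hT j i) (m j)) μ hμ

/-- The sum over the nodes. -/
theorem finsum_nodesOmega (hT : b.cartanMatrix.submatrix e e = T.cartanMatrix) {M : ℕ}
    (hM : 0 < M) {p : MvPolynomial (Fin n) ℂ} (hp : MDegreeLE b e p (2 * M - 1)) :
    ∑ᶠ y ∈ nodesOmega T b e M, (nodeSize T b e M y : ℂ) * evalReal p y =
      M ^ n * ((b.cartanMatrix.submatrix e e).det : ℂ) *
        (MvPolynomial.aeval (formalX b e T) p).coeff 0 := by
  have hinj : Set.InjOn (transformX T b e) (gridF b e M) :=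
    (injOn_transformX b e hT).mono (gridF_subset_simplexF b e hM)
  rw [nodesOmega, finsum_mem_image hinj, ← finsum_gridF b e hM (aeval_formalX_mem b e p)
    (fun w => actExp_aeval_formalX b e w p) fun μ hμ h0 =>
      exists_gridLattice_ne_one b hM (fun i => aeval_formalX_mem_atMost b e hT hp i μ hμ) h0]
  refine finsum_mem_congr rfl fun x hx => ?_
  rw [nodeSize, hinj.leftInvOn_invFunOn hx, evalReal_transformX b e hT]

end DiscreteSum


section Mixing

variable {n : ℕ} (T : SimpleType n)

/-! ### The Jacobian determinant of the `X`-transform -/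

/-- The matrix expressing the `X_j` in terms of the `Z_j`. -/
noncomputable def mixMatrix : Matrix (Fin n) (Fin n) ℂ := Matrix.of fun j l =>
  if T.partner j = j then (if j = l then 1 else 0)
  else if j < T.partner j then (1 / 2) * ((if j = l then 1 else 0) + if T.partner j = l then 1 else 0)
  else (1 / (2 * Complex.I)) * ((if T.partner j = l then 1 else 0) - if j = l then 1 else 0)

/-- Rows of different blocks have disjoint supports. A pair j, σ(j) gives the real-part and
imaginary-part rows, which are orthogonal with squared norm one half. -/
theorem mixMatrix_mul_conjTranspose : mixMatrix T * (mixMatrix T).conjTranspose =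
    Matrix.diagonal fun j => if T.partner j = j then (1 : ℂ) else 1 / 2 := by
  have hinv (j : Fin n) : T.partner (T.partner j) = j := partner_partner T j
  have key (j : Fin n) (v : Fin n → ℂ) : ∑ l, mixMatrix T j l * v l =
      if T.partner j = j then v j
      else if j < T.partner j then (1 / 2) * (v j + v (T.partner j))
      else (1 / (2 * Complex.I)) * (v (T.partner j) - v j) := by
    simp only [mixMatrix, Matrix.of_apply]
    split_ifs <;> simp only [mul_assoc, ← Finset.mul_sum, add_mul, sub_mul, ite_mul, one_mul,
      zero_mul, Finset.sum_add_distrib, Finset.sum_sub_distrib, Finset.sum_ite_eq,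
      Finset.mem_univ, if_true]
  have hI : Complex.I ≠ 0 := Complex.I_ne_zero
  have hI2 : Complex.I * Complex.I = -1 := Complex.I_mul_I
  ext j k
  rw [Matrix.mul_apply, key j fun l => (mixMatrix T).conjTranspose l k, Matrix.diagonal_apply]
  simp only [Matrix.conjTranspose_apply, mixMatrix, Matrix.of_apply]
  by_cases hkj : k = j
  · subst hkj
    rw [if_pos rfl]
    by_cases h1 : T.partner k = k
    · simp [h1]
    · have h1' : k ≠ T.partner k := Ne.symm h1
      by_cases h2 : k < T.partner k
      · simp [h1, h1', h2]; norm_num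
      · simp [h1, h1', h2]
        field_simp
        rw [sq, hI2]; norm_num
  · have hjk : j ≠ k := Ne.symm hkj
    rw [if_neg hjk]
    by_cases hp : T.partner j = k
    · have hkp : T.partner k = j := by rw [← hp, hinv]
      have h1 : T.partner j ≠ j := by rw [hp]; exact hkj
      simp only [hp, hkp, hkj, hjk, if_false, if_true]
      rcases lt_or_gt_of_ne hjk with h2 | h2
      · simp [h2, h2.not_gt]
      · simp [h2, h2.not_gt]
    · have hkp : T.partner k ≠ j := fun h => hp (by rw [← h, hinv])
      have hpp : T.partner k ≠ T.partner j := fun h => hkj (by rw [← hinv k, h, hinv])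
      have hp' : k ≠ T.partner j := Ne.symm hp
      simp [hkj, hkp, hpp, hp']

theorem norm_det_mixMatrix : ‖(mixMatrix T).det‖ = T.kappa := by
  have h1 := congrArg Matrix.det (mixMatrix_mul_conjTranspose T)
  rw [Matrix.det_mul, Matrix.det_conjTranspose, Matrix.det_diagonal, Complex.star_def,
    Complex.mul_conj, Complex.normSq_eq_norm_sq] at h1
  have h2 : ‖(mixMatrix T).det‖ ^ 2 = T.kappa ^ 2 := by
    rw [kappa_sq]
    apply Complex.ofReal_injective
    rw [h1, Complex.ofReal_prod]
    refine Finset.prod_congr rfl fun j _ => ?_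
    split_ifs <;> simp
  exact (pow_left_inj₀ (norm_nonneg _) (kappa_pos T).le two_ne_zero).1 h2

end Mixing

/-! ### The X-transform in coroot coordinates and its Jacobian -/

section Coordinates

open AddMonoidAlgebra (single)

variable {n : ℕ} {ι V N : Type*} [Finite ι] [AddCommGroup V] [Module ℝ V] [AddCommGroup N]
  [Module ℝ N] {P : RootPairing ι ℝ V N} [P.IsRootSystem] [P.IsCrystallographic] [P.IsReduced]
  (b : P.Base) (e : Fin n ≃ b.support)

/-- The coordinates on the coweight space given by the simple coroots. -/
noncomputable def ofCoord : (Fin n → ℝ) ≃ₗ[ℝ] N :=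
  (b.toCoweightBasis.reindex e.symm).equivFun.symm

theorem ofCoord_apply (t : Fin n → ℝ) : ofCoord b e t = ∑ k, t k • P.coroot (e k) := by
  rw [ofCoord, Module.Basis.equivFun_symm_apply]
  simp

theorem ofCoord_single (k : Fin n) : ofCoord b e (Pi.single k 1) = P.coroot (e k) := by
  rw [ofCoord_apply]
  simp [Pi.single_apply]

/-- The pairing with a weight, in coordinates. -/
noncomputable def coordForm (μ : V) : (Fin n → ℝ) →L[ℝ] ℝ :=
  LinearMap.toContinuousLinearMap (P.toLinearMap μ ∘ₗ (ofCoord b e).toLinearMap)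

theorem coordForm_apply (μ : V) (t : Fin n → ℝ) :
    coordForm b e μ t = P.toLinearMap μ (ofCoord b e t) := rfl

/-- The derivative of a formal exponential sum, in coordinates. -/
noncomputable def fderivExp (f : ExpAlg V) (t : Fin n → ℝ) : (Fin n → ℝ) →L[ℝ] ℂ :=
  ∑ μ ∈ f.coeff.support, (f.coeff μ * (expFun P μ (ofCoord b e t) * (2 * Real.pi * Complex.I))) •
    (Complex.ofRealCLM.comp (coordForm b e μ))

theorem fderivExp_apply (f : ExpAlg V) (t s : Fin n → ℝ) : fderivExp b e f t s =
    2 * Real.pi * Complex.I * evalExp P (ofCoord b e t) (derivExp P (ofCoord b e s) f) := by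
  rw [evalExp_derivExp, fderivExp, sum_apply, Finset.mul_sum]
  refine Finset.sum_congr rfl fun μ _ => ?_
  simp only [smul_apply, ContinuousLinearMap.comp_apply,
    Complex.ofRealCLM_apply, coordForm_apply, smul_eq_mul]
  ring

theorem hasFDerivAt_evalExp (f : ExpAlg V) (t : Fin n → ℝ) :
    HasFDerivAt (fun t => evalExp P (ofCoord b e t) f) (fderivExp b e f t) t := by
  simp only [evalExp_apply]
  refine HasFDerivAt.fun_sum fun μ _ => ?_
  have h1 : HasFDerivAt (fun t => 2 * Real.pi * Complex.I * ((coordForm b e μ t : ℝ) : ℂ))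
      ((2 * Real.pi * Complex.I : ℂ) • (Complex.ofRealCLM.comp (coordForm b e μ))) t :=
    (Complex.ofRealCLM.comp (coordForm b e μ)).hasFDerivAt.const_mul _
  have h2 := h1.cexp.const_mul (f.coeff μ)
  refine h2.congr_fderiv (ContinuousLinearMap.ext fun s => ?_)
  simp only [smul_apply, smul_eq_mul, expFun, coordForm_apply]
  ring

theorem continuous_evalExp (f : ExpAlg V) : Continuous fun t => evalExp P (ofCoord b e t) f :=
  continuous_iff_continuousAt.2 fun t => (hasFDerivAt_evalExp b e f t).continuousAt

variable [P.IsIrreducible] {T : SimpleType n}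

variable (T) in
theorem formalX_eq_sum (j : Fin n) :
    formalX b e T j = ∑ l, mixMatrix T j l • fundSum b (e l) := by
  simp only [mixMatrix, Matrix.of_apply, formalX]
  split_ifs <;> simp only [← smul_smul, ← Finset.smul_sum, add_smul, sub_smul, ite_smul, one_smul,
      zero_smul, Finset.sum_add_distrib, Finset.sum_sub_distrib, Finset.sum_ite_eq,
      Finset.mem_univ, if_true]

variable (T) in
/-- The derivative of the `X`-transform, in coordinates. -/
noncomputable def fderivX (t : Fin n → ℝ) : (Fin n → ℝ) →L[ℝ] (Fin n → ℝ) :=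
  ContinuousLinearMap.pi fun j => Complex.reCLM.comp (fderivExp b e (formalX b e T j) t)

variable (T) in
theorem hasFDerivAt_transformX (t : Fin n → ℝ) :
    HasFDerivAt (fun t => transformX T b e (ofCoord b e t)) (fderivX b e T t) t := by
  refine hasFDerivAt_pi.2 fun j => ?_
  have h := Complex.reCLM.hasFDerivAt.comp t (hasFDerivAt_evalExp b e (formalX b e T j) t)
  refine h.congr_of_eventuallyEq (Filter.Eventually.of_forall fun s => ?_)
  simp only [transformX, Function.comp_apply, evalExp_formalX, Complex.reCLM_apply]

/-- Taking real parts loses nothing: both sides are derivatives of one function, already known to be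
real. -/
theorem ofReal_fderivX (hT : b.cartanMatrix.submatrix e e = T.cartanMatrix) (t s : Fin n → ℝ)
    (j : Fin n) : ((fderivX b e T t s j : ℝ) : ℂ) = fderivExp b e (formalX b e T j) t s := by
  have h1 := hasFDerivAt_evalExp b e (formalX b e T j) t
  have h2 := Complex.ofRealCLM.hasFDerivAt.comp t
    (hasFDerivAt_pi.1 (hasFDerivAt_transformX b e T t) j)
  have h3 : (Complex.ofRealCLM ∘ fun t => transformX T b e (ofCoord b e t) j) =
      fun t => evalExp P (ofCoord b e t) (formalX b e T j) := by
    funext s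
    rw [evalExp_formalX, ← ofReal_transformX b e hT]
    rfl
  rw [h3] at h2
  exact DFunLike.congr_fun (h2.unique h1) s

/-- The derivative matrix is 2πi times the mixing matrix times the transposed Jacobian of the Z_j,
whose determinant is S_ρ. -/
theorem ofReal_det_fderivX (hT : b.cartanMatrix.submatrix e e = T.cartanMatrix)
    (t : Fin n → ℝ) : (((fderivX b e T t).det : ℝ) : ℂ) =
      (2 * Real.pi * Complex.I) ^ n * (mixMatrix T).det * orbitS P (rho b) (ofCoord b e t) := by
  classical
  set J : Matrix (Fin n) (Fin n) ℂ :=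
    ((jacobian b).map (evalExp P (ofCoord b e t))).submatrix e e with hJ
  have h1 : (LinearMap.toMatrix' (fderivX b e T t : (Fin n → ℝ) →ₗ[ℝ] (Fin n → ℝ))).map
      ((↑) : ℝ → ℂ) = (2 * Real.pi * Complex.I) • (mixMatrix T * J.transpose) := by
    ext j k
    rw [Matrix.map_apply, LinearMap.toMatrix'_apply, Matrix.smul_apply, Matrix.mul_apply]
    have h2 := ofReal_fderivX b e hT t (Pi.single k 1) j
    have hder : derivExp P (P.coroot (e k)) (formalX b e T j) =
        ∑ l, mixMatrix T j l • derivExp P (P.coroot (e k)) (fundSum b (e l)) := by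
      rw [formalX_eq_sum]
      refine AddMonoidAlgebra.coeff_injective (Finsupp.ext fun μ => ?_)
      simp only [coeff_derivExp, AddMonoidAlgebra.coeff_sum, Finsupp.finsetSum_apply,
        AddMonoidAlgebra.coeff_smul_apply, Finset.mul_sum, smul_eq_mul]
      exact Finset.sum_congr rfl fun l _ => by ring
    rw [fderivExp_apply, ofCoord_single, hder, map_sum] at h2
    refine Eq.trans ?_ (h2.trans ?_)
    · rfl
    · rw [smul_eq_mul]
      congr 1
      refine Finset.sum_congr rfl fun l _ => ?_
      rw [map_smul, smul_eq_mul]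
      rfl
  have h4 : (((fderivX b e T t).det : ℝ) : ℂ) =
      ((LinearMap.toMatrix' (fderivX b e T t : (Fin n → ℝ) →ₗ[ℝ] (Fin n → ℝ))).map
        ((↑) : ℝ → ℂ)).det := by
    rw [ContinuousLinearMap.det, ← LinearMap.det_toMatrix']
    exact Complex.ofRealHom.map_det _
  have h5 : J.det = orbitS P (rho b) (ofCoord b e t) := by
    rw [hJ, Matrix.det_submatrix_equiv_self, ← evalExp_alternatingSum, ← det_jacobian]
    exact ((evalExp P (ofCoord b e t)).toRingHom.map_det _).symm
  rw [h4, h1, Matrix.det_smul, Matrix.det_mul, Matrix.det_transpose, h5, Fintype.card_fin]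
  ring

theorem abs_det_fderivX (hT : b.cartanMatrix.submatrix e e = T.cartanMatrix) (t : Fin n → ℝ) :
    |(fderivX b e T t).det| = T.kappa * (2 * Real.pi) ^ n * ‖orbitS P (rho b) (ofCoord b e t)‖ := by
  have h := congrArg norm (ofReal_det_fderivX b e hT t)
  rw [Complex.norm_real, norm_mul, norm_mul, norm_pow, norm_det_mixMatrix, norm_mul, norm_mul,
    Complex.norm_I, mul_one, Complex.norm_ofNat, Complex.norm_real, Real.norm_eq_abs,
    Real.norm_eq_abs, abs_of_pos Real.pi_pos, mul_comm ((2 * Real.pi) ^ n)] at h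
  exact h

end Coordinates


section FundamentalDomain

open scoped Pointwise

variable {n : ℕ} {ι V N : Type*} [Finite ι] [AddCommGroup V] [Module ℝ V] [AddCommGroup N]
  [Module ℝ N] {P : RootPairing ι ℝ V N} [P.IsRootSystem] [P.IsCrystallographic] [P.IsReduced]
  (b : P.Base) (e : Fin n ≃ b.support)

/-! ### The alcove as a fundamental domain of the affine Weyl group -/

/-- The integer lattice, the coordinate version of the coroot lattice. -/
abbrev coordLattice (n : ℕ) : AddSubgroup (Fin n → ℝ) :=
  (Submodule.span ℤ (Set.range (Pi.basisFun ℝ (Fin n)))).toAddSubgroup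

instance : Countable (coordLattice n) :=
  inferInstanceAs (Countable (Submodule.span ℤ (Set.range (Pi.basisFun ℝ (Fin n)))))

theorem ofCoord_mem_corootLattice {g : Fin n → ℝ} (hg : g ∈ coordLattice n) :
    ofCoord b e g ∈ corootLattice b := by
  rw [Submodule.mem_toAddSubgroup] at hg
  induction hg using Submodule.span_induction with
  | mem g hg =>
    obtain ⟨k, rfl⟩ := hg
    rw [Pi.basisFun_apply, ofCoord_single]
    exact coroot_mem_corootLattice b _
  | zero => rw [map_zero]; exact zero_mem _
  | add g h _ _ h1 h2 => rw [map_add]; exact add_mem h1 h2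
  | smul k g _ h1 => rw [map_zsmul]; exact zsmul_mem h1 k

theorem symm_ofCoord_mem_coordLattice {q : N} (hq : q ∈ corootLattice b) :
    (ofCoord b e).symm q ∈ coordLattice n := by
  rw [Submodule.mem_toAddSubgroup]
  induction hq using AddSubgroup.closure_induction with
  | mem q hq =>
    obtain ⟨i, hi, rfl⟩ := hq
    have h : P.coroot i = ofCoord b e (Pi.single (e.symm ⟨i, hi⟩) 1) := by
      rw [ofCoord_single, Equiv.apply_symm_apply]
    rw [h, LinearEquiv.symm_apply_apply]
    exact Submodule.subset_span ⟨_, Pi.basisFun_apply _ _ _⟩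
  | zero => rw [map_zero]; exact zero_mem _
  | add g h _ _ h1 h2 => rw [map_add]; exact add_mem h1 h2
  | neg g _ h1 => rw [map_neg]; exact neg_mem h1

theorem ae_root_ne_int : ∀ᵐ t : Fin n → ℝ, ∀ i, ∀ k : ℤ,
    P.toLinearMap (P.root i) (ofCoord b e t) ≠ k := by
  rw [ae_all_iff]
  intro i
  rw [ae_all_iff]
  intro k
  rw [ae_iff]
  simp only [ne_eq, not_not]
  set S : Set (Fin n → ℝ) := {t | P.toLinearMap (P.root i) (ofCoord b e t) = k}
  rcases S.eq_empty_or_nonempty with h | ⟨p, hp⟩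
  · rw [h, measure_empty]
  · set A := AffineSubspace.mk' p (LinearMap.ker (P.toLinearMap (P.root i) ∘ₗ
      (ofCoord b e).toLinearMap))
    have hA : S ⊆ A := fun t ht => by
      rw [SetLike.mem_coe, AffineSubspace.mem_mk', LinearMap.mem_ker]
      have h1 : P.toLinearMap (P.root i) (ofCoord b e t) = k := ht
      have h2 : P.toLinearMap (P.root i) (ofCoord b e p) = k := hp
      simp [h1, h2]
    refine measure_mono_null hA (Measure.addHaar_affineSubspace _ _ fun h => ?_)
    -- The hyperplane is proper because the root takes the value 2 on its coroot.
    have h1 : (ofCoord b e).symm (P.coroot i) ∈ A.direction := by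
      rw [h, AffineSubspace.direction_top]
      trivial
    rw [AffineSubspace.direction_mk', LinearMap.mem_ker] at h1
    simp at h1

/-- The action of a Weyl group element in coordinates. -/
noncomputable def coordAct (w : P.weylGroup) : (Fin n → ℝ) ≃ₗ[ℝ] (Fin n → ℝ) :=
  (ofCoord b e).trans ((coact w).trans (ofCoord b e).symm)

theorem ofCoord_coordAct (w : P.weylGroup) (t : Fin n → ℝ) :
    ofCoord b e (coordAct b e w t) = coact w (ofCoord b e t) := by
  simp [coordAct]

/-- w has finite order, so some positive power of its determinant is 1. -/
theorem abs_det_coordAct (w : P.weylGroup) :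
    |LinearMap.det (coordAct b e w : (Fin n → ℝ) →ₗ[ℝ] (Fin n → ℝ))| = 1 := by
  have hpow (k : ℕ) (t : Fin n → ℝ) :
      ofCoord b e (((coordAct b e w : (Fin n → ℝ) →ₗ[ℝ] (Fin n → ℝ)) ^ k) t) =
        coact (w ^ k) (ofCoord b e t) := by
    induction k generalizing t with
    | zero => simp
    | succ k ih =>
      rw [pow_succ, Module.End.mul_apply, ih, LinearEquiv.coe_coe, ofCoord_coordAct, pow_succ',
        coact_mul]
  have h1 : (coordAct b e w : (Fin n → ℝ) →ₗ[ℝ] (Fin n → ℝ)) ^ orderOf w = 1 := by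
    ext1 k
    refine LinearMap.ext fun s => (ofCoord b e).injective ?_
    rw [LinearMap.comp_apply, hpow, pow_orderOf_eq_one, coact_one]
    rfl
  have h2 := congrArg LinearMap.det h1
  rw [map_pow, map_one] at h2
  have h3 : orderOf w ≠ 0 := (orderOf_pos w).ne'
  rw [← pow_eq_one_iff_of_nonneg (abs_nonneg _) h3, ← abs_pow, h2, abs_one]

theorem measurePreserving_coordAct (w : P.weylGroup) :
    MeasurePreserving (coordAct b e w : (Fin n → ℝ) → (Fin n → ℝ)) := by
  have h := abs_det_coordAct b e w
  have h0 : LinearMap.det (coordAct b e w : (Fin n → ℝ) →ₗ[ℝ] (Fin n → ℝ)) ≠ 0 := by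
    intro h0
    rw [h0, abs_zero] at h
    exact zero_ne_one h
  refine ⟨(LinearMap.continuous_on_pi (coordAct b e w).toLinearMap).measurable, ?_⟩
  have h1 := Real.map_linearMap_volume_pi_eq_smul_volume_pi h0
  rw [abs_inv, h, inv_one, ENNReal.ofReal_one, one_smul] at h1
  exact h1

theorem measurableSet_preimage_openAlcove : MeasurableSet (ofCoord b e ⁻¹' openAlcove b) := by
  have h1 : ofCoord b e ⁻¹' openAlcove b =
      (⋂ j : b.support, {t | 0 < coordForm b e (P.root j) t}) ∩
        {t | coordForm b e (highestRoot b) t < 1} := by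
    ext t
    simp [openAlcove, coordForm_apply]
  rw [h1]
  exact (MeasurableSet.iInter fun j => (isOpen_lt continuous_const
    (coordForm b e _).continuous).measurableSet).inter
    (isOpen_lt (coordForm b e _).continuous continuous_const).measurableSet

theorem measurableSet_preimage_alcove : MeasurableSet (ofCoord b e ⁻¹' alcove b) := by
  have h1 : ofCoord b e ⁻¹' alcove b =
      (⋂ j : b.support, {t | 0 ≤ coordForm b e (P.root j) t}) ∩
        {t | coordForm b e (highestRoot b) t ≤ 1} := by
    ext t
    simp [alcove, coordForm_apply]
  rw [h1]
  exact (MeasurableSet.iInter fun j => (isClosed_le continuous_const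
    (coordForm b e _).continuous).measurableSet).inter
    (isClosed_le (coordForm b e _).continuous continuous_const).measurableSet

variable [P.IsIrreducible]

/-- The union of the images of the open alcove under the Weyl group, in coordinates. -/
def openStar : Set (Fin n → ℝ) := ⋃ w : P.weylGroup, coordAct b e w ⁻¹' (ofCoord b e ⁻¹' openAlcove b)

theorem mem_preimage_openAlcove (w : P.weylGroup) (t : Fin n → ℝ) :
    t ∈ coordAct b e w ⁻¹' (ofCoord b e ⁻¹' openAlcove b) ↔
      coact w (ofCoord b e t) ∈ openAlcove b := by
  rw [Set.mem_preimage, Set.mem_preimage, ofCoord_coordAct]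

theorem eq_of_mem_openAlcove {w w' : P.weylGroup} {x q : N} (hq : q ∈ corootLattice b)
    (hx : coact w x ∈ openAlcove b) (hx' : coact w' (x + q) ∈ openAlcove b) : w = w' ∧ q = 0 := by
  have h1 : coact (w⁻¹ * w') (coact w x) + coact w' q ∈ alcove b := by
    rw [coact_mul, coact_inv_coact, ← map_add]
    exact openAlcove_subset_alcove b hx'
  obtain ⟨h2, h3⟩ := eq_one_of_mapsTo_openAlcove b (coact_mem_corootLattice b w' hq) hx h1
  exact ⟨inv_mul_eq_one.1 h2, (LinearEquiv.map_eq_zero_iff _).1 h3⟩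

/-- Almost every point avoids the reflection hyperplanes and so is equivalent to a point of the open
alcove. Distinct lattice translates of the star are disjoint because only the trivial affine element
maps a point of the open alcove into the alcove. -/
theorem isAddFundamentalDomain_openStar :
    IsAddFundamentalDomain (coordLattice n) (openStar b e) := by
  refine IsAddFundamentalDomain.mk'' ?_ ?_ ?_ ?_
  · exact (MeasurableSet.iUnion fun w => (measurePreserving_coordAct b e w).measurable
      (measurableSet_preimage_openAlcove b e)).nullMeasurableSet
  · filter_upwards [ae_root_ne_int b e] with t ht
    obtain ⟨y, hy, w, hw⟩ := exists_affWeylEquiv_mem_alcove b (ofCoord b e t)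
    have hy' : y ∈ openAlcove b := by
      refine mem_openAlcove_of_root_ne b hy fun i k hk => ?_
      obtain ⟨l, hl⟩ := exists_int_of_mem_corootLattice b (root_mem_weightLattice (P := P) i) hw
      refine ht (w • i) (k - l) ?_
      rw [← root_smul_coact, Int.cast_sub, ← hk, ← hl, map_sub, sub_sub_cancel]
    refine ⟨⟨(ofCoord b e).symm (coact w⁻¹ (y - coact w (ofCoord b e t))),
      symm_ofCoord_mem_coordLattice b e (coact_mem_corootLattice b _ hw)⟩, ?_⟩
    refine Set.mem_iUnion.2 ⟨w, (mem_preimage_openAlcove b e w _).2 ?_⟩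
    rw [AddSubgroup.vadd_def, vadd_eq_add, map_add, LinearEquiv.apply_symm_apply, map_add,
      coact_coact_inv, sub_add_cancel]
    exact hy'
  · intro g hg
    refine Disjoint.aedisjoint (Set.disjoint_left.2 fun t ht ht' => hg ?_)
    obtain ⟨s, hs, rfl⟩ := ht
    obtain ⟨w, hw⟩ := Set.mem_iUnion.1 hs
    obtain ⟨w', hw'⟩ := Set.mem_iUnion.1 ht'
    rw [mem_preimage_openAlcove] at hw hw'
    have h1 : ofCoord b e (g +ᵥ s) = ofCoord b e s + ofCoord b e g := by
      rw [AddSubgroup.vadd_def, vadd_eq_add, map_add, add_comm]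
    simp only [h1] at hw'
    have h2 := (eq_of_mem_openAlcove b (ofCoord_mem_corootLattice b e g.2) hw hw').2
    exact Subtype.ext ((LinearEquiv.map_eq_zero_iff _).1 h2)
  · exact fun g => (measurePreserving_vadd g volume).quasiMeasurePreserving

/-! ### Integration of exponential sums over the torus and the alcove -/

theorem evalExp_vadd {f : ExpAlg V} (hf : f ∈ expSubalgebra (weightLattice P))
    (g : coordLattice n) (t : Fin n → ℝ) :
    evalExp P (ofCoord b e (g +ᵥ t)) f = evalExp P (ofCoord b e t) f := by
  rw [AddSubgroup.vadd_def, vadd_eq_add, map_add, add_comm]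
  exact evalExp_add_mem b hf _ (ofCoord_mem_corootLattice b e g.2)

theorem continuous_expFun (μ : V) : Continuous fun t => expFun P μ (ofCoord b e t) := by
  have h := continuous_evalExp b e (AddMonoidAlgebra.single μ (1 : ℂ))
  simpa only [evalExp_single, one_mul] using h

open Classical in
theorem integral_expFun {μ : V} (hμ : μ ∈ weightLattice P) :
    ∫ t in ZSpan.fundamentalDomain (Pi.basisFun ℝ (Fin n)), expFun P μ (ofCoord b e t) =
      if μ = 0 then 1 else 0 := by
  set D := ZSpan.fundamentalDomain (Pi.basisFun ℝ (Fin n)) with hD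
  have hfd := ZSpan.isAddFundamentalDomain' (Pi.basisFun ℝ (Fin n)) volume
  have hper (g : coordLattice n) (t : Fin n → ℝ) :
      expFun P μ (ofCoord b e (g +ᵥ t)) = expFun P μ (ofCoord b e t) := by
    rw [AddSubgroup.vadd_def, vadd_eq_add, map_add, add_comm]
    exact expFun_add_mem b hμ _ (ofCoord_mem_corootLattice b e g.2)
  split_ifs with h0
  · subst h0
    have h1 : volume D = 1 := by
      rw [hD, ZSpan.fundamentalDomain_pi_basisFun, Real.volume_pi_Ico]
      simp
    simp [expFun, h1, Measure.real]
  · obtain ⟨x, hx⟩ : ∃ x, P.toLinearMap μ x ≠ 0 := by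
      by_contra! h
      exact h0 (P.toLinearMap.toPerfPair.injective (LinearMap.ext fun x => by simpa using h x))
    -- The shift is scaled so that μ takes the value 1/2 on it; translating the domain by it then
    -- multiplies the integral by a factor other than 1.
    set s := (ofCoord b e).symm ((1 / (2 * P.toLinearMap μ x)) • x) with hs
    have hs1 : expFun P μ (ofCoord b e s) ≠ 1 := by
      rw [Ne, expFun_eq_one_iff, hs, LinearEquiv.apply_symm_apply, map_smul, smul_eq_mul]
      rintro ⟨k, hk⟩
      have h1 : (1 : ℝ) = 2 * k := by
        rw [← hk]; field_simp
      have h2 : (1 : ℤ) = 2 * k := by exact_mod_cast h1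
      omega
    have hfd' := hfd.vadd_of_comm s
    have h1 := hfd'.setIntegral_eq hfd (f := fun t => expFun P μ (ofCoord b e t)) hper
    have h2 : ∫ t in s +ᵥ D, expFun P μ (ofCoord b e t) =
        ∫ t in D, expFun P μ (ofCoord b e (s + t)) := by
      have := (measurePreserving_vadd s (volume : Measure (Fin n → ℝ))).setIntegral_image_emb
        (measurableEmbedding_const_vadd s) (fun t => expFun P μ (ofCoord b e t)) D
      exact this
    rw [h2] at h1
    have h3 (t : Fin n → ℝ) : expFun P μ (ofCoord b e (s + t)) =
        expFun P μ (ofCoord b e s) * expFun P μ (ofCoord b e t) := by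
      simp only [expFun, ← Complex.exp_add, map_add, Complex.ofReal_add, mul_add]
    simp only [h3, integral_const_mul] at h1
    have h4 : (expFun P μ (ofCoord b e s) - 1) * ∫ t in D, expFun P μ (ofCoord b e t) = 0 := by
      rw [sub_mul, one_mul, h1, sub_self]
    exact (mul_eq_zero.1 h4).resolve_left (sub_ne_zero.2 hs1)

theorem integrableOn_evalExp (f : ExpAlg V) {s : Set (Fin n → ℝ)} (hs : Bornology.IsBounded s) :
    IntegrableOn (fun t => evalExp P (ofCoord b e t) f) s :=
  ((continuous_evalExp b e f).continuousOn.integrableOn_compact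
    (hs.isCompact_closure)).mono_set subset_closure

theorem integral_evalExp {f : ExpAlg V} (hf : f ∈ expSubalgebra (weightLattice P)) :
    ∫ t in ZSpan.fundamentalDomain (Pi.basisFun ℝ (Fin n)), evalExp P (ofCoord b e t) f =
      f.coeff 0 := by
  classical
  have hb := ZSpan.fundamentalDomain_isBounded (Pi.basisFun ℝ (Fin n))
  simp only [evalExp_apply]
  rw [integral_finsetSum]
  · have h1 (μ : V) (hμ : μ ∈ f.coeff.support) :
        ∫ t in ZSpan.fundamentalDomain (Pi.basisFun ℝ (Fin n)),
          f.coeff μ * expFun P μ (ofCoord b e t) = if μ = 0 then f.coeff μ else 0 := by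
      rw [integral_const_mul, integral_expFun b e (hf μ (Finsupp.mem_support_iff.1 hμ)), mul_ite,
        mul_one, mul_zero]
    rw [Finset.sum_congr rfl h1, Finset.sum_ite_eq']
    simp only [Finsupp.mem_support_iff, ne_eq, ite_not]
    split_ifs with h
    · exact h.symm
    · rfl
  · intro μ _
    exact (((continuous_expFun b e μ).continuousOn.integrableOn_compact
      hb.isCompact_closure).mono_set subset_closure).const_mul _

theorem integrableOn_openStar {f : ExpAlg V} (hf : f ∈ expSubalgebra (weightLattice P)) :
    IntegrableOn (fun t => evalExp P (ofCoord b e t) f) (openStar b e) :=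
  ((isAddFundamentalDomain_openStar b e).integrableOn_iff
    (ZSpan.isAddFundamentalDomain' (Pi.basisFun ℝ (Fin n)) volume) (evalExp_vadd b e hf)).2
    (integrableOn_evalExp b e f (ZSpan.fundamentalDomain_isBounded (Pi.basisFun ℝ (Fin n))))

theorem integrableOn_openAlcove {f : ExpAlg V} (hf : f ∈ expSubalgebra (weightLattice P)) :
    IntegrableOn (fun t => evalExp P (ofCoord b e t) f) (ofCoord b e ⁻¹' openAlcove b) :=
  (integrableOn_openStar b e hf).mono_set fun t ht => Set.mem_iUnion.2
    ⟨1, (mem_preimage_openAlcove b e 1 t).2 (by rwa [coact_one])⟩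

/-- The star and the unit cube are both fundamental domains of the integer lattice. Over the star
the integral splits into |W| equal pieces, over the cube it is the constant term. -/
theorem card_mul_integral_openAlcove {f : ExpAlg V} (hf : f ∈ expSubalgebra (weightLattice P))
    (hinv : ∀ w : P.weylGroup, actExp w f = f) :
    (Nat.card P.weylGroup : ℂ) * ∫ t in ofCoord b e ⁻¹' openAlcove b, evalExp P (ofCoord b e t) f =
      f.coeff 0 := by
  have hfd := ZSpan.isAddFundamentalDomain' (Pi.basisFun ℝ (Fin n)) volume
  have hper := evalExp_vadd b e hf
  rw [← integral_evalExp b e hf, ← (isAddFundamentalDomain_openStar b e).setIntegral_eq hfd hper,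
    openStar, integral_iUnion_fintype]
  · have h1 (w : P.weylGroup) : ∫ t in coordAct b e w ⁻¹' (ofCoord b e ⁻¹' openAlcove b),
        evalExp P (ofCoord b e t) f =
          ∫ t in ofCoord b e ⁻¹' openAlcove b, evalExp P (ofCoord b e t) f := by
      have hemb : MeasurableEmbedding (coordAct b e w) :=
        (LinearEquiv.toContinuousLinearEquiv (coordAct b e w)).toHomeomorph.measurableEmbedding
      have h2 := (measurePreserving_coordAct b e w).setIntegral_preimage_emb hemb
        (fun t => evalExp P (ofCoord b e t) f) (ofCoord b e ⁻¹' openAlcove b)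
      simpa only [ofCoord_coordAct, ← evalExp_actExp, hinv] using h2
    rw [Finset.sum_congr rfl fun w _ => h1 w, Finset.sum_const, Finset.card_univ, nsmul_eq_mul,
      Nat.card_eq_fintype_card]
  · exact fun w => (measurePreserving_coordAct b e w).measurable
      (measurableSet_preimage_openAlcove b e)
  · intro w w' hww
    refine Set.disjoint_left.2 fun t ht ht' => hww ?_
    rw [mem_preimage_openAlcove] at ht ht'
    refine (eq_of_mem_openAlcove b (zero_mem _) ht ?_).1
    rwa [add_zero]
  · exact fun w => (integrableOn_openStar b e hf).mono_set (Set.subset_iUnion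
      (fun w : P.weylGroup => coordAct b e w ⁻¹' (ofCoord b e ⁻¹' openAlcove b)) w)

end FundamentalDomain


section Cubature

variable {n : ℕ} {ι V N : Type*} [Finite ι] [AddCommGroup V] [Module ℝ V] [AddCommGroup N]
  [Module ℝ N] {P : RootPairing ι ℝ V N} [P.IsRootSystem] [P.IsCrystallographic] [P.IsReduced]
  [P.IsIrreducible] (b : P.Base) (e : Fin n ≃ b.support) {T : SimpleType n}

/-! ### Uniqueness of the weight polynomial -/

theorem contDiff_evalExp (f : ExpAlg V) : ContDiff ℝ 1 fun t => evalExp P (ofCoord b e t) f := by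
  simp only [evalExp_apply]
  refine ContDiff.sum fun μ _ => contDiff_const.mul (ContDiff.cexp (contDiff_const.mul ?_))
  exact (Complex.ofRealCLM.comp (coordForm b e μ)).contDiff

variable (T) in
theorem hasStrictFDerivAt_transformX (t : Fin n → ℝ) :
    HasStrictFDerivAt (fun t => transformX T b e (ofCoord b e t)) (fderivX b e T t) t := by
  have h1 : ContDiff ℝ 1 fun t => transformX T b e (ofCoord b e t) := by
    refine contDiff_pi.2 fun j => ?_
    have h2 := Complex.reCLM.contDiff.comp (contDiff_evalExp b e (formalX b e T j))
    simp only [Function.comp_def, evalExp_formalX] at h2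
    exact h2
  have h3 := h1.contDiffAt.hasStrictFDerivAt (x := t) one_ne_zero
  rwa [(hasFDerivAt_transformX b e T t).fderiv] at h3

/-- The derivative of X is invertible at an interior point of the alcove, so the image of X contains
a box, and a polynomial is determined by its values on a product of infinite sets. -/
theorem eq_of_evalReal_transformX_eq (hT : b.cartanMatrix.submatrix e e = T.cartanMatrix)
    {p q : MvPolynomial (Fin n) ℂ}
    (h : ∀ x : N, evalReal p (transformX T b e x) = evalReal q (transformX T b e x)) : p = q := by
  obtain ⟨x, hx⟩ := nonempty_openAlcove b
  have h1 := orbitS_ne_zero_of_mem_openAlcove b hx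
  have hdet : (fderivX b e T ((ofCoord b e).symm x)).det ≠ 0 := by
    have h2 := ofReal_det_fderivX b e hT ((ofCoord b e).symm x)
    rw [LinearEquiv.apply_symm_apply] at h2
    have h3 : (mixMatrix T).det ≠ 0 := by
      rw [← norm_ne_zero_iff, norm_det_mixMatrix]
      exact (kappa_pos T).ne'
    rw [← Complex.ofReal_ne_zero, h2]
    exact mul_ne_zero (mul_ne_zero (pow_ne_zero _ Complex.two_pi_I_ne_zero) h3) h1
  have hrange : (fderivX b e T ((ofCoord b e).symm x)).range = ⊤ := by
    rw [← LinearMap.isUnit_iff_range_eq_top, LinearMap.isUnit_iff_isUnit_det]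
    exact hdet.isUnit
  have h2 := (hasStrictFDerivAt_transformX b e T ((ofCoord b e).symm x)).map_nhds_eq_of_surj hrange
  have h3 : Set.range (fun t => transformX T b e (ofCoord b e t)) ∈
      nhds (transformX T b e (ofCoord b e ((ofCoord b e).symm x))) := by
    rw [← h2]
    exact Filter.range_mem_map
  obtain ⟨r, hr, hball⟩ := Metric.mem_nhds_iff.1 h3
  rw [ball_pi _ hr] at hball
  refine MvPolynomial.funext_set (fun j => ((↑) : ℝ → ℂ) '' Metric.ball
    (transformX T b e (ofCoord b e ((ofCoord b e).symm x)) j) r) (fun j => ?_) fun y hy => ?_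
  · rw [Real.ball_eq_Ioo]
    exact (Set.Ioo_infinite (by linarith)).image Complex.ofReal_injective.injOn
  · choose z hz hzy using fun j => hy j trivial
    obtain ⟨t, ht⟩ := hball fun j _ => hz j
    have h4 := h (ofCoord b e t)
    simp only at ht
    rw [ht] at h4
    have h5 : y = fun j => (z j : ℂ) := funext fun j => (hzy j).symm
    rw [h5]
    exact h4

theorem existsUnique_isWeightPolynomial (hT : b.cartanMatrix.submatrix e e = T.cartanMatrix) :
    ∃! K, IsWeightPolynomial T b e K := by
  obtain ⟨K, hK⟩ := exists_isWeightPolynomial b e hT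
  exact ⟨K, hK, fun K' hK' => eq_of_evalReal_transformX_eq b e hT fun x => (hK' x).trans (hK x).symm⟩

/-! ### The integral over `Ω` -/

theorem domainOmega_eq :
    domainOmega T b e = (fun t => transformX T b e (ofCoord b e t)) '' (ofCoord b e ⁻¹' alcove b) := by
  rw [domainOmega, simplexF_eq_alcove, ← Function.comp_def (transformX T b e), Set.image_comp,
    Set.image_preimage_eq _ (ofCoord b e).surjective]

theorem injOn_transformX_ofCoord (hT : b.cartanMatrix.submatrix e e = T.cartanMatrix) :
    Set.InjOn (fun t => transformX T b e (ofCoord b e t)) (ofCoord b e ⁻¹' alcove b) := by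
  intro t ht s hs h
  refine (ofCoord b e).injective (injOn_transformX b e hT ?_ ?_ h) <;> rwa [simplexF_eq_alcove]

/-- This includes s = 0, where both sides are 0 by convention; that case occurs on the walls of the
alcove. -/
theorem sq_cpow_neg_half {s : ℝ} (hs : 0 ≤ s) : (((s ^ 2 : ℝ) : ℂ)) ^ (-(1 / 2) : ℂ) = ((s⁻¹ : ℝ) : ℂ) := by
  have h1 : (-(1 / 2) : ℂ) = ((-(1 / 2) : ℝ) : ℂ) := by push_cast; rfl
  rw [h1, ← Complex.ofReal_cpow (sq_nonneg s), Real.rpow_neg (sq_nonneg s), ← Real.sqrt_eq_rpow,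
    Real.sqrt_sq hs]

/-- Inside the alcove the factor |S_ρ| of the Jacobian cancels K^(-1/2). On the walls the Jacobian
vanishes, which the indicator records, so the identity holds at every point of the closed alcove. -/
theorem abs_det_smul_integrand (hT : b.cartanMatrix.submatrix e e = T.cartanMatrix)
    {K : MvPolynomial (Fin n) ℂ} (hK : IsWeightPolynomial T b e K) (p : MvPolynomial (Fin n) ℂ)
    {t : Fin n → ℝ} (ht : t ∈ ofCoord b e ⁻¹' alcove b) :
    |(fderivX b e T t).det| • (evalReal p (transformX T b e (ofCoord b e t)) *
        evalReal K (transformX T b e (ofCoord b e t)) ^ (-(1 / 2) : ℂ)) =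
      (ofCoord b e ⁻¹' openAlcove b).indicator (fun t => ((T.kappa * (2 * Real.pi) ^ n : ℝ) : ℂ) *
        evalExp P (ofCoord b e t) (MvPolynomial.aeval (formalX b e T) p)) t := by
  rw [hK, abs_det_fderivX b e hT, sq_cpow_neg_half (norm_nonneg _), evalReal_transformX b e hT]
  by_cases h : t ∈ ofCoord b e ⁻¹' openAlcove b
  · rw [Set.indicator_of_mem h]
    have h1 : (‖orbitS P (rho b) (ofCoord b e t)‖ : ℂ) ≠ 0 := by
      rw [Complex.ofReal_ne_zero, norm_ne_zero_iff]
      exact orbitS_ne_zero_of_mem_openAlcove b h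
    rw [Complex.real_smul]
    push_cast
    field_simp
  · rw [Set.indicator_of_notMem h]
    have h1 : orbitS P (rho b) (ofCoord b e t) = 0 := by
      by_contra h2
      exact h (mem_openAlcove_of_root_ne b ht ((orbitS_rho_ne_zero_iff b _).1 h2))
    rw [h1, norm_zero, mul_zero, zero_smul]

theorem integrableOn_domainOmega (hT : b.cartanMatrix.submatrix e e = T.cartanMatrix)
    {K : MvPolynomial (Fin n) ℂ} (hK : IsWeightPolynomial T b e K) (p : MvPolynomial (Fin n) ℂ) :
    IntegrableOn (fun y => evalReal p y * evalReal K y ^ (-(1 / 2) : ℂ)) (domainOmega T b e) := by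
  rw [domainOmega_eq, integrableOn_image_iff_integrableOn_abs_det_fderiv_smul volume
    (measurableSet_preimage_alcove b e)
    (fun t _ => (hasFDerivAt_transformX b e T t).hasFDerivWithinAt)
    (injOn_transformX_ofCoord b e hT),
    integrableOn_congr_fun (fun t ht => abs_det_smul_integrand b e hT hK p ht)
      (measurableSet_preimage_alcove b e)]
  refine Integrable.integrableOn ?_
  rw [integrable_indicator_iff (measurableSet_preimage_openAlcove b e)]
  exact (integrableOn_openAlcove b e (aeval_formalX_mem b e p)).const_mul _

theorem integral_domainOmega (hT : b.cartanMatrix.submatrix e e = T.cartanMatrix)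
    {K : MvPolynomial (Fin n) ℂ} (hK : IsWeightPolynomial T b e K) (p : MvPolynomial (Fin n) ℂ) :
    (Nat.card P.weylGroup : ℂ) *
        ∫ y in domainOmega T b e, evalReal p y * evalReal K y ^ (-(1 / 2) : ℂ) =
      ((T.kappa * (2 * Real.pi) ^ n : ℝ) : ℂ) * (MvPolynomial.aeval (formalX b e T) p).coeff 0 := by
  rw [domainOmega_eq, integral_image_eq_integral_abs_det_fderiv_smul volume
    (measurableSet_preimage_alcove b e)
    (fun t _ => (hasFDerivAt_transformX b e T t).hasFDerivWithinAt)
    (injOn_transformX_ofCoord b e hT),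
    setIntegral_congr_fun (measurableSet_preimage_alcove b e)
      (fun t ht => abs_det_smul_integrand b e hT hK p ht),
    setIntegral_indicator (measurableSet_preimage_openAlcove b e),
    Set.inter_eq_right.2 (Set.preimage_mono (openAlcove_subset_alcove b)), integral_const_mul,
    mul_left_comm, card_mul_integral_openAlcove b e (aeval_formalX_mem b e p)
      fun w => actExp_aeval_formalX b e w p]

end Cubature

end OrbitCubature

/-! ### The cubature formula -/

theorem mainTheorem1 {n : ℕ} (T : SimpleType n)
    {ι V N : Type*} [Finite ι] [AddCommGroup V] [Module ℝ V] [AddCommGroup N] [Module ℝ N]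
    (P : RootPairing ι ℝ V N) [P.IsRootSystem] [P.IsCrystallographic] [P.IsReduced]
    [P.IsIrreducible] (b : P.Base) (e : Fin n ≃ b.support)
    (hT : b.cartanMatrix.submatrix e e = T.cartanMatrix) :
    -- the functions `X_j` are real-valued
    (∀ x j, ((transformX T b e x j : ℝ) : ℂ) = complexX T b e x j) ∧
    -- the weight polynomial exists and is unique
    (∃! K, IsWeightPolynomial T b e K) ∧
    -- the nodes correspond one-to-one to the points of the finite grid
    (∀ M : ℕ, 0 < M →
      (gridF b e M).Finite ∧ Set.InjOn (transformX T b e) (gridF b e M)) ∧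
    -- the cubature formula
    (∀ K, IsWeightPolynomial T b e K → ∀ M : ℕ, 0 < M →
      ∀ p : MvPolynomial (Fin n) ℂ, MDegreeLE b e p (2 * M - 1) →
        IntegrableOn (fun y => evalReal p y * evalReal K y ^ (-(1 / 2) : ℂ))
          (domainOmega T b e) ∧
        ∫ y in domainOmega T b e, evalReal p y * evalReal K y ^ (-(1 / 2) : ℂ) =
          ((T.kappa / ((b.cartanMatrix.submatrix e e).det * Nat.card P.weylGroup) *
              (2 * Real.pi / M) ^ n : ℝ) : ℂ) *
            ∑ᶠ y ∈ nodesOmega T b e M, (nodeSize T b e M y : ℂ) * evalReal p y) := by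

  classical
  refine ⟨ofReal_transformX b e hT, existsUnique_isWeightPolynomial b e hT, fun M hM =>
    ⟨finite_gridF b e M, (injOn_transformX b e hT).mono (gridF_subset_simplexF b e hM)⟩,
    fun K hK M hM p hp => ⟨integrableOn_domainOmega b e hT hK p, ?_⟩⟩
  -- Integral and sum are both expressed by the constant term of p(X); only the constants remain to
  -- be compared.
  have h1 := integral_domainOmega b e hT hK p
  have hW : (Nat.card P.weylGroup : ℂ) ≠ 0 := by exact_mod_cast Nat.card_pos.ne'
  have hM' : (M : ℂ) ≠ 0 := by exact_mod_cast hM.ne'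
  have hc : ((b.cartanMatrix.submatrix e e).det : ℂ) ≠ 0 := by
    rw [Matrix.det_submatrix_equiv_self]
    exact_mod_cast (det_cartanMatrix_pos b).ne'
  rw [finsum_nodesOmega b e hT hM hp, eq_div_of_mul_eq hW ((mul_comm _ _).trans h1)]
  generalize (b.cartanMatrix.submatrix e e).det = c at hc ⊢
  push_cast
  rw [div_pow]
  field_simp
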